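/- For positive integers $m,n$, let the $m\times n$ grid be the graph whose vertices are the integer points $(x,y)$ with $1\le x\le m$ and $1\le y\le n$ and whose edges are the unit segments joining these points; its cells are the $(m-1)(n-1)$ unit squares bounded by four of its edges. The signature of a cycle $C$ in the grid is the function that assigns to each cell the number of edges of that cell which belong to $C$. The difference of two cycles is the set of all edges which belong to exactly one of them. Let $m \ge 2$ and $n\ge 2$ be integers with $d=\gcd(m,n)$, $m=dm'$, and $n=dn'$. Define $$\delta_{m,n}=\begin{cases}1 & \text{if } d \text{ is odd},\\ 0 & \text{if } d\equiv 0 \pmod 4,\\ 0 & \text{if } d\equiv 2 \pmod 4,\ m\ge 4,\ n\ge 4,\text{ and } mn/d^2 \text{ is even},\\ 4 & \text{otherwise.}\end{cases}$$ Then the greatest possible size of the difference between two (not necessarily distinct) cycles on the $m\times n$ grid with the same signature is exactly $mn-\delta_{m,n}m'n'$. -/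

import Mathlib

namespace Slitherlink

/-- The grid of size `m × n`, counted in vertices: the vertices are the points `(x, y)` with
`0 ≤ x < m` and `0 ≤ y < n`, and two of them are joined when they are at distance one. -/
abbrev grid (m n : ℕ) : SimpleGraph (Fin m × Fin n) :=
  SimpleGraph.boxProd (SimpleGraph.pathGraph m) (SimpleGraph.pathGraph n)

/-- `C` is the edge set of a cycle (simple closed walk) of the `m × n` grid. -/
def IsCycle {m n : ℕ} (C : Finset (Sym2 (Fin m × Fin n))) : Prop :=
  ∃ (u : Fin m × Fin n) (p : (grid m n).Walk u u), p.IsCycle ∧ p.edges.toFinset = C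

/-- The unit square cells, that is, the finite faces, of the `m × n` grid, each one labelled by
the coordinates of its lower left vertex. -/
abbrev Cell (m n : ℕ) : Type := Fin (m - 1) × Fin (n - 1)

/-- The vertex `(x + a, y + b)` of the cell with lower left vertex `(x, y)`, for `a, b` in
`{0, 1}`. -/
def Cell.vertex {m n : ℕ} (c : Cell m n) (a b : Fin 2) : Fin m × Fin n :=
  (⟨c.1.val + a.val, by omega⟩, ⟨c.2.val + b.val, by omega⟩)

/-- The lower, upper, left, and right edges of a cell. -/
def Cell.edges {m n : ℕ} (c : Cell m n) : Finset (Sym2 (Fin m × Fin n)) :=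
  {s(Cell.vertex c 0 0, Cell.vertex c 1 0), s(Cell.vertex c 0 1, Cell.vertex c 1 1),
    s(Cell.vertex c 0 0, Cell.vertex c 0 1), s(Cell.vertex c 1 0, Cell.vertex c 1 1)}

/-- The signature of a set of edges: it assigns to every cell the number of edges of that cell
that belong to the set. -/
def signature {m n : ℕ} (C : Finset (Sym2 (Fin m × Fin n))) : Cell m n → ℕ :=
  fun c => (Cell.edges c ∩ C).card

/-- The correction term `δ_{m, n}`. -/
def delta (m n : ℕ) : ℕ :=
  if Odd (Nat.gcd m n) then 1
  else if Nat.gcd m n % 4 = 0 then 0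
  else if Nat.gcd m n % 4 = 2 ∧ 4 ≤ m ∧ 4 ≤ n ∧ Even (m * n / Nat.gcd m n ^ 2) then 0
  else 4

end Slitherlink

/-!
Draw the grid in doubled coordinates, so that vertices, cells and edges become the lattice points of
the box `[0, 2m] × [0, 2n]`. For two cycles with the same signature let `f` be the difference of
their indicators. The sum of `f` around every cell vanishes, and around every vertex it is even, so
modulo two `f` solves the discrete wave equation. Hence, continued by reflection in the sides of the
box, `f` is odd at `(i + j + 1, i - j)` exactly when `A i ≠ A j`, for a function `A` on the integers
with values in `{0, 1}`. The reflections give `A` the symmetry `i ↦ -1 - i` and the periods `2m` and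
`2n`, hence `2d`. If `A` has `k` ones in the half period `0, …, d - 1`, counting pairs shows that
the difference has `4k(d - k)m'n' = mn - (d - 2k)²m'n'` edges.

It remains to exclude the balanced case `d = 2k` when `d ≡ 2 (mod 4)` and either `mn/d²` is odd or
the grid has only two rows or columns. In the second case the corner cell would have all four sides
in the difference, three of them in the same cycle. In the first case take the signs of the cells
inside and outside of the two cycles, and a second sign which changes from cell to cell in a way
prescribed by `A`. Both satisfy the same linear equation at each cell, because the two cycles have
the same number of edges there. Applying a discrete Green identity to the cells on which the two
cycles agree and the cells on which they disagree leaves a boundary sum which is not zero.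

For the lower bound, explicit pairs of cycles on small or odd square grids are glued to reflected
copies of themselves along edges common to the two cycles of the pair.
-/

namespace Slitherlink

open Classical in
/-- The indicator of a proposition, as an integer. -/
noncomputable def ind (p : Prop) : ℤ := if p then 1 else 0

lemma ind_false {p : Prop} (h : ¬p) : ind p = 0 := if_neg h

lemma ind_eq_one_or_zero (p : Prop) : p ∧ ind p = 1 ∨ ¬p ∧ ind p = 0 := by
  by_cases h : p <;> simp [ind, h]

lemma ind_congr {p q : Prop} (h : p ↔ q) : ind p = ind q := by rw [propext h]

/-! ### Edge sets in doubled coordinates -/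

/-- A set of unit edges of the square lattice, in doubled coordinates: the vertex `(x, y)` is drawn
at `(2x + 1, 2y + 1)`, so that the cell whose upper right vertex is `(x, y)` is centred at
`(2x, 2y)`, and an edge is recorded by its midpoint, which has an odd coordinate sum. -/
abbrev MidpointSet : Type := ℤ → ℤ → Prop

/-- The sum of a function over the four neighbours of a point. -/
def neighborSum (f : ℤ → ℤ → ℤ) (a b : ℤ) : ℤ :=
  f (a + 1) b + f (a - 1) b + f a (b + 1) + f a (b - 1)

/-- The edges of `e` all belong to the `m × n` grid. -/
def WithinGrid (m n : ℤ) (e : MidpointSet) : Prop :=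
  ∀ a b, e a b → 0 < a ∧ a < 2 * m ∧ 0 < b ∧ b < 2 * n ∧ (a + b) % 2 = 1

/-- The number of edges of `e` next to a point: the degree at a vertex, and the value of the
signature at the centre of a cell. -/
noncomputable def edgeCount (e : MidpointSet) : ℤ → ℤ → ℤ :=
  neighborSum fun a b => ind (e a b)

/-- The two lattice points are at distance one. -/
def IsUnitStep (u v : ℤ × ℤ) : Prop :=
  (u.1 = v.1 ∧ (u.2 = v.2 + 1 ∨ v.2 = u.2 + 1)) ∨ (u.2 = v.2 ∧ (u.1 = v.1 + 1 ∨ v.1 = u.1 + 1))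

lemma IsUnitStep.symm {u v : ℤ × ℤ} (h : IsUnitStep u v) : IsUnitStep v u := by
  unfold IsUnitStep at *
  omega

lemma IsUnitStep.cases {x y : ℤ} {v : ℤ × ℤ} (h : IsUnitStep (x, y) v) :
    v = (x + 1, y) ∨ v = (x - 1, y) ∨ v = (x, y + 1) ∨ v = (x, y - 1) := by
  obtain ⟨a, b⟩ := v
  simp only [IsUnitStep, Prod.mk.injEq] at *
  omega

lemma IsUnitStep.eq_of_add_eq {u v u' v' : ℤ × ℤ} (h : IsUnitStep u v) (h' : IsUnitStep u' v')
    (h₁ : u.1 + v.1 = u'.1 + v'.1) (h₂ : u.2 + v.2 = u'.2 + v'.2) :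
    (u = u' ∧ v = v') ∨ (u = v' ∧ v = u') := by
  simp only [IsUnitStep, Prod.ext_iff] at *
  omega

/-- The graph on the lattice `ℤ × ℤ` formed by a set of edges. -/
def edgeGraph (e : MidpointSet) : SimpleGraph (ℤ × ℤ) where
  Adj u v := IsUnitStep u v ∧ e (u.1 + v.1 + 1) (u.2 + v.2 + 1)
  symm := ⟨fun u v h => ⟨h.1.symm, by rw [add_comm v.1, add_comm v.2]; exact h.2⟩⟩
  loopless := ⟨fun u h => by
    have := h.1
    unfold IsUnitStep at this
    omega⟩

section EdgeGraph

variable {e : MidpointSet} {x y : ℤ}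

lemma edgeGraph_adj {u v : ℤ × ℤ} :
    (edgeGraph e).Adj u v ↔ IsUnitStep u v ∧ e (u.1 + v.1 + 1) (u.2 + v.2 + 1) := Iff.rfl

lemma edgeGraph_adj_right : (edgeGraph e).Adj (x, y) (x + 1, y) ↔ e (2 * x + 2) (2 * y + 1) := by
  rw [edgeGraph_adj, show x + (x + 1) + 1 = 2 * x + 2 by ring, ← two_mul]
  simp [IsUnitStep]

lemma edgeGraph_adj_left : (edgeGraph e).Adj (x, y) (x - 1, y) ↔ e (2 * x) (2 * y + 1) := by
  rw [edgeGraph_adj, show x + (x - 1) + 1 = 2 * x by ring, ← two_mul]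
  simp [IsUnitStep]

lemma edgeGraph_adj_up : (edgeGraph e).Adj (x, y) (x, y + 1) ↔ e (2 * x + 1) (2 * y + 2) := by
  rw [edgeGraph_adj, show y + (y + 1) + 1 = 2 * y + 2 by ring, ← two_mul]
  simp [IsUnitStep]

lemma edgeGraph_adj_down : (edgeGraph e).Adj (x, y) (x, y - 1) ↔ e (2 * x + 1) (2 * y) := by
  rw [edgeGraph_adj, show y + (y - 1) + 1 = 2 * y by ring, ← two_mul]
  simp [IsUnitStep]

lemma ncard_neighborSet_edgeGraph (e : MidpointSet) (x y : ℤ) :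
    (((edgeGraph e).neighborSet (x, y)).ncard : ℤ) = edgeCount e (2 * x + 1) (2 * y + 1) := by
  classical
  have hfilter : (edgeGraph e).neighborSet (x, y) =
      ↑(({(x + 1, y), (x - 1, y), (x, y + 1), (x, y - 1)} : Finset (ℤ × ℤ)).filter
        (fun v => (edgeGraph e).Adj (x, y) v)) := by
    ext v
    simp only [SimpleGraph.mem_neighborSet, Finset.coe_filter, Finset.mem_insert,
      Finset.mem_singleton, Set.mem_ofPred_eq]
    exact ⟨fun h => ⟨h.1.cases, h⟩, fun h => h.2⟩
  rw [hfilter, Set.ncard_coe_finset, Finset.card_filter, Finset.sum_insert, Finset.sum_insert,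
    Finset.sum_insert, Finset.sum_singleton]
  · simp only [edgeGraph_adj_right, edgeGraph_adj_left, edgeGraph_adj_up, edgeGraph_adj_down,
      edgeCount, neighborSum, ind]
    push_cast
    ring_nf
  · simp; omega
  · simp
  · simp; omega

end EdgeGraph

/-- The edges of `e` form a single simple closed curve in the `m × n` grid. -/
structure IsLoop (m n : ℤ) (e : MidpointSet) : Prop where
  supp : WithinGrid m n e
  degree : ∀ x y, edgeCount e (2 * x + 1) (2 * y + 1) = 0 ∨ edgeCount e (2 * x + 1) (2 * y + 1) = 2
  connected : ∀ u v, (∃ w, (edgeGraph e).Adj u w) → (∃ w, (edgeGraph e).Adj v w) →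
    (edgeGraph e).Reachable u v
  nonempty : ∃ u w, (edgeGraph e).Adj u w

lemma IsLoop.ncard_neighborSet {m n : ℤ} {e : MidpointSet} (h : IsLoop m n e) {u : ℤ × ℤ}
    (hu : ((edgeGraph e).neighborSet u).Nonempty) : ((edgeGraph e).neighborSet u).ncard = 2 := by
  obtain ⟨x, y⟩ := u
  have hcount := ncard_neighborSet_edgeGraph e x y
  have hfin : ((edgeGraph e).neighborSet (x, y)).Finite :=
    Set.Finite.subset (Set.toFinite {(x + 1, y), (x - 1, y), (x, y + 1), (x, y - 1)})
      fun v hv => by simpa using hv.1.cases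
  have hpos := (Set.ncard_pos hfin).2 hu
  rcases h.degree x y with hdeg | hdeg <;> omega

/-! ### Cycles of the grid as loops in the plane -/

/-- The embedding of the vertices of the grid into the lattice. -/
def toPlane {m n : ℕ} (u : Fin m × Fin n) : ℤ × ℤ := ((u.1 : ℕ), (u.2 : ℕ))

/-- The midpoint of a pair of vertices in doubled coordinates. -/
def edgeMidpoint {m n : ℕ} : Sym2 (Fin m × Fin n) → ℤ × ℤ :=
  Sym2.lift ⟨fun u v => ((toPlane u).1 + (toPlane v).1 + 1, (toPlane u).2 + (toPlane v).2 + 1),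
    fun u v => by simp only [add_comm]⟩

/-- The part of the graph of `e` inside the `m × n` grid. -/
def edgeGraphOn (m n : ℕ) (e : MidpointSet) : SimpleGraph (Fin m × Fin n) :=
  (edgeGraph e).comap toPlane

/-- The edges of a finite set of pairs of vertices, recorded by their midpoints. -/
def midpoints {m n : ℕ} (C : Finset (Sym2 (Fin m × Fin n))) : MidpointSet :=
  fun a b => ∃ s ∈ C, edgeMidpoint s = (a, b)

/-- The set consists of edges of the grid. -/
def IsEdgeFinset {m n : ℕ} (C : Finset (Sym2 (Fin m × Fin n))) : Prop :=
  ∀ s ∈ C, s ∈ (grid m n).edgeSet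

section Embedding

variable {m n : ℕ} {e : MidpointSet}

lemma toPlane_injective : Function.Injective (toPlane (m := m) (n := n)) := by
  intro u v h
  simpa [toPlane, Prod.ext_iff, Fin.ext_iff] using h

lemma exists_toPlane_eq {u : ℤ × ℤ} (h₁ : 0 ≤ u.1) (h₁' : u.1 < m) (h₂ : 0 ≤ u.2)
    (h₂' : u.2 < n) : ∃ v : Fin m × Fin n, toPlane v = u :=
  ⟨(⟨u.1.toNat, by omega⟩, ⟨u.2.toNat, by omega⟩), by ext <;> simp [toPlane, h₁, h₂]⟩

lemma grid_adj_iff (u v : Fin m × Fin n) :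
    (grid m n).Adj u v ↔ IsUnitStep (toPlane u) (toPlane v) := by
  simp only [SimpleGraph.boxProd_adj, SimpleGraph.pathGraph_adj, IsUnitStep, toPlane, Fin.ext_iff]
  omega

lemma edgeMidpoint_injOn : Set.InjOn edgeMidpoint (grid m n).edgeSet := by
  intro s hs t ht h
  induction s using Sym2.ind with | _ u v
  induction t using Sym2.ind with | _ u' v'
  rw [SimpleGraph.mem_edgeSet, grid_adj_iff] at hs ht
  obtain ⟨h₁, h₂⟩ : (toPlane u).1 + (toPlane v).1 + 1 = (toPlane u').1 + (toPlane v').1 + 1 ∧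
      (toPlane u).2 + (toPlane v).2 + 1 = (toPlane u').2 + (toPlane v').2 + 1 := Prod.mk.inj h
  rcases hs.eq_of_add_eq ht (by omega) (by omega) with ⟨hu, hv⟩ | ⟨hu, hv⟩
  · rw [toPlane_injective hu, toPlane_injective hv]
  · rw [toPlane_injective hu, toPlane_injective hv, Sym2.eq_swap]

lemma WithinGrid.exists_toPlane_eq (h : WithinGrid m n e) {u v : ℤ × ℤ}
    (huv : (edgeGraph e).Adj u v) : ∃ w : Fin m × Fin n, toPlane w = u := by
  have hstep := huv.1
  have hbounds := h _ _ huv.2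
  unfold IsUnitStep at hstep
  apply Slitherlink.exists_toPlane_eq <;> omega

lemma WithinGrid.exists_edgeMidpoint_eq (h : WithinGrid m n e) {a b : ℤ} (hab : e a b) :
    ∃ u v : Fin m × Fin n, (edgeGraph e).Adj (toPlane u) (toPlane v) ∧
      edgeMidpoint s(u, v) = (a, b) := by
  obtain ⟨u, v, huv, hmid⟩ : ∃ u v : ℤ × ℤ, (edgeGraph e).Adj u v ∧
      (u.1 + v.1 + 1, u.2 + v.2 + 1) = (a, b) := by
    have hodd := (h a b hab).2.2.2.2
    rcases Int.emod_two_eq_zero_or_one a with ha | ha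
    · obtain ⟨x, rfl⟩ : ∃ x, a = 2 * x + 2 := ⟨a / 2 - 1, by omega⟩
      obtain ⟨y, rfl⟩ : ∃ y, b = 2 * y + 1 := ⟨b / 2, by omega⟩
      exact ⟨_, _, edgeGraph_adj_right.2 hab, by ext <;> dsimp only <;> ring⟩
    · obtain ⟨x, rfl⟩ : ∃ x, a = 2 * x + 1 := ⟨a / 2, by omega⟩
      obtain ⟨y, rfl⟩ : ∃ y, b = 2 * y + 2 := ⟨b / 2 - 1, by omega⟩
      exact ⟨_, _, edgeGraph_adj_up.2 hab, by ext <;> dsimp only <;> ring⟩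
  obtain ⟨u, rfl⟩ := h.exists_toPlane_eq huv
  obtain ⟨v, rfl⟩ := h.exists_toPlane_eq huv.symm
  exact ⟨u, v, huv, hmid⟩

lemma edgeGraphOn_le (e : MidpointSet) : edgeGraphOn m n e ≤ grid m n :=
  fun u v h => (grid_adj_iff u v).2 h.1

lemma WithinGrid.image_neighborSet (h : WithinGrid m n e) (u : Fin m × Fin n) :
    toPlane '' ((edgeGraphOn m n e).neighborSet u) = (edgeGraph e).neighborSet (toPlane u) := by
  ext v
  constructor
  · rintro ⟨w, hw, rfl⟩
    exact hw
  · intro hv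
    obtain ⟨w, rfl⟩ := h.exists_toPlane_eq (SimpleGraph.Adj.symm hv)
    exact ⟨w, hv, rfl⟩

lemma WithinGrid.reachable_edgeGraphOn (h : WithinGrid m n e) {u : Fin m × Fin n} {v : ℤ × ℤ}
    (hr : (edgeGraph e).Reachable (toPlane u) v) :
    ∃ w, toPlane w = v ∧ (edgeGraphOn m n e).Reachable u w := by
  rw [SimpleGraph.reachable_iff_reflTransGen] at hr
  induction hr with
  | refl => exact ⟨u, rfl, .refl u⟩
  | tail _ hadj ih =>
    obtain ⟨w, rfl, hw⟩ := ih
    obtain ⟨w', rfl⟩ := h.exists_toPlane_eq hadj.symm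
    exact ⟨w', rfl, hw.trans (SimpleGraph.Adj.reachable hadj)⟩

lemma IsLoop.isCycles (h : IsLoop m n e) : (edgeGraphOn m n e).IsCycles := by
  intro u hu
  rw [← Set.ncard_image_of_injective _ toPlane_injective, h.supp.image_neighborSet]
  apply h.ncard_neighborSet
  rw [← h.supp.image_neighborSet]
  exact hu.image _

lemma IsLoop.reachable_deleteEdges (h : IsLoop m n e) {u v : ℤ × ℤ}
    (huv : (edgeGraph e).Adj u v) : ((edgeGraph e).deleteEdges {s(u, v)}).Reachable u v := by
  obtain ⟨u, rfl⟩ := h.supp.exists_toPlane_eq huv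
  obtain ⟨v, rfl⟩ := h.supp.exists_toPlane_eq huv.symm
  have hreach := SimpleGraph.IsCycles.reachable_deleteEdges
    (show (edgeGraphOn m n e).Adj u v from huv) h.isCycles
  refine hreach.map (G' := (edgeGraph e).deleteEdges {s(toPlane u, toPlane v)}) ⟨toPlane, ?_⟩
  intro a b hab
  rw [SimpleGraph.deleteEdges_adj] at hab ⊢
  exact ⟨hab.1, fun heq => hab.2 (Sym2.map.injective toPlane_injective heq)⟩

lemma IsLoop.exists_isCycle_mem_iff_adj (h : IsLoop m n e) :
    ∃ C : Finset (Sym2 (Fin m × Fin n)), IsCycle C ∧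
      ∀ u v, s(u, v) ∈ C ↔ (edgeGraph e).Adj (toPlane u) (toPlane v) := by
  classical
  obtain ⟨u, w, huw⟩ := h.nonempty
  obtain ⟨u, rfl⟩ := h.supp.exists_toPlane_eq huw
  obtain ⟨w, rfl⟩ := h.supp.exists_toPlane_eq huw.symm
  have hloc : (edgeGraphOn m n e).LocallyFinite := fun v => Fintype.ofFinite _
  obtain ⟨p, hp, hverts⟩ := h.isCycles.exists_cycle_toSubgraph_verts_eq_connectedComponentSupp
    (c := (edgeGraphOn m n e).connectedComponentMk u) rfl ⟨w, huw⟩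
  refine ⟨(p.mapLe (edgeGraphOn_le e)).edges.toFinset,
    ⟨u, p.mapLe (edgeGraphOn_le e), hp.mapLe _, rfl⟩, fun a b => ?_⟩
  rw [List.mem_toFinset, SimpleGraph.Walk.edges_mapLe_eq_edges]
  refine ⟨fun hab => p.adj_of_mem_edges hab, fun hab => ?_⟩
  have ha : a ∈ p.toSubgraph.verts := by
    obtain ⟨a', haa', ha'⟩ := h.supp.reachable_edgeGraphOn (h.connected _ _ ⟨_, huw⟩ ⟨_, hab⟩)
    rw [hverts, ← toPlane_injective haa']
    exact SimpleGraph.ConnectedComponent.sound ha'.symm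
  rw [← SimpleGraph.Walk.mem_edges_toSubgraph, SimpleGraph.Subgraph.mem_edgeSet]
  exact (hp.adj_toSubgraph_iff_of_isCycles h.isCycles ha b).2 hab

lemma IsLoop.exists_isCycle_midpoints_eq (h : IsLoop m n e) :
    ∃ C : Finset (Sym2 (Fin m × Fin n)), IsCycle C ∧ midpoints C = e := by
  obtain ⟨C, hC, hmem⟩ := h.exists_isCycle_mem_iff_adj
  refine ⟨C, hC, ?_⟩
  ext a b
  constructor
  · rintro ⟨⟨u, v⟩, huv, hmid⟩
    obtain ⟨rfl, rfl⟩ := Prod.mk.inj hmid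
    exact ((hmem u v).1 huv).2
  · intro hab
    obtain ⟨u, v, huv, hmid⟩ := h.supp.exists_edgeMidpoint_eq hab
    exact ⟨s(u, v), (hmem u v).2 huv, hmid⟩

end Embedding

section Midpoints

variable {m n : ℕ} {C C₁ C₂ : Finset (Sym2 (Fin m × Fin n))}

lemma IsEdgeFinset.mem_iff (hC : IsEdgeFinset C) {s : Sym2 (Fin m × Fin n)}
    (hs : s ∈ (grid m n).edgeSet) :
    s ∈ C ↔ midpoints C (edgeMidpoint s).1 (edgeMidpoint s).2 := by
  refine ⟨fun h => ⟨s, h, rfl⟩, ?_⟩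
  rintro ⟨t, ht, hts⟩
  rwa [← edgeMidpoint_injOn (hC t ht) hs hts]

lemma IsEdgeFinset.withinGrid (hC : IsEdgeFinset C) : WithinGrid m n (midpoints C) := by
  rintro a b ⟨⟨u, v⟩, huv, hmid⟩
  have hstep := (grid_adj_iff u v).1 (hC _ huv)
  obtain ⟨rfl, rfl⟩ := Prod.mk.inj hmid
  have := u.1.2
  have := u.2.2
  have := v.1.2
  have := v.2.2
  simp only [IsUnitStep, toPlane] at *
  omega

lemma IsEdgeFinset.adj_iff (hC : IsEdgeFinset C) (u v : Fin m × Fin n) :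
    (edgeGraph (midpoints C)).Adj (toPlane u) (toPlane v) ↔ s(u, v) ∈ C := by
  rw [edgeGraph_adj, ← grid_adj_iff]
  exact ⟨fun h => (hC.mem_iff (s := s(u, v)) h.1).2 h.2,
    fun h => ⟨hC _ h, (hC.mem_iff (hC _ h)).1 h⟩⟩

lemma IsCycle.isEdgeFinset (hC : IsCycle C) : IsEdgeFinset C := by
  obtain ⟨u, p, -, rfl⟩ := hC
  exact fun s hs => p.edges_subset_edgeSet (List.mem_toFinset.1 hs)

lemma IsCycle.edgeCount_eq_zero_or_two (hC : IsCycle C) (x y : ℤ) :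
    edgeCount (midpoints C) (2 * x + 1) (2 * y + 1) = 0 ∨
      edgeCount (midpoints C) (2 * x + 1) (2 * y + 1) = 2 := by
  have hedges := hC.isEdgeFinset
  rw [← ncard_neighborSet_edgeGraph]
  rcases ((edgeGraph (midpoints C)).neighborSet (x, y)).eq_empty_or_nonempty with hempty | ⟨w, hw⟩
  · simp [hempty]
  right
  obtain ⟨u, hu⟩ := hedges.withinGrid.exists_toPlane_eq hw
  obtain ⟨w, rfl⟩ := hedges.withinGrid.exists_toPlane_eq hw.symm
  rw [← hu] at hw ⊢
  rw [← hedges.withinGrid.image_neighborSet, Set.ncard_image_of_injective _ toPlane_injective]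
  obtain ⟨z, p, hp, rfl⟩ := hC
  have hmem := List.mem_toFinset.1 ((hedges.adj_iff u w).1 hw)
  have hsub : (edgeGraphOn m n (midpoints p.edges.toFinset)).neighborSet u =
      p.toSubgraph.neighborSet u := by
    ext v
    change (edgeGraph _).Adj _ _ ↔ p.toSubgraph.Adj u v
    rw [hedges.adj_iff, List.mem_toFinset, ← SimpleGraph.Walk.mem_edges_toSubgraph,
      SimpleGraph.Subgraph.mem_edgeSet]
  rw [hsub, hp.ncard_neighborSet_toSubgraph_eq_two (p.fst_mem_support_of_mem_edges hmem)]
  rfl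

lemma IsEdgeFinset.signature_eq_edgeCount (hC : IsEdgeFinset C) (c : Cell m n) :
    (signature C c : ℤ) =
      edgeCount (midpoints C) (2 * ((c.1 : ℕ) + 1)) (2 * ((c.2 : ℕ) + 1)) := by
  classical
  have hside : ∀ a b a' b' : Fin 2,
      IsUnitStep (toPlane (c.vertex a b)) (toPlane (c.vertex a' b')) →
      ((if s(c.vertex a b, c.vertex a' b') ∈ C then 1 else 0 : ℕ) : ℤ) =
        ind (midpoints C (2 * (c.1 : ℕ) + (a : ℕ) + (a' : ℕ) + 1)
          (2 * (c.2 : ℕ) + (b : ℕ) + (b' : ℕ) + 1)) := by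
    intro a b a' b' h
    trans ind (s(c.vertex a b, c.vertex a' b') ∈ C)
    · simp [ind]
    · rw [ind_congr (hC.mem_iff ((grid_adj_iff _ _).2 h))]
      simp only [edgeMidpoint, Sym2.lift_mk, toPlane, Cell.vertex]
      push_cast
      congr 2 <;> ring
  have hinj : ∀ a b a' b' : Fin 2, c.vertex a b = c.vertex a' b' ↔ a = a' ∧ b = b' := by
    intro a b a' b'
    simp only [Cell.vertex, Prod.mk.injEq, Fin.ext_iff]
    omega
  rw [signature, Finset.inter_comm, ← Finset.filter_mem_eq_inter.trans (Finset.inter_comm _ _),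
    Finset.card_filter, Cell.edges, Finset.sum_insert, Finset.sum_insert, Finset.sum_insert,
    Finset.sum_singleton]
  · have hbottom := hside 0 0 1 0 (by simp [IsUnitStep, toPlane, Cell.vertex])
    have htop := hside 0 1 1 1 (by simp [IsUnitStep, toPlane, Cell.vertex])
    have hleft := hside 0 0 0 1 (by simp [IsUnitStep, toPlane, Cell.vertex])
    have hright := hside 1 0 1 1 (by simp [IsUnitStep, toPlane, Cell.vertex])
    push_cast at hbottom htop hleft hright ⊢
    rw [hbottom, htop, hleft, hright]
    simp only [edgeCount, neighborSum, Fin.val_zero, Fin.val_one, Nat.cast_zero, Nat.cast_one]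
    ring_nf
  all_goals simp [hinj]

/-- The difference of two sets of edges, as a function with values in `{-1, 0, 1}`. -/
noncomputable def edgeDiff (e₁ e₂ : MidpointSet) (a b : ℤ) : ℤ := ind (e₁ a b) - ind (e₂ a b)

lemma edgeDiff_ne_zero {e₁ e₂ : MidpointSet} {a b : ℤ} :
    edgeDiff e₁ e₂ a b ≠ 0 ↔ ¬(e₁ a b ↔ e₂ a b) := by
  unfold edgeDiff
  by_cases h : e₁ a b <;> by_cases h' : e₂ a b <;> simp [ind, h, h']

lemma neighborSum_edgeDiff (e₁ e₂ : MidpointSet) (a b : ℤ) :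
    neighborSum (edgeDiff e₁ e₂) a b = edgeCount e₁ a b - edgeCount e₂ a b := by
  simp only [neighborSum, edgeDiff, edgeCount]
  ring

/-- The sum of `f` over the sides of each cell of the `m × n` grid vanishes: for the difference of
two sets of edges, this is equality of signatures. -/
def CellSumsVanish (m n : ℤ) (f : ℤ → ℤ → ℤ) : Prop :=
  ∀ x y, 0 < x → x < m → 0 < y → y < n → neighborSum f (2 * x) (2 * y) = 0

/-- The number of points of the open box `(0, 2m) × (0, 2n)` at which `f` does not vanish. -/
noncomputable def supportCard (m n : ℤ) (f : ℤ → ℤ → ℤ) : ℕ :=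
  ((Finset.Ioo 0 (2 * m) ×ˢ Finset.Ioo 0 (2 * n)).filter (fun p => f p.1 p.2 ≠ 0)).card

lemma card_symmDiff_eq_supportCard (h₁ : IsEdgeFinset C₁) (h₂ : IsEdgeFinset C₂) :
    (symmDiff C₁ C₂).card = supportCard m n (edgeDiff (midpoints C₁) (midpoints C₂)) := by
  have hmem : ∀ s ∈ (grid m n).edgeSet, s ∈ symmDiff C₁ C₂ ↔
      edgeDiff (midpoints C₁) (midpoints C₂) (edgeMidpoint s).1 (edgeMidpoint s).2 ≠ 0 := by
    intro s hs
    rw [Finset.mem_symmDiff, edgeDiff_ne_zero, h₁.mem_iff hs, h₂.mem_iff hs]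
    tauto
  have hedge : ∀ s ∈ symmDiff C₁ C₂, s ∈ (grid m n).edgeSet := fun s hs =>
    (Finset.mem_symmDiff.1 hs).elim (fun h => h₁ s h.1) (fun h => h₂ s h.1)
  refine Finset.card_bij (fun s _ => edgeMidpoint s) (fun s hs => ?_)
    (fun s hs t ht => edgeMidpoint_injOn (hedge s hs) (hedge t ht)) ?_
  · rw [Finset.mem_filter, Finset.mem_product, Finset.mem_Ioo, Finset.mem_Ioo]
    have hbounds : 0 < (edgeMidpoint s).1 ∧ (edgeMidpoint s).1 < 2 * m ∧
        0 < (edgeMidpoint s).2 ∧ (edgeMidpoint s).2 < 2 * n ∧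
        ((edgeMidpoint s).1 + (edgeMidpoint s).2) % 2 = 1 :=
      (Finset.mem_symmDiff.1 hs).elim (fun h => h₁.withinGrid _ _ ⟨s, h.1, rfl⟩)
        (fun h => h₂.withinGrid _ _ ⟨s, h.1, rfl⟩)
    exact ⟨by omega, (hmem s (hedge s hs)).1 hs⟩
  · rintro ⟨a, b⟩ hab
    have hne := (Finset.mem_filter.1 hab).2
    obtain ⟨s, hs, hmid⟩ : ∃ s ∈ (grid m n).edgeSet, edgeMidpoint s = (a, b) := by
      rw [edgeDiff_ne_zero] at hne
      by_cases hab₁ : midpoints C₁ a b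
      · exact hab₁.imp fun s hs => ⟨h₁ s hs.1, hs.2⟩
      · exact (show midpoints C₂ a b by tauto).imp fun s hs => ⟨h₂ s hs.1, hs.2⟩
    exact ⟨s, (hmem s hs).2 (by rwa [hmid]), hmid⟩

lemma signature_eq_iff_cellSumsVanish (h₁ : IsEdgeFinset C₁) (h₂ : IsEdgeFinset C₂) :
    signature C₁ = signature C₂ ↔
      CellSumsVanish m n (edgeDiff (midpoints C₁) (midpoints C₂)) := by
  have hcell : ∀ c : Cell m n, signature C₁ c = signature C₂ c ↔
      neighborSum (edgeDiff (midpoints C₁) (midpoints C₂)) (2 * ((c.1 : ℕ) + 1))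
        (2 * ((c.2 : ℕ) + 1)) = 0 := fun c => by
    rw [neighborSum_edgeDiff, sub_eq_zero, ← h₁.signature_eq_edgeCount, ← h₂.signature_eq_edgeCount,
      Nat.cast_inj]
  refine ⟨fun h x y hx hxm hy hyn => ?_, fun h => funext fun c => (hcell c).2 ?_⟩
  · have hc := (hcell (⟨(x - 1).toNat, by omega⟩, ⟨(y - 1).toNat, by omega⟩)).1 (congrFun h _)
    rwa [Int.toNat_of_nonneg (by omega), Int.toNat_of_nonneg (by omega), sub_add_cancel,
      sub_add_cancel] at hc
  · exact h _ _ (by omega) (by omega) (by omega) (by omega)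

lemma exists_isCycle_pair {e₁ e₂ : MidpointSet} (h₁ : IsLoop m n e₁) (h₂ : IsLoop m n e₂)
    (h : CellSumsVanish m n (edgeDiff e₁ e₂)) :
    ∃ C₁ C₂ : Finset (Sym2 (Fin m × Fin n)), IsCycle C₁ ∧ IsCycle C₂ ∧
      signature C₁ = signature C₂ ∧ (symmDiff C₁ C₂).card = supportCard m n (edgeDiff e₁ e₂) := by
  obtain ⟨C₁, hC₁, rfl⟩ := h₁.exists_isCycle_midpoints_eq
  obtain ⟨C₂, hC₂, rfl⟩ := h₂.exists_isCycle_midpoints_eq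
  exact ⟨C₁, C₂, hC₁, hC₂, (signature_eq_iff_cellSumsVanish hC₁.isEdgeFinset hC₂.isEdgeFinset).2 h,
    card_symmDiff_eq_supportCard hC₁.isEdgeFinset hC₂.isEdgeFinset⟩

end Midpoints

/-! ### Solutions of the discrete wave equation modulo two -/

lemma apply_eq_of_periodic_one {α : Type*} {h : ℤ → α} (hh : Function.Periodic h 1) (i j : ℤ) :
    h i = h j := by
  have key : ∀ i, h i = h 0 := fun i => by simpa using hh.int_mul_eq i
  rw [key i, key j]

lemma add_zero_zero_eq_of_square_sums {M : Type*} [AddCommGroup M] {K : ℤ → ℤ → M}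
    (hK : ∀ i j, K (i + 1) (j + 1) + K i j = K (i + 1) j + K i (j + 1)) (i j : ℤ) :
    K i j + K 0 0 = K i 0 + K 0 j := by
  have hrow : ∀ i, K (i + 1) j - K i j = K (i + 1) 0 - K i 0 := fun i => by
    refine apply_eq_of_periodic_one (h := fun j => K (i + 1) j - K i j) (fun j => ?_) j 0
    rw [sub_eq_sub_iff_add_eq_add, hK]
  have hcol := apply_eq_of_periodic_one (h := fun i => K i j - K i 0)
    (fun i => by rw [sub_eq_sub_iff_sub_eq_sub, hrow]) i 0
  rwa [sub_eq_sub_iff_add_eq_add, add_comm (K 0 j)] at hcol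

/-- The wave equation at the points with even coordinate sum. -/
def IsWave (G : ℤ → ℤ → ZMod 2) : Prop :=
  ∀ a b, (a + b) % 2 = 0 → G (a + 1) b + G (a - 1) b + G a (b + 1) + G a (b - 1) = 0

lemma IsWave.eq_add {G : ℤ → ℤ → ZMod 2} (hG : IsWave G) (h0 : ∀ a, G a 0 = 0) (i j : ℤ) :
    G (i + j + 1) (i - j) = G (i + 1) i + G (j + 1) j := by
  have hneg : ∀ x y : ZMod 2, x + y = 0 → x = y := by decide
  have hsplit := add_zero_zero_eq_of_square_sums (K := fun i j => G (i + j + 1) (i - j))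
    (fun i j => hneg _ _ <| by
      rw [← hG (i + j + 2) (i - j) (by omega)]
      ring_nf)
  have hi := hsplit i j
  have hj := hsplit j j
  simp only [sub_self, sub_zero, add_zero, h0] at hi hj
  rw [hi, hneg _ _ hj.symm]

/-- The reflection of the integers into the interval from `0` to `M`. -/
def fold (M a : ℤ) : ℤ := |(a + M) % (2 * M) - M|

section Fold

variable {M a : ℤ}

lemma fold_mem_Icc (hM : 0 < M) (a : ℤ) : fold M a ∈ Set.Icc 0 M := by
  have hnonneg := Int.emod_nonneg (a + M) (b := 2 * M) (by omega)
  have hlt := Int.emod_lt_of_pos (a + M) (b := 2 * M) (by omega)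
  exact ⟨abs_nonneg _, abs_le.2 ⟨by omega, by omega⟩⟩

lemma exists_eq_fold_add (M a : ℤ) :
    ∃ q : ℤ, a = fold M a + 2 * M * q ∨ a = -fold M a + 2 * M * q := by
  have hdiv := Int.emod_add_mul_ediv (a + M) (2 * M)
  refine ⟨(a + M) / (2 * M), ?_⟩
  unfold fold
  rcases abs_cases ((a + M) % (2 * M) - M) with h | h
  · exact Or.inl (by linarith)
  · exact Or.inr (by linarith)

lemma fold_eq_of_eq_add (hM : 0 < M) {v q : ℤ} (hv : 0 ≤ v) (hv' : v ≤ M)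
    (h : a = v + 2 * M * q ∨ a = -v + 2 * M * q) : fold M a = v := by
  unfold fold
  rcases h with rfl | rfl
  · rw [add_right_comm, Int.add_mul_emod_self_left]
    rcases hv'.lt_or_eq with hlt | rfl
    · rw [Int.emod_eq_of_lt (by omega) (by omega), add_sub_cancel_right, abs_of_nonneg hv]
    · rw [← two_mul, Int.emod_self, zero_sub, abs_neg, abs_of_pos hM]
  · rw [add_right_comm, Int.add_mul_emod_self_left, Int.emod_eq_of_lt (by omega) (by omega),
      add_sub_cancel_right, abs_neg, abs_of_nonneg hv]

lemma fold_of_mem (hM : 0 < M) (h : 0 ≤ a) (h' : a ≤ M) : fold M a = a :=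
  fold_eq_of_eq_add hM (q := 0) h h' (Or.inl (by ring))

lemma fold_add_one_and_sub_one (hM : 0 < M) (h : 0 < fold M a) (h' : fold M a < M) :
    (fold M (a + 1) = fold M a + 1 ∧ fold M (a - 1) = fold M a - 1) ∨
      (fold M (a + 1) = fold M a - 1 ∧ fold M (a - 1) = fold M a + 1) := by
  obtain ⟨q, hq | hq⟩ := exists_eq_fold_add M a
  · exact Or.inl ⟨fold_eq_of_eq_add hM (q := q) (by omega) (by omega) (Or.inl (by linarith)),
      fold_eq_of_eq_add hM (q := q) (by omega) (by omega) (Or.inl (by linarith))⟩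
  · exact Or.inr ⟨fold_eq_of_eq_add hM (q := q) (by omega) (by omega) (Or.inr (by linarith)),
      fold_eq_of_eq_add hM (q := q) (by omega) (by omega) (Or.inr (by linarith))⟩

lemma fold_add_one_eq_fold_sub_one (hM : 0 < M) (h : fold M a = 0 ∨ fold M a = M) :
    fold M (a + 1) = fold M (a - 1) := by
  have hsymm : ∀ c q, c = 0 ∨ c = M → a = c + 2 * M * q → fold M (a + 1) = fold M (a - 1) := by
    rintro c q (rfl | rfl) rfl
    · rw [fold_eq_of_eq_add hM (v := 1) (q := q) (by omega) (by omega) (Or.inl (by ring)),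
        fold_eq_of_eq_add hM (v := 1) (q := q) (by omega) (by omega) (Or.inr (by ring))]
    · rw [fold_eq_of_eq_add hM (v := c - 1) (q := q + 1) (by omega) (by omega) (Or.inr (by ring)),
        fold_eq_of_eq_add hM (v := c - 1) (q := q) (by omega) (by omega) (Or.inl (by ring))]
  obtain ⟨q, hq | hq⟩ := exists_eq_fold_add M a
  · exact hsymm _ q h hq
  · rcases h with h | h
    · exact hsymm 0 q (Or.inl rfl) (by rw [hq, h, neg_zero])
    · exact hsymm M (q - 1) (Or.inr rfl) (by rw [hq, h]; ring)

lemma fold_two_mul_emod_two (m a : ℤ) : fold (2 * m) a % 2 = a % 2 := by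
  obtain ⟨q, h⟩ := exists_eq_fold_add (2 * m) a
  have : 2 * (2 * m) * q = 2 * (2 * m * q) := by ring
  omega

end Fold

/-! ### The profile of a difference -/

/-- What the upper bound uses about the difference `f` of two cycles with equal signatures. -/
structure IsSignatureDiff (m n : ℤ) (f : ℤ → ℤ → ℤ) : Prop where
  values : ∀ a b, f a b = 0 ∨ f a b = 1 ∨ f a b = -1
  supp : WithinGrid m n fun a b => f a b ≠ 0
  vertex : ∀ x y, neighborSum f (2 * x + 1) (2 * y + 1) % 2 = 0
  cell : CellSumsVanish m n f

/-- A symmetric function with values in `{0, 1}` which describes the support of `f`: in the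
diagonal coordinates `i`, `j` the support is the set where `A i ≠ A j`. -/
structure IsProfile (m n : ℤ) (f : ℤ → ℤ → ℤ) (A : ℤ → ℤ) : Prop where
  values : ∀ i, A i = 0 ∨ A i = 1
  neg : ∀ i, A (-1 - i) = A i
  refl₁ : ∀ i, A (2 * m - 1 - i) = A i
  refl₂ : ∀ i, A (2 * n - 1 - i) = A i
  ne_iff : ∀ i j, 0 ≤ i + j + 1 → i + j + 1 ≤ 2 * m → 0 ≤ i - j → i - j ≤ 2 * n →
    (f (i + j + 1) (i - j) ≠ 0 ↔ A i ≠ A j)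
  diag : ∀ i, 0 ≤ i → i + 1 ≤ 2 * m → i ≤ 2 * n → (f (i + 1) i ≠ 0 ↔ A i = 1)
  vanish : ∀ q, 0 ≤ q → q ≤ m → (∀ b, f (2 * q) b = 0) → ∀ i, A (2 * q - 1 - i) = A i

/-- The reduction of `f` modulo two on the box `[0, 2m] × [0, 2n]`, continued to the plane by
reflection in the sides of the box. -/
def foldedMod (m n : ℤ) (f : ℤ → ℤ → ℤ) (a b : ℤ) : ZMod 2 := f (fold (2 * m) a) (fold (2 * n) b)

/-- The profile of `f`, read off along the diagonal. -/
def profile (m n : ℤ) (f : ℤ → ℤ → ℤ) (i : ℤ) : ℤ := (foldedMod m n f (i + 1) i).val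

section Profile

variable {m n : ℤ} {f : ℤ → ℤ → ℤ}

lemma foldedMod_of_mem (hm : 0 < m) (hn : 0 < n) {a b : ℤ} (ha : 0 ≤ a) (ha' : a ≤ 2 * m)
    (hb : 0 ≤ b) (hb' : b ≤ 2 * n) : foldedMod m n f a b = f a b := by
  rw [foldedMod, fold_of_mem (by omega) ha ha', fold_of_mem (by omega) hb hb']

lemma IsSignatureDiff.cast_ne_zero (hf : IsSignatureDiff m n f) (a b : ℤ) :
    (f a b : ZMod 2) ≠ 0 ↔ f a b ≠ 0 := by
  rcases hf.values a b with h | h | h <;> simp [h]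

lemma IsSignatureDiff.eq_zero_of_boundary (hf : IsSignatureDiff m n f) {a b : ℤ}
    (h : a = 0 ∨ a = 2 * m ∨ b = 0 ∨ b = 2 * n) : f a b = 0 := by
  by_contra hne
  have := hf.supp a b hne
  omega

lemma IsSignatureDiff.cast_neighborSum_eq_zero (hf : IsSignatureDiff m n f) {a b : ℤ}
    (ha : 0 < a) (ha' : a < 2 * m) (hb : 0 < b) (hb' : b < 2 * n) (hab : (a + b) % 2 = 0) :
    ((neighborSum f a b : ℤ) : ZMod 2) = 0 := by
  rcases Int.emod_two_eq_zero_or_one a with h | h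
  · obtain ⟨x, rfl⟩ : ∃ x, a = 2 * x := ⟨a / 2, by omega⟩
    obtain ⟨y, rfl⟩ : ∃ y, b = 2 * y := ⟨b / 2, by omega⟩
    rw [hf.cell x y (by omega) (by omega) (by omega) (by omega), Int.cast_zero]
  · obtain ⟨x, rfl⟩ : ∃ x, a = 2 * x + 1 := ⟨a / 2, by omega⟩
    obtain ⟨y, rfl⟩ : ∃ y, b = 2 * y + 1 := ⟨b / 2, by omega⟩
    rw [ZMod.intCast_zmod_eq_zero_iff_dvd]
    exact Int.dvd_of_emod_eq_zero (hf.vertex x y)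

lemma IsSignatureDiff.isWave_foldedMod (hf : IsSignatureDiff m n f) (hm : 0 < m) (hn : 0 < n) :
    IsWave (foldedMod m n f) := by
  intro a b hab
  have hdouble : ∀ x : ZMod 2, x + x = 0 := CharTwo.add_self_eq_zero
  have hzero : ∀ {c d}, c = 0 ∨ c = 2 * m ∨ d = 0 ∨ d = 2 * n → (f c d : ZMod 2) = 0 := fun h => by
    rw [hf.eq_zero_of_boundary h, Int.cast_zero]
  obtain ⟨ha, ha'⟩ := fold_mem_Icc (M := 2 * m) (by omega) a
  obtain ⟨hb, hb'⟩ := fold_mem_Icc (M := 2 * n) (by omega) b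
  simp only [foldedMod]
  by_cases hedge_a : fold (2 * m) a = 0 ∨ fold (2 * m) a = 2 * m
  · rw [fold_add_one_eq_fold_sub_one (by omega) hedge_a, hdouble, zero_add,
      hzero (by tauto), hzero (by tauto), add_zero]
  by_cases hedge_b : fold (2 * n) b = 0 ∨ fold (2 * n) b = 2 * n
  · rw [fold_add_one_eq_fold_sub_one (by omega) hedge_b, add_assoc, hdouble, add_zero,
      hzero (by tauto), hzero (by tauto), add_zero]
  have hparity_a := fold_two_mul_emod_two m a
  have hparity_b := fold_two_mul_emod_two n b
  have hsum := hf.cast_neighborSum_eq_zero (a := fold (2 * m) a) (b := fold (2 * n) b)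
    (by omega) (by omega) (by omega) (by omega) (by omega)
  simp only [neighborSum, Int.cast_add] at hsum
  rcases fold_add_one_and_sub_one (M := 2 * m) (a := a) (by omega) (by omega) (by omega)
    with ⟨h₁, h₂⟩ | ⟨h₁, h₂⟩ <;>
  rcases fold_add_one_and_sub_one (M := 2 * n) (a := b) (by omega) (by omega) (by omega)
    with ⟨h₃, h₄⟩ | ⟨h₃, h₄⟩ <;>
  rw [h₁, h₂, h₃, h₄] <;> linear_combination hsum

lemma IsSignatureDiff.foldedMod_eq_add (hf : IsSignatureDiff m n f) (hm : 0 < m) (hn : 0 < n)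
    (i j : ℤ) : foldedMod m n f (i + j + 1) (i - j) =
      foldedMod m n f (i + 1) i + foldedMod m n f (j + 1) j := by
  refine (hf.isWave_foldedMod hm hn).eq_add (fun a => ?_) i j
  rw [foldedMod, fold_of_mem (a := 0) (by omega) le_rfl (by omega),
    hf.eq_zero_of_boundary (by simp), Int.cast_zero]

lemma IsSignatureDiff.foldedMod_ne_zero_iff (hf : IsSignatureDiff m n f) (hm : 0 < m) (hn : 0 < n)
    (i j : ℤ) : foldedMod m n f (i + j + 1) (i - j) ≠ 0 ↔ profile m n f i ≠ profile m n f j := by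
  rw [hf.foldedMod_eq_add hm hn, profile, profile]
  generalize foldedMod m n f (i + 1) i = u
  generalize foldedMod m n f (j + 1) j = v
  revert u v
  decide

lemma IsSignatureDiff.profile_reflect (hf : IsSignatureDiff m n f) (hm : 0 < m) (hn : 0 < n)
    {q : ℤ} (hq : 0 ≤ q) (hqm : q ≤ m) (h : ∀ b, f (2 * q) b = 0) (i : ℤ) :
    profile m n f (2 * q - 1 - i) = profile m n f i := by
  rw [← not_ne_iff, ← hf.foldedMod_ne_zero_iff hm hn, not_ne_iff,
    show 2 * q - 1 - i + i + 1 = 2 * q by ring, foldedMod,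
    fold_of_mem (a := 2 * q) (by omega) (by omega) (by omega), h, Int.cast_zero]

lemma IsSignatureDiff.isProfile_profile (hf : IsSignatureDiff m n f) (hm : 0 < m) (hn : 0 < n) :
    IsProfile m n f (profile m n f) := by
  have hneg : ∀ i, profile m n f (-1 - i) = profile m n f i := fun i => by
    simpa using hf.profile_reflect hm hn le_rfl hm.le
      (fun b => hf.eq_zero_of_boundary (by simp)) i
  refine
    { values := fun i => ?_
      neg := hneg
      refl₁ := hf.profile_reflect hm hn hm.le le_rfl fun b => hf.eq_zero_of_boundary (by simp)
      refl₂ := fun i => ?_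
      ne_iff := fun i j h₁ h₂ h₃ h₄ => ?_
      diag := fun i h₁ h₂ h₃ => ?_
      vanish := fun q h₁ h₂ h => hf.profile_reflect hm hn h₁ h₂ h }
  · have := ZMod.val_lt (foldedMod m n f (i + 1) i)
    unfold profile
    omega
  · rw [← hneg i, ← not_ne_iff, ← hf.foldedMod_ne_zero_iff hm hn, not_ne_iff,
      show 2 * n - 1 - i - (-1 - i) = 2 * n by ring, foldedMod,
      fold_of_mem (a := 2 * n) (by omega) (by omega) le_rfl, hf.eq_zero_of_boundary (by simp),
      Int.cast_zero]
  · rw [← hf.foldedMod_ne_zero_iff hm hn, foldedMod_of_mem hm hn h₁ h₂ h₃ h₄, hf.cast_ne_zero]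
  · rw [profile, foldedMod_of_mem hm hn (by omega) h₂ h₁ h₃, ← hf.cast_ne_zero]
    generalize (f (i + 1) i : ZMod 2) = u
    revert u
    decide

end Profile

/-! ### Counting the support of a difference -/

section PeriodicSums

open Finset

variable {M : Type*} [AddCommGroup M] {h : ℤ → M}

lemma sum_range_add_of_periodic {T : ℕ} (hT : Function.Periodic h T) (c : ℤ) :
    ∑ i ∈ range T, h (i + c) = ∑ i ∈ range T, h i := by
  have hshift : Function.Periodic (fun c : ℤ => ∑ i ∈ range T, h (i + c)) 1 := fun c => by
    apply add_right_cancel (b := h c)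
    have hsum := (sum_range_succ' (fun i : ℕ => h (i + c)) T).symm.trans
      (sum_range_succ (fun i : ℕ => h (i + c)) T)
    rw [add_comm (T : ℤ), hT] at hsum
    simpa only [Nat.cast_add, Nat.cast_one, Nat.cast_zero, zero_add, add_assoc,
      add_comm (1 : ℤ)] using hsum
  simpa using apply_eq_of_periodic_one hshift c 0

lemma sum_range_mul_of_periodic {T : ℕ} (hT : Function.Periodic h T) (k : ℕ) :
    ∑ i ∈ range (k * T), h i = k • ∑ i ∈ range T, h i := by
  induction k with
  | zero => simp
  | succ k ih =>
    rw [Nat.succ_mul, sum_range_add, ih, succ_nsmul, ← sum_range_add_of_periodic hT ((k * T : ℕ))]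
    simp only [Nat.cast_add, add_comm]

lemma sum_range_two_mul_of_even {L : ℕ} (heven : ∀ i, h (-i) = h i)
    (hT : Function.Periodic h (2 * L)) (h0 : h 0 = 0) (hL : h L = 0) :
    ∑ i ∈ range (2 * L), h i = 2 • ∑ i ∈ range L, h i := by
  have hreflect : ∑ i ∈ range L, h ((L + (L - 1 - i) : ℕ) : ℤ) =
      ∑ i ∈ range L, h ((i + 1 : ℕ) : ℤ) := by
    refine sum_congr rfl fun i hi => ?_
    rw [mem_range] at hi
    rw [← heven, ← hT]
    congr 1
    omega
  have hshift := (sum_range_succ' (fun i : ℕ => h i) L).symm.trans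
    (sum_range_succ (fun i : ℕ => h i) L)
  rw [Nat.cast_zero, h0, hL, add_zero, add_zero] at hshift
  rw [two_mul L, sum_range_add, ← sum_range_reflect (fun i => h ((L + i : ℕ) : ℤ)), hreflect,
    hshift, two_nsmul]

lemma sum_range_two_mul_eq_sum_pairs (h : ℤ → M) (L : ℕ) :
    ∑ i ∈ range (2 * L), h i = ∑ j ∈ range L, (h (2 * j) + h (2 * j + 1)) := by
  induction L with
  | zero => simp
  | succ L ih =>
    rw [show 2 * (L + 1) = 2 * L + 1 + 1 by ring, sum_range_succ, sum_range_succ, ih,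
      sum_range_succ, add_assoc]
    push_cast
    rfl

lemma sum_Ioo_eq_sum_range (h0 : h 0 = 0) (L : ℕ) :
    ∑ a ∈ Ioo (0 : ℤ) L, h a = ∑ a ∈ range L, h a := by
  have hIco : ∑ a ∈ range L, h a = ∑ a ∈ Ico (0 : ℤ) L, h a := by
    refine sum_nbij (fun a : ℕ => (a : ℤ)) (fun a ha => ?_) Nat.cast_injective.injOn
      (fun a ha => ?_) (fun _ _ => rfl)
    · rw [mem_range] at ha
      rw [mem_Ico]
      omega
    · rw [coe_Ico, Set.mem_Ico] at ha
      exact ⟨a.toNat, by rw [coe_range, Set.mem_Iio]; omega, by simp [ha.1]⟩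
  rw [hIco]
  refine sum_subset Ioo_subset_Ico_self fun a ha ha' => ?_
  rw [mem_Ico] at ha
  rw [mem_Ioo] at ha'
  rw [show a = 0 by omega, h0]

end PeriodicSums

/-- For values in `{0, 1}`: the indicator of `A i ≠ A j`. -/
def discord (A : ℤ → ℤ) (i j : ℤ) : ℤ := A i + A j - 2 * A i * A j

/-- The function on the plane whose value at the point with diagonal coordinates `i`, `j`, that is
`(i + j + 1, i - j)`, is `discord A i j`; it vanishes at the points with even coordinate sum, which
have no such coordinates. -/
def discordAt (A : ℤ → ℤ) (a b : ℤ) : ℤ :=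
  if (a + b) % 2 = 1 then discord A ((a + b - 1) / 2) ((a - b - 1) / 2) else 0

section Discord

variable {A : ℤ → ℤ}

lemma discord_comm (A : ℤ → ℤ) (i j : ℤ) : discord A i j = discord A j i := by
  unfold discord
  ring

lemma discordAt_diagonal (A : ℤ → ℤ) (i j : ℤ) :
    discordAt A (i + j + 1) (i - j) = discord A i j := by
  rw [discordAt, if_pos (by omega)]
  congr 1 <;> omega

lemma discordAt_of_even {a b : ℤ} (h : (a + b) % 2 ≠ 1) : discordAt A a b = 0 := if_neg h

lemma even_or_exists_diagonal (a b : ℤ) :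
    (a + b) % 2 ≠ 1 ∨ ∃ i j : ℤ, a = i + j + 1 ∧ b = i - j := by
  by_cases h : (a + b) % 2 = 1
  · exact Or.inr ⟨(a + b - 1) / 2, (a - b - 1) / 2, by omega, by omega⟩
  · exact Or.inl h

lemma periodic_of_reflect {L : ℤ} (hneg : ∀ i, A (-1 - i) = A i)
    (hL : ∀ i, A (2 * L - 1 - i) = A i) : Function.Periodic A (2 * L) := fun i => by
  rw [← hneg i, ← hL (-1 - i)]
  ring_nf

lemma discordAt_neg_left (hneg : ∀ i, A (-1 - i) = A i) (a b : ℤ) :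
    discordAt A (-a) b = discordAt A a b := by
  rcases even_or_exists_diagonal a b with h | ⟨i, j, rfl, rfl⟩
  · rw [discordAt_of_even h, discordAt_of_even (by omega)]
  · rw [discordAt_diagonal, show -(i + j + 1) = (-1 - j) + (-1 - i) + 1 by ring,
      show i - j = (-1 - j) - (-1 - i) by ring, discordAt_diagonal, discord_comm]
    simp only [discord, hneg]

lemma discordAt_neg_right (A : ℤ → ℤ) (a b : ℤ) : discordAt A a (-b) = discordAt A a b := by
  rcases even_or_exists_diagonal a b with h | ⟨i, j, rfl, rfl⟩
  · rw [discordAt_of_even h, discordAt_of_even (by omega)]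
  · rw [discordAt_diagonal, neg_sub, add_comm i j, discordAt_diagonal, discord_comm]

lemma discordAt_periodic_left {L : ℤ} (hL : Function.Periodic A L) (b : ℤ) :
    Function.Periodic (fun a => discordAt A a b) (2 * L) := fun a => by
  dsimp only
  rcases even_or_exists_diagonal a b with h | ⟨i, j, rfl, rfl⟩
  · rw [discordAt_of_even h, discordAt_of_even (by omega)]
  · rw [discordAt_diagonal, show i + j + 1 + 2 * L = (i + L) + (j + L) + 1 by ring,
      ← add_sub_add_right_eq_sub i j L, discordAt_diagonal]
    simp only [discord, hL i, hL j]

lemma discordAt_periodic_right {L : ℤ} (hL : Function.Periodic A L) (a : ℤ) :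
    Function.Periodic (discordAt A a) (2 * L) := fun b => by
  rcases even_or_exists_diagonal a b with h | ⟨i, j, rfl, rfl⟩
  · rw [discordAt_of_even h, discordAt_of_even (by omega)]
  · rw [discordAt_diagonal, show i - j + 2 * L = (i + L) - (j - L) by ring,
      show i + j + 1 = (i + L) + (j - L) + 1 by ring, discordAt_diagonal]
    simp only [discord, hL i, hL.sub_eq j]

lemma discordAt_left_eq_zero (hvals : ∀ i, A i = 0 ∨ A i = 1) {L : ℤ}
    (hL : ∀ i, A (2 * L - 1 - i) = A i) (b : ℤ) : discordAt A (2 * L) b = 0 := by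
  rcases even_or_exists_diagonal (2 * L) b with h | ⟨i, j, h, rfl⟩
  · exact discordAt_of_even h
  · rw [h, discordAt_diagonal, discord, show j = 2 * L - 1 - i by omega, hL]
    rcases hvals i with hi | hi <;> rw [hi] <;> norm_num

lemma discordAt_right_eq_zero (hvals : ∀ i, A i = 0 ∨ A i = 1) {L : ℤ}
    (hL : Function.Periodic A L) (a : ℤ) : discordAt A a L = 0 := by
  rcases even_or_exists_diagonal a L with h | ⟨i, j, rfl, h⟩
  · exact discordAt_of_even h
  · rw [h, discordAt_diagonal, discord, show i = j + L by omega, hL]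
    rcases hvals j with hj | hj <;> rw [hj] <;> norm_num

open Finset

lemma sum_discordAt_range_two_mul {T : ℕ} (hT : Function.Periodic A T) (b : ℤ) :
    ∑ a ∈ range (2 * T), discordAt A a b = ∑ j ∈ range T, discord A (j + b) j := by
  rw [← sum_range_add_of_periodic (h := fun a => discordAt A a b)
    (by simpa using discordAt_periodic_left hT b) b,
    sum_range_two_mul_eq_sum_pairs (fun a => discordAt A (a + b) b)]
  refine sum_congr rfl fun j _ => ?_
  rw [discordAt_of_even (by omega), zero_add, ← discordAt_diagonal]
  congr 1 <;> ring

lemma sum_sum_discord (A : ℤ → ℤ) (T : ℕ) :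
    ∑ j ∈ range T, ∑ i ∈ range T, discord A i j =
      2 * (∑ i ∈ range T, A i) * (T - ∑ i ∈ range T, A i) := by
  simp only [discord, sum_add_distrib, sum_sub_distrib, ← mul_sum, ← sum_mul, sum_const,
    card_range, nsmul_eq_mul]
  ring

lemma sum_sum_discordAt {T : ℕ} (hT : Function.Periodic A T) (m' n' : ℕ) :
    ∑ b ∈ range (2 * (n' * T)), ∑ a ∈ range (2 * (m' * T)), discordAt A a b =
      4 * (∑ i ∈ range T, A i) * (T - ∑ i ∈ range T, A i) * m' * n' := by
  have hperiodic_left : ∀ j, Function.Periodic (fun i => discord A i j) T := fun j i => by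
    simp only [discord, hT i]
  have hperiodic_right : Function.Periodic (fun j => ∑ i ∈ range T, discord A i j) T := fun j => by
    simp only [discord, hT j]
  have hrow : ∀ j : ℤ, ∑ b ∈ range (2 * (n' * T)), discord A (j + b) j =
      (2 * n') • ∑ i ∈ range T, discord A i j := fun j => by
    simp only [add_comm j]
    rw [← mul_assoc, sum_range_mul_of_periodic (h := fun b => discord A (b + j) j)
      (fun i => by simpa only [add_right_comm] using hperiodic_left j (i + j)),
      sum_range_add_of_periodic (hperiodic_left j)]
  simp only [sum_discordAt_range_two_mul (T := m' * T) (by simpa using hT.nat_mul m')]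
  rw [sum_comm]
  simp only [hrow]
  rw [← smul_sum, sum_range_mul_of_periodic hperiodic_right, sum_sum_discord]
  simp only [nsmul_eq_mul]
  push_cast
  ring

end Discord

section SupportCard

open Finset

variable {m n : ℕ} {f : ℤ → ℤ → ℤ} {A : ℤ → ℤ}

lemma sum_range_two_mul_of_reflect {q : ℕ} (hq : ∀ i, A (2 * q - 1 - i) = A i) :
    ∑ i ∈ range (2 * q), A i = 2 * ∑ i ∈ range q, A i := by
  rw [two_mul q, sum_range_add, ← sum_range_reflect (fun i => A ((q + i : ℕ) : ℤ)), two_mul]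
  congr 1
  refine sum_congr rfl fun i hi => ?_
  rw [mem_range] at hi
  rw [← hq]
  congr 1
  omega

lemma IsProfile.discordAt_eq (hA : IsProfile m n f A)
    (hf : IsSignatureDiff m n f) {a b : ℤ} (ha : 0 ≤ a) (ha' : a ≤ 2 * m) (hb : 0 ≤ b)
    (hb' : b ≤ 2 * n) : discordAt A a b = if f a b ≠ 0 then 1 else 0 := by
  rcases even_or_exists_diagonal a b with h | ⟨i, j, rfl, rfl⟩
  · rw [discordAt_of_even h, if_neg fun hne => h (hf.supp _ _ hne).2.2.2.2]
  · rw [discordAt_diagonal]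
    simp only [hA.ne_iff i j ha ha' hb hb', discord]
    rcases hA.values i with h | h <;> rcases hA.values j with h' | h' <;> simp [h, h']

lemma IsProfile.supportCard_eq_sum (hA : IsProfile m n f A)
    (hf : IsSignatureDiff m n f) :
    (supportCard m n f : ℤ) = ∑ a ∈ range (2 * m), ∑ b ∈ range (2 * n), discordAt A a b := by
  have hzero : ∀ {a b}, a = 0 ∨ b = 0 → f a b = 0 := fun h =>
    hf.eq_zero_of_boundary (by tauto)
  have hm : 2 * (m : ℤ) = ((2 * m : ℕ) : ℤ) := by push_cast; rfl
  have hn : 2 * (n : ℤ) = ((2 * n : ℕ) : ℤ) := by push_cast; rfl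
  rw [supportCard, card_filter, sum_product, Nat.cast_sum, hm, hn,
    sum_Ioo_eq_sum_range (by simp [hzero])]
  refine sum_congr rfl fun a ha => ?_
  rw [Nat.cast_sum, sum_Ioo_eq_sum_range (by simp [hzero])]
  refine sum_congr rfl fun b hb => ?_
  rw [mem_range] at ha hb
  rw [hA.discordAt_eq hf (by omega) (by omega) (by omega) (by omega)]
  push_cast
  rfl

/-- The box `[0, 2m] × [0, 2n]` is a fundamental domain of the torus with sides `4m` and `4n` under
the two reflections, and `f` vanishes on its boundary. -/
lemma IsProfile.four_mul_supportCard (hA : IsProfile m n f A)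
    (hf : IsSignatureDiff m n f) :
    4 * (supportCard m n f : ℤ) =
      ∑ b ∈ range (2 * (2 * n)), ∑ a ∈ range (2 * (2 * m)), discordAt A a b := by
  have hperiodic_m := periodic_of_reflect hA.neg hA.refl₁
  have hperiodic_n := periodic_of_reflect hA.neg hA.refl₂
  have hrow : ∀ b : ℤ, ∑ a ∈ range (2 * (2 * m)), discordAt A a b =
      2 * ∑ a ∈ range (2 * m), discordAt A a b := fun b => by
    rw [sum_range_two_mul_of_even (h := fun a => discordAt A a b), nsmul_eq_mul,
      Nat.cast_ofNat]
    · exact fun a => discordAt_neg_left hA.neg a b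
    · simpa using discordAt_periodic_left hperiodic_m b
    · exact discordAt_left_eq_zero hA.values (L := 0) (by simpa using hA.neg) b
    · simpa using discordAt_left_eq_zero hA.values hA.refl₁ b
  rw [sum_range_two_mul_of_even (h := fun b => ∑ a ∈ range (2 * (2 * m)), discordAt A a b)]
  · simp only [hrow]
    rw [hA.supportCard_eq_sum hf, sum_comm, ← mul_sum, two_nsmul]
    ring
  · exact fun b => sum_congr rfl fun a _ => discordAt_neg_right A a b
  · exact fun b => sum_congr rfl fun a _ => by
      simpa using discordAt_periodic_right hperiodic_n a b
  · exact sum_eq_zero fun a _ => discordAt_right_eq_zero hA.values (fun i => by rw [add_zero]) a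
  · exact sum_eq_zero fun a _ => discordAt_right_eq_zero hA.values (by simpa using hperiodic_n) a

lemma IsProfile.supportCard_eq {q m' n' : ℕ} (hA : IsProfile m n f A)
    (hf : IsSignatureDiff m n f) (hq : ∀ i, A (2 * q - 1 - i) = A i) (hm : m = q * m')
    (hn : n = q * n') :
    (supportCard m n f : ℤ) =
      4 * (∑ i ∈ range q, A i) * (q - ∑ i ∈ range q, A i) * m' * n' := by
  have hcount := hA.four_mul_supportCard hf
  rw [show 2 * n = n' * (2 * q) by rw [hn]; ring, show 2 * m = m' * (2 * q) by rw [hm]; ring,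
    sum_sum_discordAt (by simpa using periodic_of_reflect hA.neg hq),
    sum_range_two_mul_of_reflect hq] at hcount
  push_cast at hcount
  linarith

end SupportCard

/-! ### Even sets of edges as boundaries -/

/-- A set of edges of the grid with an even number of edges at each vertex. -/
structure IsEvenSet (m n : ℤ) (e : MidpointSet) : Prop where
  supp : WithinGrid m n e
  even : ∀ x y, edgeCount e (2 * x + 1) (2 * y + 1) % 2 = 0

/-- The multiplicative indicator of a set of edges: `-1` on the set and `1` elsewhere. -/
noncomputable def edgeSign (e : MidpointSet) (a b : ℤ) : ℤ := 1 - 2 * ind (e a b)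

/-- The multiplicative indicator of the region bounded by an even set of edges, as a function of
the cells: the sign of a cell is read off a ray going down from it. -/
noncomputable def regionSign (e : MidpointSet) (x y : ℤ) : ℤ :=
  ∏ j ∈ Finset.range y.toNat, edgeSign e (2 * x) (2 * j + 1)

section Region
variable {m n : ℤ} {e : MidpointSet}

lemma edgeSign_mul_self (e : MidpointSet) (a b : ℤ) : edgeSign e a b * edgeSign e a b = 1 := by
  rcases ind_eq_one_or_zero (e a b) with h | h <;> simp [edgeSign, h.2]

lemma WithinGrid.edgeSign_eq_one (h : WithinGrid m n e) {a b : ℤ}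
    (hab : a ≤ 0 ∨ 2 * m ≤ a ∨ b ≤ 0 ∨ 2 * n ≤ b) : edgeSign e a b = 1 := by
  have hout : ¬e a b := fun he => by have := h a b he; omega
  simp [edgeSign, ind_false hout]

lemma IsEvenSet.edgeSign_vertex (h : IsEvenSet m n e) (x y : ℤ) :
    edgeSign e (2 * x + 2) (2 * y + 1) * edgeSign e (2 * x) (2 * y + 1) *
      edgeSign e (2 * x + 1) (2 * y + 2) * edgeSign e (2 * x + 1) (2 * y) = 1 := by
  have heven := h.even x y
  simp only [edgeCount, neighborSum, add_sub_cancel_right, add_assoc, Int.reduceAdd] at heven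
  simp only [edgeSign]
  rcases ind_eq_one_or_zero (e (2 * x + 2) (2 * y + 1)) with h1 | h1 <;>
  rcases ind_eq_one_or_zero (e (2 * x) (2 * y + 1)) with h2 | h2 <;>
  rcases ind_eq_one_or_zero (e (2 * x + 1) (2 * y + 2)) with h3 | h3 <;>
  rcases ind_eq_one_or_zero (e (2 * x + 1) (2 * y)) with h4 | h4 <;>
  rw [h1.2, h2.2, h3.2, h4.2] at heven ⊢ <;> omega

lemma regionSign_mul_self (e : MidpointSet) (x y : ℤ) :
    regionSign e x y * regionSign e x y = 1 := by
  rw [regionSign, ← Finset.prod_mul_distrib]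
  exact Finset.prod_eq_one fun j _ => edgeSign_mul_self _ _ _

lemma regionSign_add_one (e : MidpointSet) (x : ℤ) {y : ℤ} (hy : 0 ≤ y) :
    regionSign e x (y + 1) = regionSign e x y * edgeSign e (2 * x) (2 * y + 1) := by
  lift y to ℕ using hy
  simp only [regionSign]
  rw [show ((y : ℤ) + 1).toNat = y + 1 by omega, Finset.prod_range_succ, Int.toNat_natCast]

lemma regionSign_mul_up (e : MidpointSet) (x : ℤ) {y : ℤ} (hy : 0 ≤ y) :
    regionSign e x y * regionSign e x (y + 1) = edgeSign e (2 * x) (2 * y + 1) := by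
  rw [regionSign_add_one e x hy, ← mul_assoc, regionSign_mul_self, one_mul]

/-- By induction along the rays below the two cells: the vertex between two steps has even
degree. -/
lemma IsEvenSet.regionSign_mul_right (h : IsEvenSet m n e) (x : ℤ) {y : ℤ} (hy : 0 ≤ y) :
    regionSign e x y * regionSign e (x + 1) y = edgeSign e (2 * x + 1) (2 * y) := by
  lift y to ℕ using hy
  induction y with
  | zero => rw [h.supp.edgeSign_eq_one (by simp)]; simp [regionSign]
  | succ k ih =>
    have hvertex := h.edgeSign_vertex x k
    have hsq := edgeSign_mul_self e (2 * x + 1) (2 * k + 2)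
    push_cast
    rw [regionSign_add_one _ _ (by omega), regionSign_add_one _ _ (by omega),
      show 2 * (x + 1) = 2 * x + 2 by ring, show 2 * ((k : ℤ) + 1) = 2 * k + 2 by ring]
    linear_combination (edgeSign e (2 * x) (2 * k + 1) * edgeSign e (2 * x + 2) (2 * k + 1)) * ih +
      edgeSign e (2 * x + 1) (2 * k + 2) * hvertex - (edgeSign e (2 * x + 2) (2 * k + 1) *
        edgeSign e (2 * x) (2 * k + 1) * edgeSign e (2 * x + 1) (2 * k)) * hsq

lemma IsEvenSet.regionSign_outside (h : IsEvenSet m n e) {x y : ℤ}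
    (hxy : x ≤ 0 ∨ m ≤ x ∨ y ≤ 0 ∨ n ≤ y) : regionSign e x y = 1 := by
  have outside_of_left_right {x y : ℤ} (hx : x ≤ 0 ∨ m ≤ x) : regionSign e x y = 1 :=
    Finset.prod_eq_one fun j _ => h.supp.edgeSign_eq_one (by omega)
  by_cases hy : y ≤ 0
  · rw [regionSign, Int.toNat_of_nonpos hy, Finset.prod_range_zero]
  by_cases hx : x ≤ 0 ∨ m ≤ x
  · exact outside_of_left_right hx
  have hconst : Function.Periodic (fun i => regionSign e i y) 1 := fun i => by
    have hright := h.regionSign_mul_right i (y := y) (by omega)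
    rw [h.supp.edgeSign_eq_one (by omega)] at hright
    linear_combination regionSign e i y * hright -
      regionSign e (i + 1) y * regionSign_mul_self e i y
  exact (apply_eq_of_periodic_one hconst x 0).trans (outside_of_left_right (by simp))

end Region

/-! ### Discrete antiderivatives and weights -/

/-- The sign `(-1) ^ u`, for an integer exponent. -/
def paritySign (u : ℤ) : ℤ := if u % 2 = 0 then 1 else -1

/-- The sequence of signs of period four which starts with `1, 1, -1, -1`. -/
def quarterSign (u : ℤ) : ℤ := if u % 4 < 2 then 1 else -1

lemma paritySign_add (u v : ℤ) : paritySign (u + v) = paritySign u * paritySign v := by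
  unfold paritySign
  split_ifs <;> omega

lemma paritySign_sub (u v : ℤ) : paritySign (u - v) = paritySign u * paritySign v := by
  unfold paritySign
  split_ifs <;> omega

lemma paritySign_neg (u : ℤ) : paritySign (-u) = paritySign u := by
  unfold paritySign
  split_ifs <;> omega

lemma paritySign_mul_self (u : ℤ) : paritySign u * paritySign u = 1 := by
  unfold paritySign
  split_ifs <;> norm_num

lemma paritySign_of_even {u : ℤ} (h : u % 2 = 0) : paritySign u = 1 := if_pos h

lemma paritySign_of_odd {u : ℤ} (h : u % 2 = 1) : paritySign u = -1 := if_neg (by omega)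

lemma quarterSign_mul_self (u : ℤ) : quarterSign u * quarterSign u = 1 := by
  unfold quarterSign
  split_ifs <;> norm_num

lemma quarterSign_add_two_mul (u k : ℤ) :
    quarterSign (u + 2 * k) = paritySign k * quarterSign u := by
  unfold quarterSign paritySign
  split_ifs <;> omega

lemma quarterSign_add_two (u : ℤ) : quarterSign (u + 2) = -quarterSign u := by
  simpa [paritySign_of_odd] using quarterSign_add_two_mul u 1

lemma quarterSign_neg_mul (u : ℤ) : quarterSign (-u) * quarterSign u = paritySign u := by
  unfold quarterSign paritySign
  split_ifs <;> omega

/-- The discrete antiderivative of `A` which vanishes at `0`. -/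
def primitive (A : ℤ → ℤ) (i : ℤ) : ℤ :=
  ∑ j ∈ Finset.range i.toNat, A j - ∑ j ∈ Finset.range (-i).toNat, A (-1 - j)

lemma primitive_natCast (A : ℤ → ℤ) (k : ℕ) :
    primitive A k = ∑ j ∈ Finset.range k, A j := by
  simp [primitive]

lemma primitive_zero (A : ℤ → ℤ) : primitive A 0 = 0 := primitive_natCast A 0

lemma primitive_add_one (A : ℤ → ℤ) (i : ℤ) : primitive A (i + 1) = primitive A i + A i := by
  rcases lt_or_ge i 0 with hi | hi
  · obtain ⟨k, rfl⟩ : ∃ k : ℕ, i = -1 - k := ⟨(-1 - i).toNat, by omega⟩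
    rw [primitive, primitive, show (-1 - (k : ℤ) + 1).toNat = 0 by omega,
      show (-1 - (k : ℤ)).toNat = 0 by omega, show (-(-1 - (k : ℤ) + 1)).toNat = k by omega,
      show (-(-1 - (k : ℤ))).toNat = k + 1 by omega, Finset.sum_range_succ]
    ring
  · lift i to ℕ using hi
    rw [primitive_natCast, ← Finset.sum_range_succ, ← primitive_natCast, Nat.cast_add_one]

section Primitive
variable {A : ℤ → ℤ}

lemma primitive_reflect {L : ℤ} (hL : ∀ i, A (2 * L - 1 - i) = A i) (y : ℤ) :
    primitive A (L + y) + primitive A (L - y) = 2 * primitive A L := by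
  have hconst : Function.Periodic (fun y => primitive A (L + y) + primitive A (L - y)) 1 :=
    fun y => by
      have hleft := primitive_add_one A (L - (y + 1))
      have hrefl := hL (L + y)
      rw [show L - (y + 1) + 1 = L - y by ring] at hleft
      rw [show 2 * L - 1 - (L + y) = L - (y + 1) by ring] at hrefl
      simp only [← add_assoc, primitive_add_one]
      linarith
  have h0 := apply_eq_of_periodic_one hconst y 0
  simp only [add_zero, sub_zero] at h0
  linarith

lemma primitive_neg (hneg : ∀ i, A (-1 - i) = A i) (y : ℤ) :
    primitive A (-y) = -primitive A y := by
  have h := primitive_reflect (L := 0) (by simpa using hneg) y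
  simp only [zero_add, zero_sub, primitive_zero] at h
  linarith

lemma primitive_mul (hneg : ∀ i, A (-1 - i) = A i) {L : ℤ} (hL : ∀ i, A (2 * L - 1 - i) = A i)
    (j : ℕ) : primitive A (j * L) = j * primitive A L := by
  induction j using Nat.twoStepInduction with
  | zero => simp [primitive_zero]
  | one => simp
  | more j ih _ =>
    have h := primitive_reflect hL ((j + 1) * L)
    rw [show L - (j + 1) * L = -(j * L) by ring, primitive_neg hneg, ih] at h
    push_cast
    rw [show ((j : ℤ) + 2) * L = L + (j + 1) * L by ring]
    linarith

end Primitive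

/-- A sign attached to each cell. Across a side of the cells which belongs to the difference
described by the profile `A`, the weight changes or keeps its sign according to the direction in
which `A` jumps. -/
def weight (A : ℤ → ℤ) (x y : ℤ) : ℤ :=
  quarterSign (primitive A (x + y) + primitive A (x - y) - (x - y)) *
    quarterSign (x + y - primitive A (x + y) + primitive A (x - y))

section Weight
variable {A : ℤ → ℤ} (hA : ∀ i, A i = 0 ∨ A i = 1)
include hA

lemma weight_right (x y : ℤ) :
    weight A (x + 1) y * (A (x + y) - A (x - y)) ^ 2 = weight A x y * (A (x + y) - A (x - y)) := by
  unfold weight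
  rw [show x + 1 + y = x + y + 1 by ring, show x + 1 - y = x - y + 1 by ring, primitive_add_one,
    primitive_add_one]
  set p := primitive A (x + y)
  set q := primitive A (x - y)
  rcases hA (x + y) with h | h <;> rcases hA (x - y) with h' | h' <;> rw [h, h']
  · ring
  · rw [show p + 0 + (q + 1) - (x - y + 1) = p + q - (x - y) by ring,
      show x + y + 1 - (p + 0) + (q + 1) = x + y - p + q + 2 by ring, quarterSign_add_two]
    ring
  · rw [show p + 1 + (q + 0) - (x - y + 1) = p + q - (x - y) by ring,
      show x + y + 1 - (p + 1) + (q + 0) = x + y - p + q by ring]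
    ring
  · ring

lemma weight_up (x y : ℤ) :
    weight A x (y + 1) * (A (x + y) - A (x - y - 1)) ^ 2 =
      -weight A x y * (A (x + y) - A (x - y - 1)) := by
  have hq := primitive_add_one A (x - y - 1)
  rw [sub_add_cancel] at hq
  unfold weight
  rw [show x + (y + 1) = x + y + 1 by ring, show x - (y + 1) = x - y - 1 by ring,
    primitive_add_one, hq]
  set p := primitive A (x + y)
  set q := primitive A (x - y - 1)
  rcases hA (x + y) with h | h <;> rcases hA (x - y - 1) with h' | h' <;> rw [h, h']
  · ring
  · rw [show p + 0 + q - (x - y - 1) = p + (q + 1) - (x - y) by ring,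
      show x + y + 1 - (p + 0) + q = x + y - p + (q + 1) by ring]
    ring
  · rw [show p + 1 + q - (x - y - 1) = p + (q + 0) - (x - y) + 2 by ring,
      show x + y + 1 - (p + 1) + q = x + y - p + (q + 0) by ring, quarterSign_add_two]
    ring
  · ring

lemma weight_right_symm (x y : ℤ) :
    weight A x y * (A (x + y) - A (x - y)) ^ 2 = weight A (x + 1) y * (A (x + y) - A (x - y)) := by
  have h := weight_right hA x y
  rcases hA (x + y) with h1 | h1 <;> rcases hA (x - y) with h2 | h2 <;> rw [h1, h2] at h ⊢ <;>
    linarith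

lemma weight_up_symm (x y : ℤ) :
    weight A x y * (A (x + y) - A (x - y - 1)) ^ 2 =
      -weight A x (y + 1) * (A (x + y) - A (x - y - 1)) := by
  have h := weight_up hA x y
  rcases hA (x + y) with h1 | h1 <;> rcases hA (x - y - 1) with h2 | h2 <;> rw [h1, h2] at h ⊢ <;>
    linarith

end Weight

section WeightOnSides
variable {A : ℤ → ℤ}

lemma weight_zero_left (hneg : ∀ i, A (-1 - i) = A i) (y : ℤ) :
    weight A 0 y = paritySign (primitive A y) := by
  unfold weight
  rw [zero_add, zero_sub, primitive_neg hneg, add_neg_cancel, zero_sub, neg_neg,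
    show y - primitive A y + -primitive A y = y + 2 * -primitive A y by ring,
    quarterSign_add_two_mul, mul_left_comm, quarterSign_mul_self, mul_one, paritySign_neg]

lemma weight_zero_right (A : ℤ → ℤ) (x : ℤ) : weight A x 0 = paritySign (primitive A x + x) := by
  unfold weight
  rw [add_zero, sub_zero, show primitive A x + primitive A x - x = -x + 2 * primitive A x by ring,
    quarterSign_add_two_mul, sub_add_cancel, mul_assoc, quarterSign_neg_mul, paritySign_add]

lemma weight_of_reflect_left {m : ℤ} (hm : ∀ i, A (2 * m - 1 - i) = A i) (y : ℤ) :
    weight A m y = paritySign (primitive A (m + y)) * paritySign m := by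
  have h := primitive_reflect hm y
  unfold weight
  rw [show primitive A (m + y) + primitive A (m - y) - (m - y) =
      y - m + 2 * primitive A m by linarith,
    show m + y - primitive A (m + y) + primitive A (m - y) =
      y - m + 2 * (m + primitive A m - primitive A (m + y)) by linarith,
    quarterSign_add_two_mul, quarterSign_add_two_mul, paritySign_sub, paritySign_add]
  linear_combination (paritySign (primitive A (m + y)) * paritySign m) *
    (quarterSign (y - m) * quarterSign (y - m) * paritySign_mul_self (primitive A m) +
      quarterSign_mul_self (y - m))

lemma weight_of_reflect_right (hneg : ∀ i, A (-1 - i) = A i) {n : ℤ}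
    (hn : ∀ i, A (2 * n - 1 - i) = A i) (x : ℤ) :
    weight A x n = paritySign (primitive A (n + x)) * paritySign x := by
  have hrefl := primitive_reflect hn x
  have hswap := primitive_neg hneg (x - n)
  rw [neg_sub] at hswap
  have hquarter := quarterSign_neg_mul (x - n)
  rw [paritySign_sub] at hquarter
  unfold weight
  rw [add_comm x n,
    show primitive A (n + x) + primitive A (x - n) - (x - n) =
      -(x - n) + 2 * (primitive A (n + x) - primitive A n) by linarith,
    show n + x - primitive A (n + x) + primitive A (x - n) =
      x - n + 2 * (n - primitive A n) by linarith,
    quarterSign_add_two_mul, quarterSign_add_two_mul, paritySign_sub, paritySign_sub]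
  linear_combination paritySign (primitive A (n + x)) *
    (paritySign n * quarterSign (-(x - n)) * quarterSign (x - n) *
        paritySign_mul_self (primitive A n) +
      paritySign n * hquarter + paritySign x * paritySign_mul_self n)

end WeightOnSides

/-! ### The boundary flux -/

/-- The flux of the pair `W`, `S` from the cell `(x, y)` to its right neighbour: the Wronskian of
the two functions. -/
def fluxRight (W S : ℤ → ℤ → ℤ) (x y : ℤ) : ℤ := W x y * S (x + 1) y - S x y * W (x + 1) y

/-- The flux of the pair `W`, `S` from the cell `(x, y)` to the cell above it. -/
def fluxUp (W S : ℤ → ℤ → ℤ) (x y : ℤ) : ℤ := W x y * S x (y + 1) - S x y * W x (y + 1)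

/-- A discrete Green identity: where `W * ΔS = S * ΔW`, the total flux through the boundary
vanishes. -/
lemma boundary_flux_eq_zero {m n : ℕ} {W S : ℤ → ℤ → ℤ}
    (h : ∀ x y : ℤ, 0 < x → x < m + 1 → 0 < y → y < n + 1 →
      W x y * neighborSum S x y = S x y * neighborSum W x y) :
    ∑ y ∈ Finset.range n, (fluxRight W S m (y + 1) - fluxRight W S 0 (y + 1)) +
      ∑ x ∈ Finset.range m, (fluxUp W S (x + 1) n - fluxUp W S (x + 1) 0) = 0 := by
  have hrow (y : ℤ) : fluxRight W S m y - fluxRight W S 0 y =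
      ∑ x ∈ Finset.range m, (fluxRight W S (x + 1) y - fluxRight W S x y) := by
    simpa using (Finset.sum_range_sub (fun x : ℕ => fluxRight W S x y) m).symm
  have hcolumn (x : ℤ) : fluxUp W S x n - fluxUp W S x 0 =
      ∑ y ∈ Finset.range n, (fluxUp W S x (y + 1) - fluxUp W S x y) := by
    simpa using (Finset.sum_range_sub (fun y : ℕ => fluxUp W S x y) n).symm
  simp only [hrow, hcolumn]
  rw [Finset.sum_comm, ← Finset.sum_add_distrib]
  refine Finset.sum_eq_zero fun x hx => ?_
  rw [← Finset.sum_add_distrib]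
  refine Finset.sum_eq_zero fun y hy => ?_
  rw [Finset.mem_range] at hx hy
  have hcell := h (x + 1) (y + 1) (by omega) (by omega) (by omega) (by omega)
  simp only [neighborSum, add_sub_cancel_right] at hcell
  simp only [fluxRight, fluxUp]
  linarith

section SideSums
variable {A : ℤ → ℤ} (hA : ∀ i, A i = 0 ∨ A i = 1)
include hA

lemma sum_paritySign_primitive (c : ℤ) (k : ℕ) :
    ∑ i ∈ Finset.range k, paritySign (primitive A (c + i + 1)) * (A (c + i + 1) - A (c + i)) =
      paritySign (primitive A c) * (1 - A c) -
        paritySign (primitive A (c + k)) * (1 - A (c + k)) := by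
  induction k with
  | zero => simp
  | succ k ih =>
    rw [Finset.sum_range_succ, ih]
    push_cast
    rw [← add_assoc]
    rcases hA (c + k) with h | h
    · rw [primitive_add_one, h, add_zero]; ring
    · rw [h]; ring

lemma sum_paritySign_primitive_add (c : ℤ) (k : ℕ) :
    ∑ i ∈ Finset.range k,
        paritySign (primitive A (c + i + 1) + (c + i + 1)) * (A (c + i) - A (c + i + 1)) =
      paritySign (primitive A c + c) * A c -
        paritySign (primitive A (c + k) + (c + k)) * A (c + k) := by
  induction k with
  | zero => simp
  | succ k ih =>
    rw [Finset.sum_range_succ, ih]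
    push_cast
    rw [← add_assoc c]
    rcases hA (c + k) with h | h
    · rw [h]; ring
    · rw [primitive_add_one, h, show primitive A (c + k) + 1 + (c + k + 1) =
        primitive A (c + k) + (c + k) + 2 by ring, paritySign_add _ 2,
        paritySign_of_even (u := 2) rfl]
      ring

lemma sum_weight_left_side (hneg : ∀ i, A (-1 - i) = A i) (n : ℕ) :
    ∑ y ∈ Finset.range n, weight A 0 (y + 1) * (A (y + 1) - A (-(y + 1))) =
      1 - A 0 - paritySign (primitive A n) * (1 - A n) := by
  have h := sum_paritySign_primitive hA 0 n
  simp only [zero_add, primitive_zero, paritySign_of_even (u := 0) rfl, one_mul] at h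
  rw [← h]
  refine Finset.sum_congr rfl fun y _ => ?_
  rw [weight_zero_left hneg, ← hneg y, neg_add']
  ring_nf

lemma sum_weight_bottom_side (m : ℕ) :
    ∑ x ∈ Finset.range m, weight A (x + 1) 0 * (A (x + 1) - A x) =
      paritySign (primitive A m + m) * A m - A 0 := by
  have h := sum_paritySign_primitive_add hA 0 m
  simp only [zero_add, primitive_zero, paritySign_of_even (u := 0) rfl, one_mul] at h
  rw [← neg_sub, ← h, ← Finset.sum_neg_distrib]
  refine Finset.sum_congr rfl fun x _ => ?_
  rw [weight_zero_right]
  ring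

lemma sum_weight_right_side {m : ℤ} (hm : ∀ i, A (2 * (m + 1) - 1 - i) = A i) (n : ℕ) :
    ∑ y ∈ Finset.range n, weight A (m + 1) (y + 1) * (A (m + (y + 1)) - A (m - (y + 1))) =
      paritySign (m + 1) * (paritySign (primitive A (m + 1 + n)) * (1 - A (m + 1 + n)) -
        paritySign (primitive A (m + 1)) * (1 - A (m + 1))) := by
  rw [← neg_sub, ← sum_paritySign_primitive hA, ← Finset.sum_neg_distrib, Finset.mul_sum]
  refine Finset.sum_congr rfl fun y _ => ?_
  rw [weight_of_reflect_left hm, ← hm (m - (y + 1))]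
  ring_nf

lemma sum_weight_top_side (hneg : ∀ i, A (-1 - i) = A i) {n : ℤ}
    (hn : ∀ i, A (2 * (n + 1) - 1 - i) = A i) (m : ℕ) :
    ∑ x ∈ Finset.range m, weight A (x + 1) (n + 1) * (A (x + 1 + n) - A (x + 1 - n - 1)) =
      paritySign (n + 1) * (paritySign (primitive A (n + 1) + (n + 1)) * A (n + 1) -
        paritySign (primitive A (n + 1 + m) + (n + 1 + m)) * A (n + 1 + m)) := by
  rw [← sum_paritySign_primitive_add hA, Finset.mul_sum]
  refine Finset.sum_congr rfl fun x _ => ?_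
  rw [weight_of_reflect_right hneg hn, ← hneg (x + 1 - n - 1), ← hn (-1 - (x + 1 - n - 1)),
    add_assoc (n + 1) (x : ℤ) 1, paritySign_add (primitive A _), paritySign_add (n + 1)]
  have hsq := paritySign_mul_self (n + 1)
  ring_nf at hsq ⊢
  rw [hsq]
  ring_nf

end SideSums

section Difference
variable {m n : ℤ} {e₁ e₂ : MidpointSet} {A : ℤ → ℤ}

lemma IsEvenSet.isSignatureDiff (h₁ : IsEvenSet m n e₁) (h₂ : IsEvenSet m n e₂)
    (hc : CellSumsVanish m n (edgeDiff e₁ e₂)) : IsSignatureDiff m n (edgeDiff e₁ e₂) where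
  values a b := by
    unfold edgeDiff
    rcases ind_eq_one_or_zero (e₁ a b) with h | h <;>
      rcases ind_eq_one_or_zero (e₂ a b) with h' | h' <;> rw [h.2, h'.2] <;> norm_num
  supp a b h := by
    have := edgeDiff_ne_zero.1 h
    by_cases h' : e₁ a b
    · exact h₁.supp a b h'
    · exact h₂.supp a b (by tauto)
  vertex x y := by
    have heven₁ := h₁.even x y
    have heven₂ := h₂.even x y
    rw [neighborSum_edgeDiff]
    omega
  cell := hc

lemma two_mul_edgeDiff (a b : ℤ) :
    2 * edgeDiff e₁ e₂ a b = edgeSign e₂ a b - edgeSign e₁ a b := by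
  unfold edgeDiff edgeSign
  ring

lemma one_sub_edgeSign_mul (a b : ℤ) :
    1 - edgeSign e₁ a b * edgeSign e₂ a b = 2 * ind (edgeDiff e₁ e₂ a b ≠ 0) := by
  unfold edgeSign
  rw [ind_congr edgeDiff_ne_zero]
  by_cases h : e₁ a b <;> by_cases h' : e₂ a b <;> simp [ind, h, h']

lemma ind_ne_of_zero_or_one {a b : ℤ} (ha : a = 0 ∨ a = 1) (hb : b = 0 ∨ b = 1) :
    ind (a ≠ b) = (a - b) ^ 2 := by
  rcases ha with rfl | rfl <;> rcases hb with rfl | rfl <;> simp [ind]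

/-- `1` on the cells which lie inside both or neither of the two sets, and `-1` on the others. -/
noncomputable def relativeSign (e₁ e₂ : MidpointSet) (x y : ℤ) : ℤ :=
  regionSign e₁ x y * regionSign e₂ x y

/-- The first of the two functions in the Green identity: twice the region sign of both sets on the
cells at which these signs agree, and `0` on the others. -/
noncomputable def agreement (e₁ e₂ : MidpointSet) (x y : ℤ) : ℤ :=
  regionSign e₁ x y + regionSign e₂ x y

/-- The second of the two functions in the Green identity: twice the weight on the cells at which
the region signs of the two sets disagree, and `0` on the others. -/
noncomputable def disagreement (A : ℤ → ℤ) (e₁ e₂ : MidpointSet) (x y : ℤ) : ℤ :=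
  weight A x y * (1 - relativeSign e₁ e₂ x y)

lemma relativeSign_mul_self (e₁ e₂ : MidpointSet) (x y : ℤ) :
    relativeSign e₁ e₂ x y * relativeSign e₁ e₂ x y = 1 := by
  rw [relativeSign, mul_mul_mul_comm, regionSign_mul_self, regionSign_mul_self, one_mul]

lemma relativeSign_outside (h₁ : IsEvenSet m n e₁) (h₂ : IsEvenSet m n e₂) {x y : ℤ}
    (hxy : x ≤ 0 ∨ m ≤ x ∨ y ≤ 0 ∨ n ≤ y) : relativeSign e₁ e₂ x y = 1 := by
  rw [relativeSign, h₁.regionSign_outside hxy, h₂.regionSign_outside hxy, one_mul]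

lemma agreement_outside (h₁ : IsEvenSet m n e₁) (h₂ : IsEvenSet m n e₂) {x y : ℤ}
    (hxy : x ≤ 0 ∨ m ≤ x ∨ y ≤ 0 ∨ n ≤ y) : agreement e₁ e₂ x y = 2 := by
  rw [agreement, h₁.regionSign_outside hxy, h₂.regionSign_outside hxy, one_add_one_eq_two]

lemma disagreement_outside (h₁ : IsEvenSet m n e₁) (h₂ : IsEvenSet m n e₂) {x y : ℤ}
    (hxy : x ≤ 0 ∨ m ≤ x ∨ y ≤ 0 ∨ n ≤ y) : disagreement A e₁ e₂ x y = 0 := by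
  rw [disagreement, relativeSign_outside h₁ h₂ hxy, sub_self, mul_zero]

lemma IsProfile.one_sub_relativeSign_right (h₁ : IsEvenSet m n e₁) (h₂ : IsEvenSet m n e₂)
    (hA : IsProfile m n (edgeDiff e₁ e₂) A) {x y : ℤ} (hx : 0 ≤ x) (hx' : x < m) (hy : 0 ≤ y)
    (hy' : y ≤ n) :
    1 - relativeSign e₁ e₂ x y * relativeSign e₁ e₂ (x + 1) y =
      2 * (A (x + y) - A (x - y)) ^ 2 := by
  have h := hA.ne_iff (x + y) (x - y) (by omega) (by omega) (by omega) (by omega)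
  rw [show x + y + (x - y) + 1 = 2 * x + 1 by ring, show x + y - (x - y) = 2 * y by ring] at h
  rw [relativeSign, relativeSign, mul_mul_mul_comm, h₁.regionSign_mul_right x hy,
    h₂.regionSign_mul_right x hy, one_sub_edgeSign_mul, ind_congr h,
    ind_ne_of_zero_or_one (hA.values _) (hA.values _)]

lemma IsProfile.one_sub_relativeSign_up (hA : IsProfile m n (edgeDiff e₁ e₂) A) {x y : ℤ}
    (hx : 0 ≤ x) (hx' : x ≤ m) (hy : 0 ≤ y) (hy' : y < n) :
    1 - relativeSign e₁ e₂ x y * relativeSign e₁ e₂ x (y + 1) =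
      2 * (A (x + y) - A (x - y - 1)) ^ 2 := by
  have h := hA.ne_iff (x + y) (x - y - 1) (by omega) (by omega) (by omega) (by omega)
  rw [show x + y + (x - y - 1) + 1 = 2 * x by ring,
    show x + y - (x - y - 1) = 2 * y + 1 by ring] at h
  rw [relativeSign, relativeSign, mul_mul_mul_comm, regionSign_mul_up e₁ x hy,
    regionSign_mul_up e₂ x hy, one_sub_edgeSign_mul, ind_congr h,
    ind_ne_of_zero_or_one (hA.values _) (hA.values _)]

/-- Multiplied by the region sign of the cell, the sum of the neighbouring region signs becomes the
sum of the edge signs of the cell, which is the same for both sets. -/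
lemma neighborSum_regionSign (h₁ : IsEvenSet m n e₁) (h₂ : IsEvenSet m n e₂)
    (hc : CellSumsVanish m n (edgeDiff e₁ e₂)) {x y : ℤ} (hx : 0 < x) (hx' : x < m) (hy : 0 < y)
    (hy' : y < n) :
    neighborSum (regionSign e₂) x y =
      relativeSign e₁ e₂ x y * neighborSum (regionSign e₁) x y := by
  have hsides {e : MidpointSet} (he : IsEvenSet m n e) :
      regionSign e x y * neighborSum (regionSign e) x y =
        neighborSum (edgeSign e) (2 * x) (2 * y) := by
    have hleft := he.regionSign_mul_right (x - 1) hy.le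
    have hdown := regionSign_mul_up e x (y := y - 1) (by omega)
    rw [sub_add_cancel, show 2 * (x - 1) + 1 = 2 * x - 1 by ring] at hleft
    rw [sub_add_cancel, show 2 * (y - 1) + 1 = 2 * y - 1 by ring] at hdown
    rw [neighborSum, neighborSum, ← he.regionSign_mul_right x hy.le, ← hleft,
      ← regionSign_mul_up e x hy.le, ← hdown]
    ring
  have hsame : neighborSum (edgeSign e₂) (2 * x) (2 * y) =
      neighborSum (edgeSign e₁) (2 * x) (2 * y) := by
    have hcell := hc x y hx hx' hy hy'
    have hright := two_mul_edgeDiff (e₁ := e₁) (e₂ := e₂) (2 * x + 1) (2 * y)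
    have hleft := two_mul_edgeDiff (e₁ := e₁) (e₂ := e₂) (2 * x - 1) (2 * y)
    have hup := two_mul_edgeDiff (e₁ := e₁) (e₂ := e₂) (2 * x) (2 * y + 1)
    have hdown := two_mul_edgeDiff (e₁ := e₁) (e₂ := e₂) (2 * x) (2 * y - 1)
    unfold neighborSum at hcell ⊢
    linarith
  rw [← hsides h₁, ← hsides h₂] at hsame
  unfold relativeSign
  linear_combination regionSign e₂ x y * hsame -
    neighborSum (regionSign e₂) x y * regionSign_mul_self e₂ x y

/-- The equation of `neighborSum_regionSign`, satisfied by the weights in place of the region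
signs. -/
lemma IsProfile.neighborSum_weight (h₁ : IsEvenSet m n e₁) (h₂ : IsEvenSet m n e₂)
    (hA : IsProfile m n (edgeDiff e₁ e₂) A) {x y : ℤ} (hx : 0 < x) (hx' : x < m) (hy : 0 < y)
    (hy' : y < n) :
    neighborSum (weight A) x y = relativeSign e₁ e₂ x y *
      neighborSum (fun x y => weight A x y * relativeSign e₁ e₂ x y) x y := by
  have sign_right := hA.one_sub_relativeSign_right h₁ h₂ hx.le hx' hy.le hy'.le
  have sign_left := hA.one_sub_relativeSign_right h₁ h₂ (x := x - 1) (by omega) (by omega) hy.le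
    hy'.le
  have sign_up := hA.one_sub_relativeSign_up hx.le hx'.le hy.le hy'
  have sign_down := hA.one_sub_relativeSign_up (y := y - 1) hx.le hx'.le (by omega) (by omega)
  have weight_left := weight_right_symm hA.values (x - 1) y
  have weight_down := weight_up_symm hA.values x (y - 1)
  rw [sub_add_cancel] at sign_left sign_down weight_left weight_down
  rw [show x - (y - 1) - 1 = x - y by ring, show x + (y - 1) = x + y - 1 by ring]
    at sign_down weight_down
  rw [show x - 1 + y = x + y - 1 by ring, show x - 1 - y = x - y - 1 by ring]
    at sign_left weight_left
  unfold neighborSum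
  linear_combination weight A (x + 1) y * sign_right + weight A (x - 1) y * sign_left +
    weight A x (y + 1) * sign_up + weight A x (y - 1) * sign_down +
    2 * weight_right hA.values x y + 2 * weight_left + 2 * weight_up hA.values x y +
    2 * weight_down

lemma IsProfile.disagreement_mul_neighborSum (h₁ : IsEvenSet m n e₁) (h₂ : IsEvenSet m n e₂)
    (hc : CellSumsVanish m n (edgeDiff e₁ e₂)) (hA : IsProfile m n (edgeDiff e₁ e₂) A) {x y : ℤ}
    (hx : 0 < x) (hx' : x < m) (hy : 0 < y) (hy' : y < n) :
    disagreement A e₁ e₂ x y * neighborSum (agreement e₁ e₂) x y =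
      agreement e₁ e₂ x y * neighborSum (disagreement A e₁ e₂) x y := by
  set r := relativeSign e₁ e₂ x y with hr
  have sum_agreement : neighborSum (agreement e₁ e₂) x y =
      (1 + r) * neighborSum (regionSign e₁) x y := by
    rw [add_mul, one_mul, hr, ← neighborSum_regionSign h₁ h₂ hc hx hx' hy hy']
    simp only [neighborSum, agreement]
    ring
  have sum_disagreement : neighborSum (disagreement A e₁ e₂) x y =
      (r - 1) * neighborSum (fun x y => weight A x y * relativeSign e₁ e₂ x y) x y := by
    rw [sub_mul, one_mul, hr, ← hA.neighborSum_weight h₁ h₂ hx hx' hy hy']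
    simp only [neighborSum, disagreement]
    ring
  have hagree : agreement e₁ e₂ x y = regionSign e₁ x y * (1 + r) := by
    rw [hr, relativeSign, agreement]
    linear_combination -regionSign e₂ x y * regionSign_mul_self e₁ x y
  rw [sum_agreement, sum_disagreement, hagree, disagreement, ← hr]
  rcases mul_self_eq_one_iff.1 (relativeSign_mul_self e₁ e₂ x y) with h | h <;> rw [hr, h] <;> ring

lemma IsProfile.fluxRight_left_side (h₁ : IsEvenSet m n e₁) (h₂ : IsEvenSet m n e₂)
    (hA : IsProfile m n (edgeDiff e₁ e₂) A) (hm : 0 < m) {y : ℤ} (hy : 0 ≤ y) (hy' : y ≤ n) :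
    fluxRight (disagreement A e₁ e₂) (agreement e₁ e₂) 0 y =
      -4 * (weight A 0 y * (A y - A (-y))) := by
  have hsign := hA.one_sub_relativeSign_right h₁ h₂ le_rfl hm hy hy'
  have hweight := weight_right hA.values 0 y
  rw [relativeSign_outside h₁ h₂ (x := 0) (by omega)] at hsign
  simp only [zero_add, zero_sub, one_mul] at hsign hweight
  rw [fluxRight, disagreement_outside h₁ h₂ (x := 0) (by omega),
    agreement_outside h₁ h₂ (x := 0) (by omega), zero_add, disagreement]
  linear_combination (-2 * weight A 1 y) * hsign - 4 * hweight

lemma IsProfile.fluxRight_right_side (h₁ : IsEvenSet (m + 1) n e₁) (h₂ : IsEvenSet (m + 1) n e₂)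
    (hA : IsProfile (m + 1) n (edgeDiff e₁ e₂) A) (hm : 0 ≤ m) {y : ℤ} (hy : 0 ≤ y)
    (hy' : y ≤ n) :
    fluxRight (disagreement A e₁ e₂) (agreement e₁ e₂) m y =
      4 * (weight A (m + 1) y * (A (m + y) - A (m - y))) := by
  have hsign := hA.one_sub_relativeSign_right h₁ h₂ hm (by omega) hy hy'
  rw [relativeSign_outside h₁ h₂ (x := m + 1) (by omega), mul_one] at hsign
  rw [fluxRight, disagreement_outside h₁ h₂ (x := m + 1) (by omega),
    agreement_outside h₁ h₂ (x := m + 1) (by omega), disagreement]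
  linear_combination (2 * weight A m y) * hsign + 4 * weight_right_symm hA.values m y

lemma IsProfile.fluxUp_bottom_side (h₁ : IsEvenSet m n e₁) (h₂ : IsEvenSet m n e₂)
    (hA : IsProfile m n (edgeDiff e₁ e₂) A) (hn : 0 < n) {x : ℤ} (hx : 0 ≤ x) (hx' : x ≤ m) :
    fluxUp (disagreement A e₁ e₂) (agreement e₁ e₂) x 0 =
      4 * (weight A x 0 * (A x - A (x - 1))) := by
  have hsign := hA.one_sub_relativeSign_up hx hx' le_rfl hn
  have hweight := weight_up hA.values x 0
  rw [relativeSign_outside h₁ h₂ (y := 0) (by omega)] at hsign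
  simp only [zero_add, sub_zero, add_zero, one_mul] at hsign hweight
  rw [fluxUp, disagreement_outside h₁ h₂ (y := 0) (by omega),
    agreement_outside h₁ h₂ (y := 0) (by omega), zero_add, disagreement]
  linear_combination (-2 * weight A x 1) * hsign - 4 * hweight

lemma IsProfile.fluxUp_top_side (h₁ : IsEvenSet m (n + 1) e₁) (h₂ : IsEvenSet m (n + 1) e₂)
    (hA : IsProfile m (n + 1) (edgeDiff e₁ e₂) A) (hn : 0 ≤ n) {x : ℤ} (hx : 0 ≤ x)
    (hx' : x ≤ m) :
    fluxUp (disagreement A e₁ e₂) (agreement e₁ e₂) x n =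
      -4 * (weight A x (n + 1) * (A (x + n) - A (x - n - 1))) := by
  have hsign := hA.one_sub_relativeSign_up hx hx' hn (by omega)
  rw [relativeSign_outside h₁ h₂ (y := n + 1) (by omega), mul_one] at hsign
  rw [fluxUp, disagreement_outside h₁ h₂ (y := n + 1) (by omega),
    agreement_outside h₁ h₂ (y := n + 1) (by omega), disagreement]
  linear_combination (2 * weight A x n) * hsign + 4 * weight_up_symm hA.values x n

lemma IsProfile.sum_weight_sides_eq {m n : ℕ} (h₁ : IsEvenSet (m + 1) (n + 1) e₁)
    (h₂ : IsEvenSet (m + 1) (n + 1) e₂) (hc : CellSumsVanish (m + 1) (n + 1) (edgeDiff e₁ e₂))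
    (hA : IsProfile (m + 1) (n + 1) (edgeDiff e₁ e₂) A) :
    ∑ y ∈ Finset.range n, weight A (m + 1) (y + 1) * (A (m + (y + 1)) - A (m - (y + 1))) +
        ∑ y ∈ Finset.range n, weight A 0 (y + 1) * (A (y + 1) - A (-(y + 1))) =
      ∑ x ∈ Finset.range m, weight A (x + 1) (n + 1) * (A (x + 1 + n) - A (x + 1 - n - 1)) +
        ∑ x ∈ Finset.range m, weight A (x + 1) 0 * (A (x + 1) - A x) := by
  have hflux := boundary_flux_eq_zero (m := m) (n := n) fun x y hx hx' hy hy' =>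
    hA.disagreement_mul_neighborSum h₁ h₂ hc hx hx' hy hy'
  have hvertical (y : ℕ) (hy : y ∈ Finset.range n) :
      fluxRight (disagreement A e₁ e₂) (agreement e₁ e₂) m (y + 1) -
          fluxRight (disagreement A e₁ e₂) (agreement e₁ e₂) 0 (y + 1) =
        4 * (weight A (m + 1) (y + 1) * (A (m + (y + 1)) - A (m - (y + 1))) +
          weight A 0 (y + 1) * (A (y + 1) - A (-(y + 1)))) := by
    rw [Finset.mem_range] at hy
    rw [hA.fluxRight_right_side h₁ h₂ (by omega) (by omega) (by omega),
      hA.fluxRight_left_side h₁ h₂ (by omega) (by omega) (by omega)]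
    ring
  have hhorizontal (x : ℕ) (hx : x ∈ Finset.range m) :
      fluxUp (disagreement A e₁ e₂) (agreement e₁ e₂) (x + 1) n -
          fluxUp (disagreement A e₁ e₂) (agreement e₁ e₂) (x + 1) 0 =
        -4 * (weight A (x + 1) (n + 1) * (A (x + 1 + n) - A (x + 1 - n - 1)) +
          weight A (x + 1) 0 * (A (x + 1) - A x)) := by
    rw [Finset.mem_range] at hx
    rw [hA.fluxUp_top_side h₁ h₂ (by omega) (by omega) (by omega),
      hA.fluxUp_bottom_side h₁ h₂ (by omega) (by omega) (by omega), add_sub_cancel_right]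
    ring
  rw [Finset.sum_congr rfl hvertical, Finset.sum_congr rfl hhorizontal, ← Finset.mul_sum,
    ← Finset.mul_sum, Finset.sum_add_distrib, Finset.sum_add_distrib] at hflux
  linarith

end Difference

/-! ### The upper bound -/

section UpperBound
variable {e₁ e₂ : MidpointSet} {A : ℤ → ℤ}

/-- In the odd case all terms of the boundary sums have a definite sign, and one of the constants
left over is nonzero. -/
lemma IsProfile.false_of_odd {m n : ℕ} (h₁ : IsEvenSet (m + 1) (n + 1) e₁)
    (h₂ : IsEvenSet (m + 1) (n + 1) e₂) (hc : CellSumsVanish (m + 1) (n + 1) (edgeDiff e₁ e₂))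
    (hA : IsProfile (m + 1) (n + 1) (edgeDiff e₁ e₂) A) (hm : (m : ℤ) % 2 = 1)
    (hn : (n : ℤ) % 2 = 1) (hPm : primitive A (m + 1) % 2 = 1)
    (hPn : primitive A (n + 1) % 2 = 1) (hPmn : primitive A (m + n + 2) % 2 = 0) : False := by
  have hsides := hA.sum_weight_sides_eq h₁ h₂ hc
  rw [sum_weight_left_side hA.values hA.neg, sum_weight_bottom_side hA.values,
    sum_weight_right_side hA.values hA.refl₁, sum_weight_top_side hA.values hA.neg hA.refl₂,
    paritySign_of_odd hPm, paritySign_of_even (u := (m : ℤ) + 1) (by omega),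
    paritySign_of_even (u := (n : ℤ) + 1) (by omega), paritySign_add (primitive A m),
    paritySign_of_odd hm, paritySign_of_odd (u := primitive A (n + 1) + (n + 1)) (by omega),
    show (n : ℤ) + 1 + m = m + 1 + n by ring, paritySign_add _ (m + 1 + n : ℤ),
    paritySign_of_odd (u := (m : ℤ) + 1 + n) (by omega)] at hsides
  have hstep_m := primitive_add_one A m
  have hstep_n := primitive_add_one A n
  have hstep := primitive_add_one A (m + 1 + n)
  rw [show (m : ℤ) + 1 + n + 1 = m + n + 2 by ring] at hstep
  have hleft : paritySign (primitive A n) * (1 - A n) ≤ 0 := by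
    rcases hA.values n with h | h
    · rw [h, paritySign_of_odd (by omega)]; norm_num
    · rw [h]; norm_num
  have hbottom : 0 ≤ paritySign (primitive A m) * A m := by
    rcases hA.values m with h | h
    · rw [h]; norm_num
    · rw [h, paritySign_of_even (by omega)]; norm_num
  have hright : 0 ≤ paritySign (primitive A (m + 1 + n)) * (1 - A (m + 1 + n)) := by
    rcases hA.values (m + 1 + n) with h | h
    · rw [h, paritySign_of_even (by omega)]; norm_num
    · rw [h]; norm_num
  have htop : paritySign (primitive A (m + 1 + n)) * A (m + 1 + n) ≤ 0 := by
    rcases hA.values (m + 1 + n) with h | h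
    · rw [h]; norm_num
    · rw [h, paritySign_of_odd (by omega)]; norm_num
  have : A (m + 1) ≤ 1 := by rcases hA.values (m + 1) with h | h <;> omega
  have : 0 ≤ A (n + 1) := by rcases hA.values (n + 1) with h | h <;> omega
  linarith

lemma edgeDiff_eq_two_mul_sub_one {a b : ℤ} (h : edgeDiff e₁ e₂ a b ≠ 0) :
    edgeDiff e₁ e₂ a b = 2 * ind (e₁ a b) - 1 := by
  rw [edgeDiff_ne_zero] at h
  unfold edgeDiff
  rcases ind_eq_one_or_zero (e₁ a b) with ⟨h1, h1'⟩ | ⟨h1, h1'⟩ <;>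
    rcases ind_eq_one_or_zero (e₂ a b) with ⟨h2, h2'⟩ | ⟨h2, h2'⟩ <;> rw [h1', h2'] <;> tauto

/-- In a grid with only two rows or columns, all four sides of the corner cell would belong to the
difference, and three of them would have the same sign. -/
lemma IsProfile.apply_zero_eq_apply_one_of_narrow {m n : ℤ} (hm : 2 ≤ m) (hn : 2 ≤ n)
    (hmn : m = 2 ∨ n = 2) (h₁ : IsEvenSet m n e₁) (hc : CellSumsVanish m n (edgeDiff e₁ e₂))
    (hA : IsProfile m n (edgeDiff e₁ e₂) A) : A 0 = A 1 := by
  by_contra h01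
  have hneg : A (-1) = A 0 := by simpa using hA.neg 0
  have htwo : A 2 = A 1 := by
    rcases hmn with rfl | rfl
    · simpa using hA.refl₁ 1
    · simpa using hA.refl₂ 1
  have hbottom := (hA.ne_iff 1 0 (by omega) (by omega) (by omega) (by omega)).2 (by tauto)
  have hleft := (hA.ne_iff 1 (-1) (by omega) (by omega) (by omega) (by omega)).2
    (by rw [hneg]; tauto)
  have hright := (hA.ne_iff 2 0 (by omega) (by omega) (by omega) (by omega)).2
    (by rw [htwo]; tauto)
  have htop := (hA.ne_iff 2 (-1) (by omega) (by omega) (by omega) (by omega)).2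
    (by rw [hneg, htwo]; tauto)
  have hcell := hc 1 1 (by omega) (by omega) (by omega) (by omega)
  have hcorner := h₁.even 0 0
  have hout {a b : ℤ} (hab : a ≤ 0 ∨ 2 * m ≤ a ∨ b ≤ 0 ∨ 2 * n ≤ b) : ind (e₁ a b) = 0 :=
    ind_false fun he => by have := h₁.supp a b he; omega
  norm_num [edgeCount, neighborSum] at hbottom hleft hright htop hcell hcorner
  rw [hout (a := 0) (by omega), hout (b := 0) (by omega)] at hcorner
  rw [edgeDiff_eq_two_mul_sub_one hbottom, edgeDiff_eq_two_mul_sub_one hleft,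
    edgeDiff_eq_two_mul_sub_one hright, edgeDiff_eq_two_mul_sub_one htop] at hcell
  have sign_bottom := ind_eq_one_or_zero (e₁ 2 1)
  have sign_left := ind_eq_one_or_zero (e₁ 1 2)
  have sign_right := ind_eq_one_or_zero (e₁ 3 2)
  have sign_top := ind_eq_one_or_zero (e₁ 2 3)
  rcases hmn with rfl | rfl
  · have hcorner' := h₁.even 1 0
    norm_num [edgeCount, neighborSum] at hcorner'
    rw [hout (a := 4) (by omega), hout (b := 0) (by omega)] at hcorner'
    omega
  · have hcorner' := h₁.even 0 1
    norm_num [edgeCount, neighborSum] at hcorner'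
    rw [hout (a := 0) (by omega), hout (b := 4) (by omega)] at hcorner'
    omega

lemma IsProfile.refl_gcd {m n : ℕ} {f : ℤ → ℤ → ℤ} (hA : IsProfile m n f A) (i : ℤ) :
    A (2 * (m.gcd n : ℕ) - 1 - i) = A i := by
  have hm := periodic_of_reflect hA.neg hA.refl₁
  have hn := periodic_of_reflect hA.neg hA.refl₂
  rw [← hA.neg i, ← (hm.int_mul (m.gcdA n)).add_period (hn.int_mul (m.gcdB n)) (-1 - i),
    Nat.gcd_eq_gcd_ab]
  congr 1
  push_cast
  ring

/-- A balanced profile is excluded by `IsProfile.false_of_odd`: its antiderivative at `m`, `n` and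
`m + n` is an odd, odd and even multiple of the odd number `d / 2`. -/
lemma IsProfile.two_mul_sum_ne_of_odd {m n d m' n' : ℕ} (hm : 0 < m) (hn : 0 < n)
    (hm' : m = d * m') (hn' : n = d * n') (hd : d % 4 = 2) (hodd : Odd (m' * n'))
    (h₁ : IsEvenSet m n e₁) (h₂ : IsEvenSet m n e₂) (hc : CellSumsVanish m n (edgeDiff e₁ e₂))
    (hA : IsProfile m n (edgeDiff e₁ e₂) A) (hrefl : ∀ i, A (2 * d - 1 - i) = A i) :
    2 * ∑ i ∈ Finset.range d, A i ≠ d := by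
  intro hbalanced
  rw [← primitive_natCast] at hbalanced
  obtain ⟨hm_odd, hn_odd⟩ := Nat.odd_mul.1 hodd
  have primitive_mod (j : ℕ) : primitive A (d * j) % 2 = j % 2 := by
    rw [mul_comm, primitive_mul hA.neg hrefl, Int.mul_emod, show primitive A d % 2 = 1 by omega]
    simp
  have hPm := primitive_mod m'
  have hPn := primitive_mod n'
  have hPmn := primitive_mod (m' + n')
  have hm_even : 2 ∣ m := hm' ▸ Dvd.dvd.mul_right (by omega) _
  have hn_even : 2 ∣ n := hn' ▸ Dvd.dvd.mul_right (by omega) _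
  rw [← Nat.cast_mul, ← hm'] at hPm
  rw [← Nat.cast_mul, ← hn'] at hPn
  rw [← Nat.cast_mul, mul_add, ← hm', ← hn'] at hPmn
  obtain ⟨a, rfl⟩ := hm_odd
  obtain ⟨b, rfl⟩ := hn_odd
  obtain ⟨m, rfl⟩ := Nat.exists_eq_add_of_lt hm
  obtain ⟨n, rfl⟩ := Nat.exists_eq_add_of_lt hn
  push_cast [zero_add] at h₁ h₂ hc hA hPm hPn hPmn
  refine hA.false_of_odd h₁ h₂ hc (by omega) (by omega) (by omega) (by omega) ?_
  rw [show (m : ℤ) + n + 2 = m + 1 + (n + 1) by ring]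
  omega

lemma IsProfile.two_mul_sum_ne {m n d m' n' : ℕ} (hm : 2 ≤ m) (hn : 2 ≤ n) (hd : d = m.gcd n)
    (hm' : m = d * m') (hn' : n = d * n') (h₁ : IsEvenSet m n e₁) (h₂ : IsEvenSet m n e₂)
    (hc : CellSumsVanish m n (edgeDiff e₁ e₂)) (hA : IsProfile m n (edgeDiff e₁ e₂) A)
    (hdelta : delta m n ≠ 0) : 2 * ∑ i ∈ Finset.range d, A i ≠ d := by
  rcases Nat.even_or_odd d with heven | hodd
  swap
  · obtain ⟨r, hr⟩ := hodd
    omega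
  have hrefl := hA.refl_gcd
  rw [← hd] at hrefl
  have hd2 : 2 ∣ d := heven.two_dvd
  have hdm : d ∣ m := ⟨m', hm'⟩
  have hdn : d ∣ n := ⟨n', hn'⟩
  have hd0 : 0 < d := Nat.pos_of_dvd_of_pos hdm (by omega)
  by_cases hnarrow : m = 2 ∨ n = 2
  · obtain rfl : d = 2 := by
      have : d ∣ 2 := by rcases hnarrow with rfl | rfl <;> assumption
      have := Nat.le_of_dvd two_pos this
      omega
    have h01 := hA.apply_zero_eq_apply_one_of_narrow (by omega) (by omega) (by omega) h₁ hc
    have := hA.values 0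
    rw [Finset.sum_range_succ, Finset.sum_range_one]
    push_cast
    omega
  · have hdiv : m * n / d ^ 2 = m' * n' := by
      rw [show m * n = m' * n' * d ^ 2 by rw [hm', hn']; ring,
        Nat.mul_div_cancel _ (by positivity)]
    unfold delta at hdelta
    rw [← hd, hdiv] at hdelta
    refine hA.two_mul_sum_ne_of_odd (by omega) (by omega) hm' hn' ?_ ?_ h₁ h₂ hc hrefl
    · by_contra h4
      exact hdelta (by rw [if_neg (Nat.not_odd_iff_even.2 heven), if_pos (by omega)])
    · by_contra hev
      rw [Nat.not_odd_iff_even] at hev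
      apply hdelta
      split_ifs <;> first | rfl | (exfalso; grind)

lemma delta_le_sq {m n d : ℕ} {k : ℤ} (hd : d = m.gcd n) (h : delta m n ≠ 0 → 2 * k ≠ d) :
    (delta m n : ℤ) ≤ (d - 2 * k) ^ 2 := by
  by_cases h0 : delta m n = 0
  · rw [h0]
    positivity
  have hne : (d : ℤ) - 2 * k ≠ 0 := sub_ne_zero.2 (h h0).symm
  unfold delta at h0 ⊢
  rw [← hd] at h0 ⊢
  split_ifs at h0 ⊢ with hodd
  · exact Int.add_one_le_of_lt (sq_pos_of_ne_zero hne)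
  · exact absurd rfl h0
  · exact absurd rfl h0
  · have heven : (d : ℤ) % 2 = 0 := by rw [Nat.not_odd_iff] at hodd; omega
    have habs : 2 ≤ |(d : ℤ) - 2 * k| := by rcases abs_cases ((d : ℤ) - 2 * k) <;> omega
    rw [← sq_abs]
    exact pow_le_pow_left₀ (by norm_num) habs 2

lemma supportCard_edgeDiff_le {m n d m' n' : ℕ} (hm : 2 ≤ m) (hn : 2 ≤ n) (hd : d = m.gcd n)
    (hm' : m = d * m') (hn' : n = d * n') (h₁ : IsEvenSet m n e₁) (h₂ : IsEvenSet m n e₂)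
    (hc : CellSumsVanish m n (edgeDiff e₁ e₂)) :
    (supportCard m n (edgeDiff e₁ e₂) : ℤ) ≤ m * n - delta m n * m' * n' := by
  have hf := h₁.isSignatureDiff h₂ hc
  have hA := hf.isProfile_profile (by omega) (by omega)
  have hrefl := hA.refl_gcd
  rw [← hd] at hrefl
  rw [hA.supportCard_eq hf hrefl hm' hn']
  set k := ∑ i ∈ Finset.range d, profile m n (edgeDiff e₁ e₂) i
  have hdelta : (delta m n : ℤ) ≤ (d - 2 * k) ^ 2 :=
    delta_le_sq hd (hA.two_mul_sum_ne hm hn hd hm' hn' h₁ h₂ hc)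
  calc 4 * k * (d - k) * m' * n' = m * n - (d - 2 * k) ^ 2 * (m' * n' : ℕ) := by
        rw [hm', hn']; push_cast; ring
    _ ≤ m * n - delta m n * (m' * n' : ℕ) := by gcongr
    _ = m * n - delta m n * m' * n' := by push_cast; ring

lemma IsCycle.isEvenSet {m n : ℕ} {C : Finset (Sym2 (Fin m × Fin n))} (hC : IsCycle C) :
    IsEvenSet m n (midpoints C) where
  supp := hC.isEdgeFinset.withinGrid
  even x y := by rcases hC.edgeCount_eq_zero_or_two x y with h | h <;> rw [h] <;> rfl

lemma IsCycle.card_symmDiff_le {m n d m' n' : ℕ} (hm : 2 ≤ m) (hn : 2 ≤ n) (hd : d = m.gcd n)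
    (hm' : m = d * m') (hn' : n = d * n') {C₁ C₂ : Finset (Sym2 (Fin m × Fin n))}
    (h₁ : IsCycle C₁) (h₂ : IsCycle C₂) (hs : signature C₁ = signature C₂) :
    ((symmDiff C₁ C₂).card : ℤ) ≤ m * n - delta m n * m' * n' := by
  rw [card_symmDiff_eq_supportCard h₁.isEdgeFinset h₂.isEdgeFinset]
  exact supportCard_edgeDiff_le hm hn hd hm' hn' h₁.isEvenSet h₂.isEvenSet
    ((signature_eq_iff_cellSumsVanish h₁.isEdgeFinset h₂.isEdgeFinset).1 hs)

end UpperBound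

/-! ### Gluing pairs of loops -/

lemma reachable_of_adj_reachable {V W : Type*} {G : SimpleGraph V} {H : SimpleGraph W} {φ : V → W}
    (h : ∀ u v, G.Adj u v → H.Reachable (φ u) (φ v)) {u v : V} (huv : G.Reachable u v) :
    H.Reachable (φ u) (φ v) := by
  simp only [SimpleGraph.reachable_iff_reflTransGen] at *
  exact Relation.ReflTransGen.lift' φ h _ _ huv

section IsLoop

variable {m n : ℤ} {e : MidpointSet}

lemma IsLoop.of_equiv {m' n' : ℤ} {e' : MidpointSet} (h : IsLoop m n e) (φ : ℤ × ℤ ≃ ℤ × ℤ)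
    (hφ : ∀ u v, (edgeGraph e').Adj (φ u) (φ v) ↔ (edgeGraph e).Adj u v) (hs : WithinGrid m' n' e')
    (hd : ∀ x y, ∃ x' y', edgeCount e' (2 * x + 1) (2 * y + 1) =
      edgeCount e (2 * x' + 1) (2 * y' + 1)) :
    IsLoop m' n' e' where
  supp := hs
  degree x y := by
    obtain ⟨x', y', hxy⟩ := hd x y
    rw [hxy]
    exact h.degree x' y'
  connected u v hu hv := by
    obtain ⟨u, rfl⟩ := φ.surjective u
    obtain ⟨v, rfl⟩ := φ.surjective v
    have hadj : ∀ u, (∃ w, (edgeGraph e').Adj (φ u) w) → ∃ w, (edgeGraph e).Adj u w := by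
      rintro u ⟨w, hw⟩
      obtain ⟨w, rfl⟩ := φ.surjective w
      exact ⟨w, (hφ _ _).1 hw⟩
    exact reachable_of_adj_reachable (fun a b hab => ((hφ a b).2 hab).reachable)
      (h.connected u v (hadj u hu) (hadj v hv))
  nonempty := by
    obtain ⟨u, w, huw⟩ := h.nonempty
    exact ⟨_, _, (hφ _ _).2 huw⟩

lemma IsLoop.mirror (h : IsLoop m n e) : IsLoop m n (fun a b => e (2 * m - a) b) := by
  refine h.of_equiv (Equiv.prodCongr (Equiv.subLeft (m - 1)) (Equiv.refl ℤ)) ?_ ?_ ?_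
  · rintro ⟨a, b⟩ ⟨c, d⟩
    simp only [edgeGraph_adj, Equiv.prodCongr_apply, Prod.map_apply, Equiv.subLeft_apply,
      Equiv.refl_apply, IsUnitStep]
    rw [show 2 * m - (m - 1 - a + (m - 1 - c) + 1) = a + c + 1 by ring]
    refine and_congr_left fun _ => ?_
    omega
  · intro a b hab
    have := h.supp _ _ hab
    omega
  · intro x y
    refine ⟨m - 1 - x, y, ?_⟩
    simp only [edgeCount, neighborSum]
    rw [show 2 * m - (2 * x + 1 + 1) = 2 * (m - 1 - x) + 1 - 1 by ring,
      show 2 * m - (2 * x + 1 - 1) = 2 * (m - 1 - x) + 1 + 1 by ring,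
      show 2 * m - (2 * x + 1) = 2 * (m - 1 - x) + 1 by ring]
    ring

lemma IsLoop.transpose (h : IsLoop m n e) : IsLoop n m (fun a b => e b a) := by
  refine h.of_equiv (Equiv.prodComm ℤ ℤ) ?_ ?_ ?_
  · rintro ⟨a, b⟩ ⟨c, d⟩
    simp only [edgeGraph_adj, Equiv.prodComm_apply, Prod.swap_prod_mk, IsUnitStep]
    refine and_congr_left fun _ => ?_
    omega
  · intro a b hab
    have := h.supp _ _ hab
    omega
  · intro x y
    refine ⟨y, x, ?_⟩
    simp only [edgeCount, neighborSum]
    ring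

/-- Deleting an edge from a loop does not disconnect it, so the missing edge is not missed. -/
lemma IsLoop.reachable_map_of_forall_ne {W : Type*} {G : SimpleGraph W} (h : IsLoop m n e)
    (φ : ℤ × ℤ → W) {u v : ℤ × ℤ} (huv : (edgeGraph e).Adj u v)
    (hG : ∀ a b, (edgeGraph e).Adj a b → s(a, b) ≠ s(u, v) → G.Adj (φ a) (φ b))
    {a b : ℤ × ℤ} (hab : (edgeGraph e).Reachable a b) : G.Reachable (φ a) (φ b) := by
  have hbounds := h.supp _ _ huv.2
  lift m to ℕ using by omega
  lift n to ℕ using by omega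
  have huv' : G.Reachable (φ u) (φ v) := by
    refine reachable_of_adj_reachable (fun a b hab => ?_) (h.reachable_deleteEdges huv)
    rw [SimpleGraph.deleteEdges_adj] at hab
    exact (hG a b hab.1 hab.2).reachable
  refine reachable_of_adj_reachable (fun a b hab => ?_) hab
  by_cases heq : s(a, b) = s(u, v)
  · rcases Sym2.eq_iff.1 heq with ⟨rfl, rfl⟩ | ⟨rfl, rfl⟩
    exacts [huv', huv'.symm]
  · exact (hG a b hab heq).reachable

lemma IsLoop.isEvenSet (h : IsLoop m n e) : IsEvenSet m n e where
  supp := h.supp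
  even x y := by rcases h.degree x y with h | h <;> rw [h] <;> rfl

lemma WithinGrid.edgeCount_eq_zero (h : WithinGrid m n e) {x y : ℤ}
    (hxy : x < 0 ∨ m ≤ x ∨ y < 0 ∨ n ≤ y) : edgeCount e (2 * x + 1) (2 * y + 1) = 0 := by
  have hzero : ∀ a b : ℤ, a ≤ 0 ∨ 2 * m ≤ a ∨ b ≤ 0 ∨ 2 * n ≤ b → ind (e a b) = 0 :=
    fun a b hab => ind_false fun he => by have := h a b he; omega
  simp only [edgeCount, neighborSum]
  rw [hzero _ _ (by omega), hzero _ _ (by omega), hzero _ _ (by omega), hzero _ _ (by omega)]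
  rfl

end IsLoop

/-- The union of two sets of edges in adjacent boxes, modified along the cell with centre
`(2 * m, c)`, which lies between the boxes: two opposite sides of the cell are replaced by the other
two. -/
def joinAcross (m c : ℤ) (e e' : MidpointSet) (a b : ℤ) : Prop :=
  (e a b ∧ ¬(a = 2 * m - 1 ∧ b = c)) ∨ (e' (a - 2 * m) b ∧ ¬(a = 2 * m + 1 ∧ b = c)) ∨
    (a = 2 * m ∧ (b = c - 1 ∨ b = c + 1))

section Join

variable {m n m' c : ℤ} {e e' : MidpointSet}

lemma joinAcross_iff_of_lt (h' : WithinGrid m' n e') {a : ℤ} (b : ℤ) (ha : a < 2 * m) :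
    joinAcross m c e e' a b ↔ e a b ∧ ¬(a = 2 * m - 1 ∧ b = c) := by
  have := h' (a - 2 * m) b
  simp only [joinAcross]
  grind

lemma joinAcross_iff_of_eq (h : WithinGrid m n e) (h' : WithinGrid m' n e') {a : ℤ} (b : ℤ)
    (ha : a = 2 * m) : joinAcross m c e e' a b ↔ b = c - 1 ∨ b = c + 1 := by
  have := h a b
  have := h' (a - 2 * m) b
  simp only [joinAcross]
  grind

lemma joinAcross_iff_of_gt (h : WithinGrid m n e) {a : ℤ} (b : ℤ) (ha : 2 * m < a) :
    joinAcross m c e e' a b ↔ e' (a - 2 * m) b ∧ ¬(a = 2 * m + 1 ∧ b = c) := by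
  have := h a b
  simp only [joinAcross]
  grind

lemma ind_and_not {p q : Prop} [Decidable q] (hqp : q → p) :
    ind (p ∧ ¬q) = ind p - if q then 1 else 0 := by
  by_cases hq : q
  · simp [ind, hq, hqp hq]
  · simp [hq]

lemma ind_joinAcross (h : WithinGrid m n e) (h' : WithinGrid m' n e') (hc : e (2 * m - 1) c)
    (hc' : e' 1 c) (a b : ℤ) :
    ind (joinAcross m c e e' a b) = ind (e a b) + ind (e' (a - 2 * m) b) +
      ((if a = 2 * m ∧ (b = c - 1 ∨ b = c + 1) then 1 else 0) -
        (if (a = 2 * m - 1 ∨ a = 2 * m + 1) ∧ b = c then 1 else 0)) := by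
  have hle : 2 * m ≤ a → ind (e a b) = 0 := fun ha =>
    ind_false fun hab => by have := h _ _ hab; omega
  have hge : a ≤ 2 * m → ind (e' (a - 2 * m) b) = 0 := fun ha =>
    ind_false fun hab => by have := h' _ _ hab; omega
  rcases lt_trichotomy a (2 * m) with ha | ha | ha
  · rw [ind_congr (joinAcross_iff_of_lt h' b ha), hge ha.le,
      ind_and_not (by rintro ⟨rfl, rfl⟩; exact hc)]
    split_ifs <;> omega
  · rw [ind_congr (joinAcross_iff_of_eq h h' b ha), hle ha.ge, hge ha.le]
    unfold ind
    split_ifs <;> omega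
  · rw [ind_congr (joinAcross_iff_of_gt h b ha), hle ha.le,
      ind_and_not (by rintro ⟨rfl, rfl⟩; rwa [add_sub_cancel_left])]
    split_ifs <;> omega

lemma edgeCount_joinAcross (h : WithinGrid m n e) (h' : WithinGrid m' n e') (hc : e (2 * m - 1) c)
    (hc' : e' 1 c) (x z : ℤ) : edgeCount (joinAcross m c e e') (2 * x + 1) (2 * z + 1) =
      edgeCount e (2 * x + 1) (2 * z + 1) + edgeCount e' (2 * (x - m) + 1) (2 * z + 1) := by
  have hodd := h _ _ hc
  simp only [edgeCount, neighborSum, ind_joinAcross h h' hc hc']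
  rw [show 2 * x + 1 + 1 - 2 * m = 2 * (x - m) + 1 + 1 by ring,
    show 2 * x + 1 - 1 - 2 * m = 2 * (x - m) + 1 - 1 by ring,
    show 2 * x + 1 - 2 * m = 2 * (x - m) + 1 by ring,
    if_neg (c := (2 * x + 1 + 1 = 2 * m - 1 ∨ _) ∧ _) (by omega),
    if_neg (c := (2 * x + 1 - 1 = 2 * m - 1 ∨ _) ∧ _) (by omega),
    if_neg (c := 2 * x + 1 = 2 * m ∧ (2 * z + 1 + 1 = _ ∨ _)) (by omega),
    if_neg (c := 2 * x + 1 = 2 * m ∧ (2 * z + 1 - 1 = _ ∨ _)) (by omega)]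
  split_ifs <;> omega

lemma WithinGrid.join (h : WithinGrid m n e) (h' : WithinGrid m' n e') (hc : e (2 * m - 1) c)
    (hc' : e' 1 c) : WithinGrid (m + m') n (joinAcross m c e e') := by
  have hbounds := h _ _ hc
  have hbounds' := h' _ _ hc'
  rintro a b (hab | hab | hab)
  · have := h _ _ hab.1
    omega
  · have := h' _ _ hab.1
    omega
  · omega

section Connected

variable {y : ℤ}

lemma IsLoop.reachable_joinAcross_left (h : IsLoop m n e) (hc : e (2 * m - 1) (2 * y + 2))
    (e' : MidpointSet) {u v : ℤ × ℤ} (huv : (edgeGraph e).Reachable u v) :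
    (edgeGraph (joinAcross m (2 * y + 2) e e')).Reachable u v := by
  have hadj : (edgeGraph e).Adj (m - 1, y) (m - 1, y + 1) :=
    edgeGraph_adj_up.2 (by rwa [show 2 * (m - 1) + 1 = 2 * m - 1 by ring])
  refine h.reachable_map_of_forall_ne (G := edgeGraph _) id hadj
    (fun a b hab hne => ⟨hab.1, .inl ⟨hab.2, ?_⟩⟩) huv
  rintro ⟨h₁, h₂⟩
  exact hne (Sym2.eq_iff.2 (hab.1.eq_of_add_eq hadj.1 (by grind) (by grind)))

lemma IsLoop.reachable_joinAcross_right (h' : IsLoop m' n e') (hc' : e' 1 (2 * y + 2)) (m : ℤ)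
    (e : MidpointSet) {u v : ℤ × ℤ} (huv : (edgeGraph e').Reachable u v) :
    (edgeGraph (joinAcross m (2 * y + 2) e e')).Reachable (u.1 + m, u.2) (v.1 + m, v.2) := by
  have hadj : (edgeGraph e').Adj (0, y) (0, y + 1) := edgeGraph_adj_up.2 hc'
  refine h'.reachable_map_of_forall_ne (G := edgeGraph _) (fun u => (u.1 + m, u.2)) hadj
    (fun a b hab hne => ⟨?_, .inr (.inl ⟨?_, ?_⟩)⟩) huv
  · have := hab.1
    simp only [IsUnitStep] at *
    omega
  · rw [show a.1 + m + (b.1 + m) + 1 - 2 * m = a.1 + b.1 + 1 by ring]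
    exact hab.2
  · rintro ⟨h₁, h₂⟩
    exact hne (Sym2.eq_iff.2 (hab.1.eq_of_add_eq hadj.1 (by grind) (by grind)))

lemma edgeGraph_joinAcross_adj (e e' : MidpointSet) {z : ℤ} (hz : z = y ∨ z = y + 1) :
    (edgeGraph (joinAcross m (2 * y + 2) e e')).Adj (m - 1, z) (m, z) := by
  have hadj := edgeGraph_adj_right (e := joinAcross m (2 * y + 2) e e') (x := m - 1) (y := z)
  rw [sub_add_cancel] at hadj
  exact hadj.2 (.inr (.inr (by omega)))

lemma IsLoop.reachable_joinAcross_of_adj (h : IsLoop m n e) (h' : IsLoop m' n e')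
    (hc : e (2 * m - 1) (2 * y + 2)) (hc' : e' 1 (2 * y + 2)) {u w : ℤ × ℤ}
    (huw : (edgeGraph (joinAcross m (2 * y + 2) e e')).Adj u w) :
    (edgeGraph (joinAcross m (2 * y + 2) e e')).Reachable u (m - 1, y) := by
  have hadj : (edgeGraph e).Adj (m - 1, y) (m - 1, y + 1) :=
    edgeGraph_adj_up.2 (by rwa [show 2 * (m - 1) + 1 = 2 * m - 1 by ring])
  have hadj' : (edgeGraph e').Adj (0, y) (0, y + 1) := edgeGraph_adj_up.2 hc'
  obtain ⟨hstep, ⟨he, -⟩ | ⟨he', -⟩ | hnew⟩ := huw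
  · exact h.reachable_joinAcross_left hc e' (h.connected _ _ ⟨w, hstep, he⟩ ⟨_, hadj⟩)
  · have hstep' : (edgeGraph e').Adj (u.1 - m, u.2) (w.1 - m, w.2) := by
      refine ⟨by simp only [IsUnitStep] at *; omega, ?_⟩
      rwa [show u.1 - m + (w.1 - m) + 1 = u.1 + w.1 + 1 - 2 * m by ring]
    have hreach := h'.reachable_joinAcross_right hc' m e (h'.connected _ _ ⟨_, hstep'⟩ ⟨_, hadj'⟩)
    simp only [sub_add_cancel, zero_add] at hreach
    exact hreach.trans (edgeGraph_joinAcross_adj e e' (.inl rfl)).symm.reachable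
  · obtain ⟨a, b⟩ := u
    simp only [IsUnitStep] at hstep hnew
    have hb : b = y ∨ b = y + 1 := by omega
    have hleft : (edgeGraph (joinAcross m (2 * y + 2) e e')).Reachable (m - 1, b) (m - 1, y) := by
      rcases hb with rfl | rfl
      exacts [.refl _, (h.reachable_joinAcross_left hc e' hadj.reachable).symm]
    obtain rfl | rfl : a = m - 1 ∨ a = m := by omega
    · exact hleft
    · exact (edgeGraph_joinAcross_adj e e' hb).symm.reachable.trans hleft

end Connected

lemma IsLoop.join (h : IsLoop m n e) (h' : IsLoop m' n e') (hc : e (2 * m - 1) c) (hc' : e' 1 c) :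
    IsLoop (m + m') n (joinAcross m c e e') := by
  have hparity := h.supp _ _ hc
  obtain ⟨y, rfl⟩ : ∃ y, c = 2 * y + 2 := ⟨c / 2 - 1, by omega⟩
  exact
    { supp := h.supp.join h'.supp hc hc'
      degree := fun x z => by
        rw [edgeCount_joinAcross h.supp h'.supp hc hc']
        by_cases hx : x < m
        · rw [h'.supp.edgeCount_eq_zero (by omega), add_zero]
          exact h.degree x z
        · rw [h.supp.edgeCount_eq_zero (by omega), zero_add]
          exact h'.degree _ z
      connected := fun u v ⟨_, hu⟩ ⟨_, hv⟩ =>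
        (h.reachable_joinAcross_of_adj h' hc hc' hu).trans
          (h.reachable_joinAcross_of_adj h' hc hc' hv).symm
      nonempty := ⟨_, _, edgeGraph_joinAcross_adj e e' (.inl rfl)⟩ }

end Join

/-- There are two loops with equal signatures, with difference `f`, and with the edges of `K` in
common. The edges of `K` are those along which further loops may be attached. -/
def HasLoopPair (m n : ℤ) (f : ℤ → ℤ → ℤ) (K : MidpointSet) : Prop :=
  ∃ e₁ e₂, IsLoop m n e₁ ∧ IsLoop m n e₂ ∧ edgeDiff e₁ e₂ = f ∧ CellSumsVanish m n f ∧
    ∀ a b, K a b → e₁ a b ∧ e₂ a b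

lemma neighborSum_add_shift (f f' : ℤ → ℤ → ℤ) (m a b : ℤ) :
    neighborSum (fun a b => f a b + f' (a - 2 * m) b) a b =
      neighborSum f a b + neighborSum f' (a - 2 * m) b := by
  simp only [neighborSum]
  rw [show a + 1 - 2 * m = a - 2 * m + 1 by ring, show a - 1 - 2 * m = a - 2 * m - 1 by ring]
  ring

namespace HasLoopPair

variable {m n : ℤ} {f : ℤ → ℤ → ℤ} {K : MidpointSet}

lemma neg (h : HasLoopPair m n f K) : HasLoopPair m n (fun a b => -f a b) K := by
  obtain ⟨e₁, e₂, h₁, h₂, rfl, hcell, hK⟩ := h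
  refine ⟨e₂, e₁, h₂, h₁, ?_, fun x y hx hx' hy hy' => ?_, fun a b hab => (hK a b hab).symm⟩
  · funext a b
    unfold edgeDiff
    ring
  · have := hcell x y hx hx' hy hy'
    unfold neighborSum at *
    linarith

lemma mirror (h : HasLoopPair m n f K) :
    HasLoopPair m n (fun a b => f (2 * m - a) b) (fun a b => K (2 * m - a) b) := by
  obtain ⟨e₁, e₂, h₁, h₂, rfl, hcell, hK⟩ := h
  refine ⟨_, _, h₁.mirror, h₂.mirror, rfl, fun x y hx hx' hy hy' => ?_, fun a b hab => hK _ b hab⟩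
  have := hcell (m - x) y (by omega) (by omega) hy hy'
  unfold neighborSum at *
  rw [show 2 * (m - x) + 1 = 2 * m - (2 * x - 1) by ring,
    show 2 * (m - x) - 1 = 2 * m - (2 * x + 1) by ring,
    show 2 * (m - x) = 2 * m - 2 * x by ring] at this
  linarith

lemma transpose (h : HasLoopPair m n f K) :
    HasLoopPair n m (fun a b => f b a) (fun a b => K b a) := by
  obtain ⟨e₁, e₂, h₁, h₂, rfl, hcell, hK⟩ := h
  refine ⟨_, _, h₁.transpose, h₂.transpose, rfl, fun x y hx hx' hy hy' => ?_,
    fun a b hab => hK _ _ hab⟩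
  have := hcell y x hy hy' hx hx'
  unfold neighborSum at *
  linarith

lemma eq_zero (h : HasLoopPair m n f K) {a b : ℤ}
    (hab : a ≤ 0 ∨ 2 * m ≤ a ∨ b ≤ 0 ∨ 2 * n ≤ b) : f a b = 0 := by
  obtain ⟨e₁, e₂, h₁, h₂, rfl, -, -⟩ := h
  unfold edgeDiff
  rw [ind_false fun h => by have := h₁.supp a b h; omega,
    ind_false fun h => by have := h₂.supp a b h; omega, sub_zero]

section Join

variable {m' : ℤ} {f' : ℤ → ℤ → ℤ} {K' : MidpointSet}

lemma cellSumsVanish_join (h : HasLoopPair m n f K) (h' : HasLoopPair m' n f' K')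
    (hf : ∀ b, f (2 * m - 1) b + f' 1 b = 0) :
    CellSumsVanish (m + m') n (fun a b => f a b + f' (a - 2 * m) b) := by
  intro x y hx hx' hy hy'
  have hzero : ∀ a b, 2 * m ≤ a → f a b = 0 := fun a b ha => h.eq_zero (by omega)
  have hzero' : ∀ a b, a ≤ 0 → f' a b = 0 := fun a b ha => h'.eq_zero (by omega)
  obtain ⟨-, -, -, -, -, hcell, -⟩ := h
  obtain ⟨-, -, -, -, -, hcell', -⟩ := h'
  rw [neighborSum_add_shift]
  rcases lt_trichotomy x m with hxm | rfl | hxm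
  · rw [hcell x y hx hxm hy hy']
    simp only [neighborSum]
    rw [hzero' _ _ (by omega), hzero' _ _ (by omega), hzero' _ _ (by omega), hzero' _ _ (by omega)]
    rfl
  · simp only [neighborSum, sub_self, zero_add, zero_sub]
    rw [hzero' (-1) _ (by omega), hzero' 0 _ le_rfl, hzero' 0 _ le_rfl,
      hzero (2 * x + 1) _ (by omega), hzero (2 * x) _ le_rfl, hzero (2 * x) _ le_rfl]
    linarith [hf (2 * y)]
  · rw [← mul_sub, hcell' (x - m) y (by omega) (by omega) hy hy']
    simp only [neighborSum]
    rw [hzero _ _ (by omega), hzero _ _ (by omega), hzero _ _ (by omega), hzero _ _ (by omega)]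
    rfl

lemma join {c : ℤ} (h : HasLoopPair m n f K) (h' : HasLoopPair m' n f' K') (hc : K (2 * m - 1) c)
    (hc' : K' 1 c) (hf : ∀ b, f (2 * m - 1) b + f' 1 b = 0) :
    HasLoopPair (m + m') n (fun a b => f a b + f' (a - 2 * m) b)
      (fun a b => K a b ∧ ¬(a = 2 * m - 1 ∧ b = c)) := by
  have hcell := h.cellSumsVanish_join h' hf
  obtain ⟨e₁, e₂, h₁, h₂, rfl, -, hK⟩ := h
  obtain ⟨e₁', e₂', h₁', h₂', rfl, -, hK'⟩ := h'
  obtain ⟨hc₁, hc₂⟩ := hK _ _ hc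
  obtain ⟨hc₁', hc₂'⟩ := hK' _ _ hc'
  refine ⟨_, _, h₁.join h₁' hc₁ hc₁', h₂.join h₂' hc₂ hc₂', ?_, hcell, ?_⟩
  · funext a b
    unfold edgeDiff
    rw [ind_joinAcross h₁.supp h₁'.supp hc₁ hc₁', ind_joinAcross h₂.supp h₂'.supp hc₂ hc₂']
    ring
  · rintro a b ⟨hab, hne⟩
    exact ⟨.inl ⟨(hK a b hab).1, hne⟩, .inl ⟨(hK a b hab).2, hne⟩⟩

end Join

/-- Every second copy is reflected and has its two loops exchanged, so that the differences cancel
along each junction. -/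
lemma exists_row {c c' : ℤ} (hm : 2 ≤ m) (k : ℕ) (h : HasLoopPair m n f K) (hc : K 1 c)
    (hc' : K (2 * m - 1) c') :
    ∃ f' K', HasLoopPair ((k + 1 : ℕ) * m) n f' K' ∧ (∀ a b, a ≤ 2 * m → f' a b = f a b) ∧
      (∀ z, (∀ a, f a z = 0) → ∀ a, f' a z = 0) ∧ (∀ a b, b % 2 = 1 → K a b → K' a b) ∧
      K' 1 c := by
  induction k generalizing f K c c' with
  | zero =>
    exact ⟨f, K, by simpa using h, fun _ _ _ => rfl, fun _ h => h, fun _ _ _ h => h, hc⟩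
  | succ k ih =>
    obtain ⟨f', K', hrow, hfirst, hzero, -, hc''⟩ := ih (c := c') (c' := c) h.mirror.neg
      hc' (by rwa [sub_sub_cancel])
    have heven : c' % 2 = 0 := by
      obtain ⟨e₁, e₂, h₁, -, -, -, hK⟩ := h
      have := h₁.supp _ _ (hK _ _ hc').1
      omega
    have hjoin := h.join hrow hc' hc'' (fun b => by rw [hfirst _ _ (by omega)]; ring_nf)
    rw [show m + ((k + 1 : ℕ) : ℤ) * m = ((k + 1 + 1 : ℕ) : ℤ) * m by push_cast; ring] at hjoin
    refine ⟨_, _, hjoin, fun a b ha => ?_, fun z hz a => ?_, fun a b hb hab => ⟨hab, by omega⟩,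
      hc, by omega⟩
    · rw [hrow.eq_zero (by omega), add_zero]
    · rw [hz, hzero z (fun a => by rw [hz, neg_zero]), add_zero]

lemma exists_array {a a' c c' : ℤ} (hm : 2 ≤ m) (hn : 2 ≤ n) (k l : ℕ) (h : HasLoopPair m n f K)
    (hleft : K 1 c) (hright : K (2 * m - 1) c') (hbottom : K a 1) (htop : K a' (2 * n - 1)) :
    ∃ f' K', HasLoopPair ((k + 1 : ℕ) * m) ((l + 1 : ℕ) * n) f' K' ∧
      (∀ a b, a ≤ 2 * m → b ≤ 2 * n → f' a b = f a b) ∧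
      (∀ z, z ≤ 2 * m → (∀ b, f z b = 0) → ∀ b, f' z b = 0) := by
  obtain ⟨f₁, K₁, hrow, hrow_eq, -, hK₁, -⟩ := h.exists_row hm k hleft hright
  obtain ⟨f₂, K₂, harray, harray_eq, hzero, -, -⟩ := hrow.transpose.exists_row hn l
    (hK₁ _ _ (by norm_num) hbottom) (hK₁ _ _ (by omega) htop)
  refine ⟨_, _, harray.transpose, fun a b ha hb => ?_, fun z hz h₀ b => ?_⟩
  · rw [harray_eq _ _ hb, hrow_eq _ _ ha]
  · exact hzero z (fun b => by rw [hrow_eq _ _ hz]; exact h₀ b) b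

end HasLoopPair

lemma HasLoopPair.supportCard_eq {m n q m' n' : ℕ} {f : ℤ → ℤ → ℤ} {K : MidpointSet}
    (h : HasLoopPair m n f K) (hm : m = q * m') (hn : n = q * n') (hm₀ : 0 < m) (hn₀ : 0 < n)
    (hz : ∀ b, f (2 * q) b = 0) :
    (supportCard m n f : ℤ) = 4 * (∑ i ∈ Finset.range q, if f (i + 1) i ≠ 0 then 1 else 0) *
      (q - ∑ i ∈ Finset.range q, if f (i + 1) i ≠ 0 then 1 else 0) * m' * n' := by
  obtain ⟨e₁, e₂, h₁, h₂, rfl, hcell, -⟩ := h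
  have hf := h₁.isEvenSet.isSignatureDiff h₂.isEvenSet hcell
  have hA := hf.isProfile_profile (by exact_mod_cast hm₀) (by exact_mod_cast hn₀)
  have hqm : q ≤ m := Nat.le_of_dvd hm₀ ⟨m', hm⟩
  have hqn : q ≤ n := Nat.le_of_dvd hn₀ ⟨n', hn⟩
  have hones : ∑ i ∈ Finset.range q, profile m n (edgeDiff e₁ e₂) i =
      ∑ i ∈ Finset.range q, if edgeDiff e₁ e₂ (i + 1) i ≠ 0 then 1 else 0 := by
    refine Finset.sum_congr rfl fun i hi => ?_
    rw [Finset.mem_range] at hi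
    have hdiag := hA.diag i (by omega) (by omega) (by omega)
    rcases hA.values i with hi | hi <;> simp [hdiag, hi]
  rw [hA.supportCard_eq hf (hA.vanish q (by omega) (by omega) hz) hm hn, hones]

lemma supportCard_transpose (m n : ℤ) (f : ℤ → ℤ → ℤ) :
    supportCard n m (fun a b => f b a) = supportCard m n f :=
  Finset.card_equiv (Equiv.prodComm ℤ ℤ) fun p => by
    simp [and_comm (a := _ ∧ p.1 < _)]

/-! ### Loops given by lists of vertices -/

/-- The midpoints, in doubled coordinates, of the edges of the closed polygon with the given
vertices. -/
def polygonMidpoints (l : List (ℤ × ℤ)) : List (ℤ × ℤ) :=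
  List.zipWith (fun u v => (u.1 + v.1 + 1, u.2 + v.2 + 1)) l (l.rotate 1)

instance (u v : ℤ × ℤ) : Decidable (IsUnitStep u v) := by unfold IsUnitStep; infer_instance

/-- The closed polygon with the given vertices, as a set of edges. -/
def polygon (l : List (ℤ × ℤ)) (a b : ℤ) : Prop := (a, b) ∈ polygonMidpoints l

instance (l : List (ℤ × ℤ)) (a b : ℤ) : Decidable (polygon l a b) := by
  unfold polygon; infer_instance

/-- The indicator `ind`, for decidable propositions and therefore by evaluation. -/
def bit (p : Prop) [Decidable p] : ℤ := if p then 1 else 0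

lemma ind_eq_bit (p : Prop) [Decidable p] : ind p = bit p := by
  unfold ind bit; congr

lemma reachable_of_isChain {V : Type*} {G : SimpleGraph V} {u : V} {l : List V}
    (h : List.IsChain G.Adj (u :: l)) : ∀ v ∈ u :: l, G.Reachable u v := by
  induction l generalizing u with
  | nil => simp
  | cons w l ih =>
    rw [List.isChain_cons_cons] at h
    intro v hv
    rcases List.mem_cons.1 hv with rfl | hv
    · exact SimpleGraph.Reachable.refl _
    · exact h.1.reachable.trans (ih h.2 v hv)

lemma IsUnitStep.left_eq {u v : ℤ × ℤ} (h : IsUnitStep u v) :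
    u = ((u.1 + v.1) / 2, (u.2 + v.2) / 2) ∨ u = ((u.1 + v.1 + 1) / 2, (u.2 + v.2 + 1) / 2) := by
  simp only [IsUnitStep, Prod.ext_iff] at h ⊢
  omega

lemma edgeCount_polygon_eq_zero {l : List (ℤ × ℤ)} {x y : ℤ}
    (h : ∀ w, ¬(edgeGraph (polygon l)).Adj (x, y) w) :
    edgeCount (polygon l) (2 * x + 1) (2 * y + 1) = 0 := by
  have hempty : (edgeGraph (polygon l)).neighborSet (x, y) = ∅ :=
    Set.eq_empty_of_forall_notMem h
  rw [← ncard_neighborSet_edgeGraph, hempty, Set.ncard_empty, Nat.cast_zero]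

/-- All hypotheses can be checked by evaluation. -/
lemma isLoop_polygon {m n : ℤ} {u : ℤ × ℤ} {l : List (ℤ × ℤ)} (hl : l ≠ [])
    (hgrid : ∀ p ∈ polygonMidpoints (u :: l), 0 < p.1 ∧ p.1 < 2 * m ∧ 0 < p.2 ∧ p.2 < 2 * n ∧
      (p.1 + p.2) % 2 = 1)
    (hends : ∀ p ∈ polygonMidpoints (u :: l),
      ((p.1 - 1) / 2, (p.2 - 1) / 2) ∈ u :: l ∧ (p.1 / 2, p.2 / 2) ∈ u :: l)
    (hdeg : ∀ v ∈ u :: l, neighborSum (fun a b => bit (polygon (u :: l) a b))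
      (2 * v.1 + 1) (2 * v.2 + 1) = 2)
    (hchain : List.IsChain
      (fun v w => IsUnitStep v w ∧ polygon (u :: l) (v.1 + w.1 + 1) (v.2 + w.2 + 1)) (u :: l)) :
    IsLoop m n (polygon (u :: l)) := by
  have hmem : ∀ v w, (edgeGraph (polygon (u :: l))).Adj v w → v ∈ u :: l := by
    rintro v w ⟨hstep, hvw⟩
    obtain ⟨hfloor, hceil⟩ := hends _ hvw
    simp only [add_sub_cancel_right] at hfloor
    rcases hstep.left_eq with hv | hv <;> rw [hv] <;> assumption
  have hreach := reachable_of_isChain (G := edgeGraph (polygon (u :: l))) hchain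
  refine ⟨fun a b hab => ?_, fun x y => ?_, fun v w ⟨v', hv⟩ ⟨w', hw⟩ => ?_, ?_⟩
  · have := hgrid _ hab
    omega
  · by_cases hv : (x, y) ∈ u :: l
    · exact .inr (by simpa only [edgeCount, ind_eq_bit] using hdeg _ hv)
    · exact .inl (edgeCount_polygon_eq_zero fun w hw => hv (hmem _ _ hw))
  · exact (hreach _ (hmem _ _ hv)).symm.trans (hreach _ (hmem _ _ hw))
  · obtain ⟨w, l, rfl⟩ := List.exists_cons_of_ne_nil hl
    exact ⟨u, w, (List.isChain_cons_cons.1 hchain).1⟩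

lemma IsLoop.mono {m n m' n' : ℤ} {e : MidpointSet} (h : IsLoop m n e) (hm : m ≤ m')
    (hn : n ≤ n') : IsLoop m' n' e where
  __ := h
  supp a b hab := by have := h.supp a b hab; omega

/-- The boundary of a cell, as a list of vertices. -/
def square : List (ℤ × ℤ) := [(0, 0), (1, 0), (1, 1), (0, 1)]

lemma isLoop_square : IsLoop 2 2 (polygon square) :=
  isLoop_polygon (by decide) (by decide) (by decide) (by decide) (by decide)

/-- The first loop of a pair on the `4 × 4` grid. -/
def fourA : List (ℤ × ℤ) := [(0, 0), (1, 0), (2, 0), (2, 1), (3, 1), (3, 2), (3, 3), (2, 3), (1, 3),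
  (1, 2), (0, 2), (0, 1)]

/-- The second loop of a pair on the `4 × 4` grid. -/
def fourB : List (ℤ × ℤ) := [(1, 0), (2, 0), (3, 0), (3, 1), (3, 2), (2, 2), (2, 3), (1, 3), (0, 3),
  (0, 2), (0, 1), (1, 1)]

/-- The first loop of a pair on the `6 × 4` grid. -/
def sixA : List (ℤ × ℤ) := [(1, 3), (2, 3), (3, 3), (4, 3), (4, 2), (5, 2), (5, 1), (5, 0), (4, 0),
  (3, 0), (3, 1), (3, 2), (2, 2), (2, 1), (2, 0), (1, 0), (0, 0), (0, 1), (0, 2), (1, 2)]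

/-- The second loop of a pair on the `6 × 4` grid. -/
def sixB : List (ℤ × ℤ) := [(0, 3), (1, 3), (2, 3), (2, 2), (2, 1), (3, 1), (3, 2), (3, 3), (4, 3),
  (5, 3), (5, 2), (5, 1), (4, 1), (4, 0), (3, 0), (2, 0), (1, 0), (1, 1), (0, 1), (0, 2)]

lemma isLoop_fourA : IsLoop 4 4 (polygon fourA) :=
  isLoop_polygon (by decide) (by decide +kernel) (by decide +kernel) (by decide +kernel) (by decide)

lemma isLoop_fourB : IsLoop 4 4 (polygon fourB) :=
  isLoop_polygon (by decide) (by decide +kernel) (by decide +kernel) (by decide +kernel) (by decide)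

lemma isLoop_sixA : IsLoop 6 4 (polygon sixA) :=
  isLoop_polygon (by decide) (by decide +kernel) (by decide +kernel) (by decide +kernel) (by decide)

lemma isLoop_sixB : IsLoop 6 4 (polygon sixB) :=
  isLoop_polygon (by decide) (by decide +kernel) (by decide +kernel) (by decide +kernel) (by decide)

lemma edgeDiff_polygon (l l' : List (ℤ × ℤ)) (a b : ℤ) :
    edgeDiff (polygon l) (polygon l') a b = bit (polygon l a b) - bit (polygon l' a b) := by
  rw [edgeDiff, ind_eq_bit, ind_eq_bit]

lemma hasLoopPair_polygon {m n : ℤ} {l l' : List (ℤ × ℤ)} (h : IsLoop m n (polygon l))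
    (h' : IsLoop m n (polygon l'))
    (hcell : ∀ x ∈ Finset.Ioo 0 m, ∀ y ∈ Finset.Ioo 0 n,
      neighborSum (fun a b => bit (polygon l a b) - bit (polygon l' a b)) (2 * x) (2 * y) = 0) :
    HasLoopPair m n (edgeDiff (polygon l) (polygon l'))
      (fun a b => polygon l a b ∧ polygon l' a b) := by
  refine ⟨_, _, h, h', rfl, fun x y hx hx' hy hy' => ?_, fun a b hab => hab⟩
  simpa only [neighborSum, edgeDiff_polygon] using
    hcell x (Finset.mem_Ioo.2 ⟨hx, hx'⟩) y (Finset.mem_Ioo.2 ⟨hy, hy'⟩)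

lemma hasLoopPair_four : HasLoopPair 4 4 (edgeDiff (polygon fourA) (polygon fourB))
    (fun a b => polygon fourA a b ∧ polygon fourB a b) :=
  hasLoopPair_polygon isLoop_fourA isLoop_fourB (by decide +kernel)

lemma hasLoopPair_six : HasLoopPair 6 4 (edgeDiff (polygon sixA) (polygon sixB))
    (fun a b => polygon sixA a b ∧ polygon sixB a b) :=
  hasLoopPair_polygon isLoop_sixA isLoop_sixB (by decide +kernel)

lemma HasLoopPair.column_congr {m m' n : ℤ} {f f' : ℤ → ℤ → ℤ} {K K' : MidpointSet}
    (h : HasLoopPair m n f K) (h' : HasLoopPair m' n f' K') {a a' : ℤ}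
    (heq : ∀ b ∈ Finset.Ioo 0 (2 * n), f a b = f' a' b) (b : ℤ) : f a b = f' a' b := by
  by_cases hb : b ∈ Finset.Ioo 0 (2 * n)
  · exact heq b hb
  · rw [Finset.mem_Ioo] at hb
    rw [h.eq_zero (by omega), h'.eq_zero (by omega)]

lemma HasLoopPair.column_eq_zero {m n : ℤ} {f : ℤ → ℤ → ℤ} {K : MidpointSet}
    (h : HasLoopPair m n f K) {a : ℤ} (hzero : ∀ b ∈ Finset.Ioo 0 (2 * n), f a b = 0) (b : ℤ) :
    f a b = 0 := by
  have hzero' : ∀ b, f 0 b = 0 := fun b => h.eq_zero (by omega)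
  rw [h.column_congr h (a' := 0) (fun b hb => by rw [hzero b hb, hzero']), hzero']

lemma edgeDiff_four_column_four (b : ℤ) : edgeDiff (polygon fourA) (polygon fourB) 4 b = 0 :=
  hasLoopPair_four.column_eq_zero (by simp only [edgeDiff_polygon]; decide +kernel) b

lemma edgeDiff_six_column_four (b : ℤ) : edgeDiff (polygon sixA) (polygon sixB) 4 b = 0 :=
  hasLoopPair_six.column_eq_zero (by simp only [edgeDiff_polygon]; decide +kernel) b

lemma edgeDiff_six_last_column (b : ℤ) : edgeDiff (polygon sixA) (polygon sixB) 11 b =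
    edgeDiff (polygon fourA) (polygon fourB) 1 b :=
  hasLoopPair_six.column_congr hasLoopPair_four
    (by simp only [edgeDiff_polygon]; decide +kernel) b

/-! ### Even gcd: gluing copies of the explicit pairs -/

/-- Some pair of loops on the `m × n` grid with equal signatures has a difference of size `s`. -/
def IsAttained (m n : ℕ) (s : ℤ) : Prop :=
  ∃ f K, HasLoopPair m n f K ∧ (supportCard m n f : ℤ) = s

lemma IsAttained.transpose {m n : ℕ} {s : ℤ} (h : IsAttained m n s) : IsAttained n m s := by
  obtain ⟨f, K, hpair, hcard⟩ := h
  exact ⟨_, _, hpair.transpose, by rw [supportCard_transpose, hcard]⟩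

/-- The vanishing column gives the period `4`, with one half of its residues in the support. -/
lemma HasLoopPair.isAttained_mul {m n : ℕ} {f : ℤ → ℤ → ℤ} {K : MidpointSet}
    (h : HasLoopPair m n f K) (hm : 2 ∣ m) (hn : 2 ∣ n) (hm₀ : 0 < m) (hn₀ : 0 < n)
    (hzero : ∀ b, f 4 b = 0) (hne : f 2 1 ≠ 0) : IsAttained m n (m * n) := by
  obtain ⟨m', rfl⟩ := hm
  obtain ⟨n', rfl⟩ := hn
  have hcorner : f 1 0 = 0 := h.eq_zero (by omega)
  refine ⟨f, K, h, ?_⟩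
  rw [h.supportCard_eq rfl rfl hm₀ hn₀ hzero, Finset.sum_range_succ, Finset.sum_range_one]
  norm_num [hcorner, hne]
  ring

lemma isAttained_of_four_dvd {m n : ℕ} (hm : 4 ∣ m) (hn : 4 ∣ n) (hm₀ : 0 < m) (hn₀ : 0 < n) :
    IsAttained m n (m * n) := by
  obtain ⟨k, rfl⟩ : ∃ k, m = (k + 1) * 4 := ⟨m / 4 - 1, by omega⟩
  obtain ⟨l, rfl⟩ : ∃ l, n = (l + 1) * 4 := ⟨n / 4 - 1, by omega⟩
  obtain ⟨f, K, hpair, hcopy, hzero⟩ :=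
    hasLoopPair_four.exists_array (a := 4) (a' := 4) (c := 4) (c' := 4) (by norm_num)
      (by norm_num) k l (by decide) (by decide) (by decide) (by decide)
  have hpair' : HasLoopPair ((k + 1) * 4 : ℕ) ((l + 1) * 4 : ℕ) f K := by
    rw [Nat.cast_mul, Nat.cast_mul]; exact hpair
  refine hpair'.isAttained_mul (by omega) (by omega) hm₀ hn₀
    (hzero 4 (by norm_num) edgeDiff_four_column_four) ?_
  rw [hcopy 2 1 (by norm_num) (by norm_num), edgeDiff_polygon]
  decide

/-- The `6 × 4` pair followed by a row of `k` copies of the `4 × 4` pair. -/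
lemma exists_row_six_four (k : ℕ) :
    ∃ f K, HasLoopPair (6 + k * 4 : ℕ) 4 f K ∧
      (∀ a b, a ≤ 11 → f a b = edgeDiff (polygon sixA) (polygon sixB) a b) ∧ K 4 1 ∧ K 4 7 := by
  rcases k with _ | k
  · exact ⟨_, _, hasLoopPair_six, fun _ _ _ => rfl, by decide, by decide⟩
  · obtain ⟨f, K, hrow, hcopy, -, -, hK⟩ :=
      hasLoopPair_four.neg.exists_row (c := 4) (c' := 4) (by norm_num) k (by decide) (by decide)
    have hjoin := hasLoopPair_six.join hrow (c := 4) (by decide) hK fun b => by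
      rw [hcopy _ _ (by norm_num), add_neg_eq_zero]; exact edgeDiff_six_last_column b
    refine ⟨_, _, by push_cast at hjoin ⊢; exact hjoin, fun a b ha => ?_, by decide, by decide⟩
    rw [hrow.eq_zero (by omega), add_zero]

lemma isAttained_of_mod_four_eq_two {m n : ℕ} (hm : m % 4 = 2) (hn : 4 ∣ n) (hm₀ : 4 ≤ m)
    (hn₀ : 0 < n) : IsAttained m n (m * n) := by
  obtain ⟨k, rfl⟩ : ∃ k, m = 6 + k * 4 := ⟨(m - 6) / 4, by omega⟩
  obtain ⟨l, rfl⟩ : ∃ l, n = (l + 1) * 4 := ⟨n / 4 - 1, by omega⟩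
  obtain ⟨f₀, K₀, hrow, hrow_eq, hbottom, htop⟩ := exists_row_six_four k
  obtain ⟨f, K, harray, harray_eq, hzero, -⟩ :=
    hrow.transpose.exists_row (c := 4) (c' := 4) (by norm_num) l hbottom htop
  have hpair : HasLoopPair (6 + k * 4 : ℕ) ((l + 1) * 4 : ℕ)
      (fun a b => f b a) (fun a b => K b a) := by
    rw [Nat.cast_mul]; exact harray.transpose
  refine hpair.isAttained_mul (by omega) (by omega) (by omega) hn₀
    (hzero 4 fun b => by rw [hrow_eq _ _ (by norm_num)]; exact edgeDiff_six_column_four b) ?_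
  rw [harray_eq 1 2 (by norm_num), hrow_eq _ _ (by norm_num), edgeDiff_polygon]
  decide

/-! ### Pairs of loops on odd square grids -/

/-- The right end of the edge is `(x + 1, y)`; the loop contains it if it lies below the
antidiagonal. -/
def LowerHorizontal (c x y : ℤ) : Prop :=
  0 ≤ x ∧ 0 ≤ y ∧ ((x % 2 = 0 ∧ (x / 2 + y) % 2 = c) ∨ (y = 0 ∧ x % 4 = 1) ∨
    ((y = 1 ∨ y = 2) ∧ x % 4 = 3))

/-- The upper end of the edge is `(x, y + 1)`; the loop contains it if it lies below the
antidiagonal. -/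
def LowerVertical (c x y : ℤ) : Prop :=
  0 ≤ x ∧ 0 ≤ y ∧ ((y % 2 = 0 ∧ (y / 2 + x) % 2 = c) ∨
    (y % 2 = 1 ∧ (x / 2 + y / 2 + x) % 2 = 0 ∧ (3 ≤ y ∨ x = 0)))

/-- The horizontal edges beyond the antidiagonal, in coordinates rotated by a half turn. -/
def UpperHorizontal (c x y : ℤ) : Prop :=
  0 ≤ x ∧ 0 ≤ y ∧ ((x % 2 = 0 ∧ (x / 2 + y) % 2 = 1 - c) ∨ (y = 0 ∧ x % 4 = 1))

/-- The vertical edges beyond the antidiagonal, in coordinates rotated by a half turn. -/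
def UpperVertical (c x y : ℤ) : Prop :=
  0 ≤ x ∧ 0 ≤ y ∧ ((y % 2 = 0 ∧ (y / 2 + x) % 2 = 1 - c) ∨
    (y % 2 = 1 ∧ (x / 2 + y / 2 + x) % 2 = 0))

instance (c x y : ℤ) : Decidable (LowerHorizontal c x y) := by
  unfold LowerHorizontal; infer_instance

instance (c x y : ℤ) : Decidable (LowerVertical c x y) := by
  unfold LowerVertical; infer_instance

instance (c x y : ℤ) : Decidable (UpperHorizontal c x y) := by
  unfold UpperHorizontal; infer_instance

instance (c x y : ℤ) : Decidable (UpperVertical c x y) := by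
  unfold UpperVertical; infer_instance

/-- The edge patterns do not distinguish the two coordinates: beyond `3` they have period `4`. -/
def PatternEquiv (x x' : ℤ) : Prop := x % 4 = x' % 4 ∧ (x = x' ∨ (3 ≤ x ∧ 3 ≤ x'))

lemma exists_patternEquiv {x : ℤ} (hx : 0 ≤ x) :
    ∃ x' ∈ Finset.Ico (0 : ℤ) 8, PatternEquiv x x' ∧ PatternEquiv (x - 1) (x' - 1) ∧
      PatternEquiv (x + 1) (x' + 1) := by
  by_cases h : x < 4
  · exact ⟨x, by rw [Finset.mem_Ico]; omega, by unfold PatternEquiv; omega⟩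
  · exact ⟨x % 4 + 4, by rw [Finset.mem_Ico]; omega, by unfold PatternEquiv; omega⟩

section Pattern

variable {c x x' y y' : ℤ}

lemma ind_lowerHorizontal (c : ℤ) (hx : PatternEquiv x x') (hy : PatternEquiv y y') :
    ind (LowerHorizontal c x y) = bit (LowerHorizontal c x' y') := by
  rw [← ind_eq_bit]
  refine ind_congr ?_
  unfold PatternEquiv at hx hy
  unfold LowerHorizontal
  rw [show (x / 2 + y) % 2 = (x' / 2 + y') % 2 by omega, show x % 2 = x' % 2 by omega,
    show 0 ≤ x ↔ 0 ≤ x' by omega, show 0 ≤ y ↔ 0 ≤ y' by omega, show y = 0 ↔ y' = 0 by omega,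
    show (y = 1 ∨ y = 2) ↔ (y' = 1 ∨ y' = 2) by omega, hx.1]

lemma ind_lowerVertical (c : ℤ) (hx : PatternEquiv x x') (hy : PatternEquiv y y') :
    ind (LowerVertical c x y) = bit (LowerVertical c x' y') := by
  rw [← ind_eq_bit]
  refine ind_congr ?_
  unfold PatternEquiv at hx hy
  unfold LowerVertical
  rw [show (x / 2 + y / 2 + x) % 2 = (x' / 2 + y' / 2 + x') % 2 by omega,
    show (y / 2 + x) % 2 = (y' / 2 + x') % 2 by omega, show y % 2 = y' % 2 by omega,
    show 0 ≤ x ↔ 0 ≤ x' by omega, show 0 ≤ y ↔ 0 ≤ y' by omega, show x = 0 ↔ x' = 0 by omega,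
    show 3 ≤ y ↔ 3 ≤ y' by omega]

lemma ind_upperHorizontal (c : ℤ) (hx : PatternEquiv x x') (hy : PatternEquiv y y') :
    ind (UpperHorizontal c x y) = bit (UpperHorizontal c x' y') := by
  rw [← ind_eq_bit]
  refine ind_congr ?_
  unfold PatternEquiv at hx hy
  unfold UpperHorizontal
  rw [show (x / 2 + y) % 2 = (x' / 2 + y') % 2 by omega, show x % 2 = x' % 2 by omega,
    show 0 ≤ x ↔ 0 ≤ x' by omega, show 0 ≤ y ↔ 0 ≤ y' by omega, show y = 0 ↔ y' = 0 by omega, hx.1]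

lemma ind_upperVertical (c : ℤ) (hx : PatternEquiv x x') (hy : PatternEquiv y y') :
    ind (UpperVertical c x y) = bit (UpperVertical c x' y') := by
  rw [← ind_eq_bit]
  refine ind_congr ?_
  unfold PatternEquiv at hx hy
  unfold UpperVertical
  rw [show (x / 2 + y / 2 + x) % 2 = (x' / 2 + y' / 2 + x') % 2 by omega,
    show (y / 2 + x) % 2 = (y' / 2 + x') % 2 by omega, show y % 2 = y' % 2 by omega,
    show 0 ≤ x ↔ 0 ≤ x' by omega, show 0 ≤ y ↔ 0 ≤ y' by omega]

lemma lower_degree (hc : c ∈ ({0, 1} : Finset ℤ)) (hx : 0 ≤ x) (hy : 0 ≤ y) :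
    ind (LowerHorizontal c x y) + ind (LowerHorizontal c (x - 1) y) +
      ind (LowerVertical c x y) + ind (LowerVertical c x (y - 1)) ∈ ({0, 2} : Finset ℤ) := by
  obtain ⟨x', hx', ex, ex', -⟩ := exists_patternEquiv hx
  obtain ⟨y', hy', ey, ey', -⟩ := exists_patternEquiv hy
  rw [ind_lowerHorizontal c ex ey, ind_lowerHorizontal c ex' ey, ind_lowerVertical c ex ey,
    ind_lowerVertical c ex ey']
  clear * - hc hx' hy'
  revert y' x' c
  decide +kernel

lemma upper_degree (hc : c ∈ ({0, 1} : Finset ℤ)) (hx : 0 ≤ x) (hy : 0 ≤ y) :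
    ind (UpperHorizontal c (x - 1) y) + ind (UpperHorizontal c x y) +
      ind (UpperVertical c x (y - 1)) + ind (UpperVertical c x y) ∈ ({0, 2} : Finset ℤ) := by
  obtain ⟨x', hx', ex, ex', -⟩ := exists_patternEquiv hx
  obtain ⟨y', hy', ey, ey', -⟩ := exists_patternEquiv hy
  rw [ind_upperHorizontal c ex ey, ind_upperHorizontal c ex' ey, ind_upperVertical c ex ey,
    ind_upperVertical c ex ey']
  clear * - hc hx' hy'
  revert y' x' c
  decide +kernel

lemma antidiagonal_degree (hc : c ∈ ({0, 1} : Finset ℤ)) (hx : 0 ≤ x) (hy : 0 ≤ y)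
    (hxy : (x + y) % 2 = 0) :
    ind (UpperHorizontal c (y - 1) x) + ind (LowerHorizontal c (x - 1) y) +
      ind (UpperVertical c y (x - 1)) + ind (LowerVertical c x (y - 1)) ∈ ({0, 2} : Finset ℤ) := by
  obtain ⟨x', hx', ex, ex', -⟩ := exists_patternEquiv hx
  obtain ⟨y', hy', ey, ey', -⟩ := exists_patternEquiv hy
  rw [ind_upperHorizontal c ey' ex, ind_lowerHorizontal c ex' ey, ind_upperVertical c ey ex',
    ind_lowerVertical c ex ey']
  have hparity : (x' + y') % 2 = 0 := by have := ex.1; have := ey.1; omega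
  clear * - hc hx' hy' hparity
  revert hparity y' x' c
  decide +kernel

lemma lower_cell (hx : 0 ≤ x) (hy : 0 ≤ y) :
    ind (LowerHorizontal 0 x y) + ind (LowerHorizontal 0 x (y + 1)) +
        ind (LowerVertical 0 x y) + ind (LowerVertical 0 (x + 1) y) =
      ind (LowerHorizontal 1 x y) + ind (LowerHorizontal 1 x (y + 1)) +
        ind (LowerVertical 1 x y) + ind (LowerVertical 1 (x + 1) y) := by
  obtain ⟨x', hx', ex, -, ex'⟩ := exists_patternEquiv hx
  obtain ⟨y', hy', ey, -, ey'⟩ := exists_patternEquiv hy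
  simp only [ind_lowerHorizontal _ ex ey, ind_lowerHorizontal _ ex ey', ind_lowerVertical _ ex ey,
    ind_lowerVertical _ ex' ey]
  clear * - hx' hy'
  revert y' x'
  decide +kernel

lemma upper_cell (hx : 0 ≤ x) (hy : 0 ≤ y) :
    ind (UpperHorizontal 0 x (y + 1)) + ind (UpperHorizontal 0 x y) +
        ind (UpperVertical 0 (x + 1) y) + ind (UpperVertical 0 x y) =
      ind (UpperHorizontal 1 x (y + 1)) + ind (UpperHorizontal 1 x y) +
        ind (UpperVertical 1 (x + 1) y) + ind (UpperVertical 1 x y) := by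
  obtain ⟨x', hx', ex, -, ex'⟩ := exists_patternEquiv hx
  obtain ⟨y', hy', ey, -, ey'⟩ := exists_patternEquiv hy
  simp only [ind_upperHorizontal _ ex ey, ind_upperHorizontal _ ex ey', ind_upperVertical _ ex ey,
    ind_upperVertical _ ex' ey]
  clear * - hx' hy'
  revert y' x'
  decide +kernel

lemma antidiagonal_cell (hx : 0 ≤ x) (hy : 0 ≤ y) (hxy : (x + y) % 2 = 1) :
    ind (LowerHorizontal 0 x y) + ind (UpperHorizontal 0 y x) +
        ind (LowerVertical 0 x y) + ind (UpperVertical 0 y x) =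
      ind (LowerHorizontal 1 x y) + ind (UpperHorizontal 1 y x) +
        ind (LowerVertical 1 x y) + ind (UpperVertical 1 y x) := by
  obtain ⟨x', hx', ex, -⟩ := exists_patternEquiv hx
  obtain ⟨y', hy', ey, -⟩ := exists_patternEquiv hy
  simp only [ind_lowerHorizontal _ ex ey, ind_upperHorizontal _ ey ex, ind_lowerVertical _ ex ey,
    ind_upperVertical _ ey ex]
  have hparity : (x' + y') % 2 = 1 := by have := ex.1; have := ey.1; omega
  clear * - hx' hy' hparity
  revert hparity y' x'
  decide +kernel

end Pattern

/-- The edges from `(x, y)` to `(x + 1, y)` of the loop `c` on the grid with `2 * N + 1` vertices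
on a side. -/
def OddHorizontal (N c x y : ℤ) : Prop :=
  (x + y ≤ 2 * N - 1 ∧ LowerHorizontal c x y) ∨
    (2 * N ≤ x + y ∧ UpperHorizontal c (2 * N - 1 - x) (2 * N - y))

/-- The edges from `(x, y)` to `(x, y + 1)` of the loop `c` on the grid with `2 * N + 1` vertices
on a side. -/
def OddVertical (N c x y : ℤ) : Prop :=
  (x + y ≤ 2 * N - 1 ∧ LowerVertical c x y) ∨
    (2 * N ≤ x + y ∧ UpperVertical c (2 * N - x) (2 * N - 1 - y))

/-- The loop `c ∈ {0, 1}` on the grid with `2 * N + 1` vertices on a side.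

The square `(X, Y)` has the corners `(2X, 2Y)`, …, `(2X + 1, 2Y + 1)`. Below the antidiagonal both
loops have one horizontal and one vertical edge in each square; together these join the same two
opposite corners, along the two possible ways round for `c = 0` and `c = 1`. The edges between the
squares do not depend on `c`. Beyond the antidiagonal the squares are counted from the top right
corner. -/
def oddLoop (N c : ℤ) : MidpointSet := fun a b =>
  (a % 2 = 0 ∧ b % 2 = 1 ∧ OddHorizontal N c (a / 2 - 1) (b / 2)) ∨
    (a % 2 = 1 ∧ b % 2 = 0 ∧ OddVertical N c (a / 2) (b / 2 - 1))

section OddLoop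

variable {N c x y X Y : ℤ}

lemma oddLoop_horizontal : oddLoop N c (2 * x + 2) (2 * y + 1) ↔ OddHorizontal N c x y := by
  unfold oddLoop
  rw [show (2 * x + 2) / 2 - 1 = x by omega, show (2 * y + 1) / 2 = y by omega]
  refine ⟨?_, fun h => .inl ⟨by omega, by omega, h⟩⟩
  rintro (⟨-, -, h⟩ | ⟨h, -⟩)
  · exact h
  · omega

lemma oddLoop_vertical : oddLoop N c (2 * x + 1) (2 * y + 2) ↔ OddVertical N c x y := by
  unfold oddLoop
  rw [show (2 * y + 2) / 2 - 1 = y by omega, show (2 * x + 1) / 2 = x by omega]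
  refine ⟨?_, fun h => .inr ⟨by omega, by omega, h⟩⟩
  rintro (⟨h, -⟩ | ⟨-, -, h⟩)
  · omega
  · exact h

lemma withinGrid_oddLoop : WithinGrid (2 * N + 1) (2 * N + 1) (oddLoop N c) := by
  rintro a b (⟨ha, hb, ⟨hab, hx, hy, -⟩ | ⟨hab, hx, hy, -⟩⟩ |
    ⟨ha, hb, ⟨hab, hx, hy, -⟩ | ⟨hab, hx, hy, -⟩⟩) <;> omega

lemma oddHorizontal_iff_lower (h : x + y ≤ 2 * N - 1) :
    OddHorizontal N c x y ↔ LowerHorizontal c x y :=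
  ⟨fun h' => h'.elim And.right fun h' => by omega, fun h' => .inl ⟨h, h'⟩⟩

lemma oddVertical_iff_lower (h : x + y ≤ 2 * N - 1) :
    OddVertical N c x y ↔ LowerVertical c x y :=
  ⟨fun h' => h'.elim And.right fun h' => by omega, fun h' => .inl ⟨h, h'⟩⟩

lemma oddHorizontal_iff_upper (h : 2 * N ≤ x + y) (hX : 2 * N - 1 - x = X) (hY : 2 * N - y = Y) :
    OddHorizontal N c x y ↔ UpperHorizontal c X Y := by
  subst hX hY
  exact ⟨fun h' => h'.elim (fun h' => by omega) And.right, fun h' => .inr ⟨h, h'⟩⟩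

lemma oddVertical_iff_upper (h : 2 * N ≤ x + y) (hX : 2 * N - x = X) (hY : 2 * N - 1 - y = Y) :
    OddVertical N c x y ↔ UpperVertical c X Y := by
  subst hX hY
  exact ⟨fun h' => h'.elim (fun h' => by omega) And.right, fun h' => .inr ⟨h, h'⟩⟩

lemma edgeCount_oddLoop_vertex : edgeCount (oddLoop N c) (2 * x + 1) (2 * y + 1) =
    ind (OddHorizontal N c x y) + ind (OddHorizontal N c (x - 1) y) +
      ind (OddVertical N c x y) + ind (OddVertical N c x (y - 1)) := by
  simp only [edgeCount, neighborSum]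
  rw [show 2 * x + 1 + 1 = 2 * x + 2 by ring, show 2 * y + 1 + 1 = 2 * y + 2 by ring,
    show 2 * x + 1 - 1 = 2 * (x - 1) + 2 by ring, show 2 * y + 1 - 1 = 2 * (y - 1) + 2 by ring,
    oddLoop_horizontal, oddLoop_horizontal, oddLoop_vertical, oddLoop_vertical]

lemma edgeCount_oddLoop_cell : edgeCount (oddLoop N c) (2 * x + 2) (2 * y + 2) =
    ind (OddHorizontal N c x y) + ind (OddHorizontal N c x (y + 1)) +
      ind (OddVertical N c x y) + ind (OddVertical N c (x + 1) y) := by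
  simp only [edgeCount, neighborSum]
  rw [show 2 * x + 2 - 1 = 2 * x + 1 by ring, show 2 * y + 2 - 1 = 2 * y + 1 by ring,
    show 2 * x + 2 + 1 = 2 * (x + 1) + 1 by ring, show 2 * y + 2 + 1 = 2 * (y + 1) + 1 by ring,
    oddLoop_horizontal, oddLoop_horizontal, oddLoop_vertical, oddLoop_vertical]
  ring

lemma edgeCount_oddLoop_vertex_mem (hc : c ∈ ({0, 1} : Finset ℤ)) (x y : ℤ) :
    edgeCount (oddLoop N c) (2 * x + 1) (2 * y + 1) ∈ ({0, 2} : Finset ℤ) := by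
  by_cases hgrid : x < 0 ∨ 2 * N + 1 ≤ x ∨ y < 0 ∨ 2 * N + 1 ≤ y
  · simp [withinGrid_oddLoop.edgeCount_eq_zero hgrid]
  rw [edgeCount_oddLoop_vertex]
  rcases lt_trichotomy (x + y) (2 * N) with hxy | hxy | hxy
  · rw [oddHorizontal_iff_lower (by omega), oddHorizontal_iff_lower (by omega),
      oddVertical_iff_lower (by omega), oddVertical_iff_lower (by omega)]
    exact lower_degree hc (by omega) (by omega)
  · rw [oddHorizontal_iff_upper (X := y - 1) (Y := x) (by omega) (by omega) (by omega),
      oddHorizontal_iff_lower (by omega),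
      oddVertical_iff_upper (X := y) (Y := x - 1) (by omega) (by omega) (by omega),
      oddVertical_iff_lower (by omega)]
    exact antidiagonal_degree hc (by omega) (by omega) (by omega)
  · rw [oddHorizontal_iff_upper (X := 2 * N - x - 1) (Y := 2 * N - y) (by omega) (by omega) rfl,
      oddHorizontal_iff_upper (X := 2 * N - x) (Y := 2 * N - y) (by omega) (by omega) rfl,
      oddVertical_iff_upper (X := 2 * N - x) (Y := 2 * N - y - 1) (by omega) rfl (by omega),
      oddVertical_iff_upper (X := 2 * N - x) (Y := 2 * N - y) (by omega) rfl (by omega)]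
    exact upper_degree hc (by omega) (by omega)

lemma edgeCount_oddLoop_cell_eq (hx : 0 ≤ x) (hxN : x < 2 * N) (hy : 0 ≤ y) (hyN : y < 2 * N) :
    edgeCount (oddLoop N 0) (2 * x + 2) (2 * y + 2) =
      edgeCount (oddLoop N 1) (2 * x + 2) (2 * y + 2) := by
  rw [edgeCount_oddLoop_cell, edgeCount_oddLoop_cell]
  rcases lt_trichotomy (x + y) (2 * N - 1) with hxy | hxy | hxy
  · simp only [oddHorizontal_iff_lower (show x + y ≤ 2 * N - 1 by omega),
      oddHorizontal_iff_lower (show x + (y + 1) ≤ 2 * N - 1 by omega),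
      oddVertical_iff_lower (show x + y ≤ 2 * N - 1 by omega),
      oddVertical_iff_lower (show x + 1 + y ≤ 2 * N - 1 by omega)]
    exact lower_cell hx hy
  · simp only [oddHorizontal_iff_lower (show x + y ≤ 2 * N - 1 by omega),
      oddHorizontal_iff_upper (show 2 * N ≤ x + (y + 1) by omega)
        (show 2 * N - 1 - x = y by omega) (show 2 * N - (y + 1) = x by omega),
      oddVertical_iff_lower (show x + y ≤ 2 * N - 1 by omega),
      oddVertical_iff_upper (show 2 * N ≤ x + 1 + y by omega)
        (show 2 * N - (x + 1) = y by omega) (show 2 * N - 1 - y = x by omega)]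
    exact antidiagonal_cell hx hy (by omega)
  · simp only [oddHorizontal_iff_upper (show 2 * N ≤ x + y by omega) rfl
        (show 2 * N - y = 2 * N - 1 - y + 1 by omega),
      oddHorizontal_iff_upper (show 2 * N ≤ x + (y + 1) by omega) rfl
        (show 2 * N - (y + 1) = 2 * N - 1 - y by omega),
      oddVertical_iff_upper (show 2 * N ≤ x + y by omega)
        (show 2 * N - x = 2 * N - 1 - x + 1 by omega) rfl,
      oddVertical_iff_upper (show 2 * N ≤ x + 1 + y by omega)
        (show 2 * N - (x + 1) = 2 * N - 1 - x by omega) rfl]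
    exact upper_cell (by omega) (by omega)

/-! ### Connectedness on odd square grids -/

/-- The two vertices are joined by a path in the loop `c`. -/
abbrev Joined (N c : ℤ) (u v : ℤ × ℤ) : Prop := (edgeGraph (oddLoop N c)).Reachable u v

/-- The half turn of the grid with `2 * N + 1` vertices on a side. -/
def halfTurn (N : ℤ) (v : ℤ × ℤ) : ℤ × ℤ := (2 * N - v.1, 2 * N - v.2)

/-- The lower end of the path inside the square `(X, Y)`. -/
def entry (X Y : ℤ) : ℤ × ℤ := (2 * X + 1 - (X + Y) % 2, 2 * Y)

/-- The upper end of the path inside the square `(X, Y)`. -/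
def exit (X Y : ℤ) : ℤ × ℤ := (2 * X + (X + Y) % 2, 2 * Y + 1)

lemma joined_of_lowerHorizontal {u v : ℤ × ℤ} (hv : v = (u.1 + 1, u.2))
    (h : LowerHorizontal c u.1 u.2) (hu : u.1 + u.2 ≤ 2 * N - 1) : Joined N c u v := by
  subst hv
  exact (edgeGraph_adj_right.2 (oddLoop_horizontal.2 (.inl ⟨hu, h⟩))).reachable

lemma joined_of_lowerVertical {u v : ℤ × ℤ} (hv : v = (u.1, u.2 + 1))
    (h : LowerVertical c u.1 u.2) (hu : u.1 + u.2 ≤ 2 * N - 1) : Joined N c u v := by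
  subst hv
  exact (edgeGraph_adj_up.2 (oddLoop_vertical.2 (.inl ⟨hu, h⟩))).reachable

lemma joined_of_upperHorizontal {u v : ℤ × ℤ} (hv : v = (u.1 + 1, u.2))
    (h : UpperHorizontal c u.1 u.2) (hu : u.1 + u.2 ≤ 2 * N - 1) :
    Joined N c (halfTurn N u) (halfTurn N v) := by
  subst hv
  have hodd := (oddHorizontal_iff_upper (N := N) (x := 2 * N - (u.1 + 1)) (y := 2 * N - u.2)
    (by omega) (by omega) (by omega)).2 h
  have hjoined := (edgeGraph_adj_right.2 (oddLoop_horizontal.2 hodd)).reachable.symm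
  rwa [show 2 * N - (u.1 + 1) + 1 = 2 * N - u.1 by ring] at hjoined

lemma joined_of_upperVertical {u v : ℤ × ℤ} (hv : v = (u.1, u.2 + 1))
    (h : UpperVertical c u.1 u.2) (hu : u.1 + u.2 ≤ 2 * N - 1) :
    Joined N c (halfTurn N u) (halfTurn N v) := by
  subst hv
  have hodd := (oddVertical_iff_upper (N := N) (x := 2 * N - u.1) (y := 2 * N - (u.2 + 1))
    (by omega) (by omega) (by omega)).2 h
  have hjoined := (edgeGraph_adj_up.2 (oddLoop_vertical.2 hodd)).reachable.symm
  rwa [show 2 * N - (u.2 + 1) + 1 = 2 * N - u.2 by ring] at hjoined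

/-- To be used with `R` the relation `Joined N c`, directly below the antidiagonal and through the
half turn beyond it. -/
lemma entry_rel_exit {R : ℤ × ℤ → ℤ × ℤ → Prop} (hR : Equivalence R)
    (hc : c ∈ ({0, 1} : Finset ℤ))
    (hhor : ∀ y, (X + y) % 2 = c → y / 2 = Y → R (2 * X, y) (2 * X + 1, y))
    (hver : ∀ x, (Y + x) % 2 = c → x / 2 = X → R (x, 2 * Y) (x, 2 * Y + 1)) :
    R (entry X Y) (exit X Y) := by
  simp only [Finset.mem_insert, Finset.mem_singleton] at hc
  unfold entry exit
  rcases Int.emod_two_eq_zero_or_one (X + Y) with hp | hp <;> rw [hp]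
  · rw [sub_zero, add_zero]
    by_cases h : X % 2 = c
    · exact hR.trans (hR.symm (hhor _ (by omega) (by omega))) (hver _ (by omega) (by omega))
    · exact hR.trans (hver _ (by omega) (by omega)) (hR.symm (hhor _ (by omega) (by omega)))
  · rw [add_sub_cancel_right]
    by_cases h : X % 2 = c
    · exact hR.trans (hhor _ (by omega) (by omega)) (hver _ (by omega) (by omega))
    · exact hR.trans (hver _ (by omega) (by omega)) (hhor _ (by omega) (by omega))

lemma joined_entry_exit (hc : c ∈ ({0, 1} : Finset ℤ)) (hX : 0 ≤ X) (hY : 0 ≤ Y)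
    (hXY : X + Y ≤ N - 1) : Joined N c (entry X Y) (exit X Y) := by
  refine entry_rel_exit (SimpleGraph.reachable_is_equivalence _) hc
    (fun y hy hyY => joined_of_lowerHorizontal rfl ?_ ?_)
    (fun x hx hxX => joined_of_lowerVertical rfl ?_ ?_)
  · refine ⟨by omega, by omega, .inl ⟨by omega, ?_⟩⟩
    rwa [Int.mul_ediv_cancel_left X two_ne_zero]
  · simp only
    omega
  · refine ⟨by omega, by omega, .inl ⟨by omega, ?_⟩⟩
    rwa [Int.mul_ediv_cancel_left Y two_ne_zero]
  · simp only
    omega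

lemma joined_halfTurn_entry_exit (hc : c ∈ ({0, 1} : Finset ℤ)) (hX : 0 ≤ X) (hY : 0 ≤ Y)
    (hXY : X + Y ≤ N - 1) : Joined N c (halfTurn N (entry X Y)) (halfTurn N (exit X Y)) := by
  have hc' : 1 - c ∈ ({0, 1} : Finset ℤ) := by
    simp only [Finset.mem_insert, Finset.mem_singleton] at hc ⊢
    omega
  refine entry_rel_exit (R := fun u v => Joined N c (halfTurn N u) (halfTurn N v))
    ((SimpleGraph.reachable_is_equivalence _).comap _) hc'
    (fun y hy hyY => joined_of_upperHorizontal rfl ?_ ?_)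
    (fun x hx hxX => joined_of_upperVertical rfl ?_ ?_)
  · refine ⟨by omega, by omega, .inl ⟨by omega, ?_⟩⟩
    rwa [Int.mul_ediv_cancel_left X two_ne_zero]
  · simp only
    omega
  · refine ⟨by omega, by omega, .inl ⟨by omega, ?_⟩⟩
    rwa [Int.mul_ediv_cancel_left Y two_ne_zero]
  · simp only
    omega

lemma entry_succ_right (X Y : ℤ) : entry X (Y + 1) = ((exit X Y).1, (exit X Y).2 + 1) := by
  simp only [entry, exit, Prod.mk.injEq]
  omega

lemma joined_exit_entry_above (hX : 0 ≤ X) (hY : 0 ≤ Y) (hXY : X + Y + 1 ≤ N - 1)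
    (h : 1 ≤ Y ∨ X = 0) : Joined N c (exit X Y) (entry X (Y + 1)) := by
  refine joined_of_lowerVertical (entry_succ_right X Y) ?_ ?_ <;>
    simp only [exit, LowerVertical]
  · rw [show (2 * X + (X + Y) % 2) / 2 = X by omega, show (2 * Y + 1) / 2 = Y by omega]
    omega
  · omega

lemma joined_halfTurn_exit_entry_above (hX : 0 ≤ X) (hY : 0 ≤ Y) (hXY : X + Y + 1 ≤ N - 1) :
    Joined N c (halfTurn N (exit X Y)) (halfTurn N (entry X (Y + 1))) := by
  refine joined_of_upperVertical (entry_succ_right X Y) ?_ ?_ <;>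
    simp only [exit, UpperVertical]
  · rw [show (2 * X + (X + Y) % 2) / 2 = X by omega, show (2 * Y + 1) / 2 = Y by omega]
    omega
  · omega

lemma joined_column (hc : c ∈ ({0, 1} : Finset ℤ)) (hX : 0 ≤ X) (hY : 1 ≤ Y)
    (hXY : X + Y ≤ N - 1) : Joined N c (entry X 1) (exit X Y) := by
  induction Y, hY using Int.leInduction with
  | base => exact joined_entry_exit hc hX zero_le_one hXY
  | succ Y hY ih =>
    exact ((ih (by omega)).trans
      (joined_exit_entry_above hX (by omega) (by omega) (.inl hY))).trans
        (joined_entry_exit hc hX (by omega) hXY)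

lemma joined_halfTurn_column (hc : c ∈ ({0, 1} : Finset ℤ)) (hX : 0 ≤ X) (hY : 0 ≤ Y)
    (hXY : X + Y ≤ N - 1) : Joined N c (halfTurn N (entry X 0)) (halfTurn N (exit X Y)) := by
  induction Y, hY using Int.leInduction with
  | base => exact joined_halfTurn_entry_exit hc hX le_rfl hXY
  | succ Y hY ih =>
    exact ((ih (by omega)).trans (joined_halfTurn_exit_entry_above hX hY (by omega))).trans
      (joined_halfTurn_entry_exit hc hX (by omega) hXY)

lemma joined_bottom_row (hc : c ∈ ({0, 1} : Finset ℤ)) (hX : 0 ≤ X) (hXN : X ≤ N - 1) :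
    Joined N c (entry 0 0) (entry X 0) := by
  induction X, hX using Int.leInduction with
  | base => exact .refl _
  | succ X hX ih =>
    have hrow := ih (by omega)
    rcases Int.emod_two_eq_zero_or_one X with hp | hp
    · refine hrow.trans (joined_of_lowerHorizontal ?_ ?_ ?_) <;>
        simp only [entry, LowerHorizontal, Prod.mk.injEq, and_true] <;> omega
    · have hleft := joined_entry_exit (N := N) (Y := 0) hc hX le_rfl (by omega)
      have hright :=
        joined_entry_exit (N := N) (X := X + 1) (Y := 0) hc (by omega) le_rfl (by omega)
      refine (hrow.trans hleft).trans (.trans (joined_of_lowerHorizontal ?_ ?_ ?_) hright.symm) <;>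
        simp only [exit, LowerHorizontal, Prod.mk.injEq, and_true] <;> omega

lemma joined_entry_one_succ_of_odd (hX : 0 ≤ X) (hodd : X % 2 = 1) (hXN : X + 1 ≤ N - 1) :
    Joined N c (entry X 1) (entry (X + 1) 1) := by
  refine joined_of_lowerHorizontal ?_ ?_ ?_ <;>
    simp only [entry, LowerHorizontal, Prod.mk.injEq, and_true] <;> omega

lemma joined_halfTurn_entry_zero_succ_of_even (hX : 0 ≤ X) (heven : X % 2 = 0)
    (hXN : X + 1 ≤ N - 1) :
    Joined N c (halfTurn N (entry X 0)) (halfTurn N (entry (X + 1) 0)) := by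
  refine joined_of_upperHorizontal ?_ ?_ ?_ <;>
    simp only [entry, UpperHorizontal, Prod.mk.injEq, and_true] <;> omega

lemma joined_entry_zero_entry_one (hc : c ∈ ({0, 1} : Finset ℤ)) (hN : 2 ≤ N) :
    Joined N c (entry 0 0) (entry 0 1) :=
  (joined_entry_exit hc le_rfl le_rfl (by omega)).trans
    (joined_exit_entry_above le_rfl le_rfl (by omega) (.inr rfl))

lemma exit_eq_halfTurn_exit (hN : N % 2 = 0) (X : ℤ) :
    exit X (N - 1 - X) = halfTurn N (exit (N - 1 - X) X) := by
  simp only [exit, halfTurn, Prod.mk.injEq]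
  omega

lemma joined_across_of_even (hc : c ∈ ({0, 1} : Finset ℤ)) (hN : N % 2 = 0) (hX : 0 ≤ X)
    (hXN : X ≤ N - 2) : Joined N c (entry X 1) (halfTurn N (entry (N - 1 - X) 0)) := by
  have hcolumn := joined_column (N := N) (Y := N - 1 - X) hc hX (by omega) (by omega)
  rw [exit_eq_halfTurn_exit hN] at hcolumn
  exact hcolumn.trans (joined_halfTurn_column hc (by omega) hX (by omega)).symm

lemma joined_antidiagonal (hc : c ∈ ({0, 1} : Finset ℤ)) (hN : N % 2 = 1) (hX : 0 ≤ X)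
    (hXN : X ≤ N - 2) : Joined N c (entry X 1) (2 * X, 2 * (N - X)) := by
  refine (joined_column (Y := N - 1 - X) hc hX (by omega) (by omega)).trans
    (joined_of_lowerVertical ?_ ?_ ?_) <;>
    simp only [exit, LowerVertical, Prod.mk.injEq] <;> omega

lemma joined_halfTurn_antidiagonal (hc : c ∈ ({0, 1} : Finset ℤ)) (hN : N % 2 = 1) (hX : 0 ≤ X)
    (hXN : X ≤ N - 1) :
    Joined N c (halfTurn N (entry X 0)) (halfTurn N (2 * X, 2 * (N - X))) := by
  refine (joined_halfTurn_column (Y := N - 1 - X) hc hX (by omega) (by omega)).trans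
    (joined_of_upperVertical ?_ ?_ ?_) <;>
    simp only [exit, UpperVertical, Prod.mk.injEq] <;> omega

lemma joined_across_of_odd (hc : c ∈ ({0, 1} : Finset ℤ)) (hN : N % 2 = 1) (hX : 1 ≤ X)
    (hXN : X ≤ N - 2) : Joined N c (entry X 1) (halfTurn N (entry (N - X) 0)) := by
  have hlower := joined_antidiagonal hc hN (by omega) hXN
  have hupper := joined_halfTurn_antidiagonal (X := N - X) hc hN (by omega) (by omega)
  have hmeet : halfTurn N (2 * (N - X), 2 * (N - (N - X))) = (2 * X, 2 * (N - X)) := by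
    simp only [halfTurn, Prod.mk.injEq]
    omega
  rw [hmeet] at hupper
  exact hlower.trans hupper.symm

/-- The first column of the lower part ends in the top left corner of the grid. -/
lemma joined_across_first_of_odd (hc : c ∈ ({0, 1} : Finset ℤ)) (hN : N % 2 = 1) (hN₂ : 2 ≤ N) :
    Joined N c (entry 0 1) (halfTurn N (entry (N - 1) 0)) := by
  have hlower := joined_antidiagonal hc hN le_rfl (by omega)
  have hcorner : Joined N c (halfTurn N (entry (N - 1) 0)) (halfTurn N (2 * N, 0)) := by
    refine joined_of_upperHorizontal ?_ ?_ ?_ <;>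
      simp only [entry, UpperHorizontal, Prod.mk.injEq] <;> omega
  rw [show halfTurn N (2 * N, 0) = (2 * 0, 2 * (N - 0)) by simp [halfTurn]] at hcorner
  exact hlower.trans hcorner.symm

/-- The last square of the bottom row is next to the bottom right corner of the grid. -/
lemma joined_bottom_right (hc : c ∈ ({0, 1} : Finset ℤ)) (hN : 1 ≤ N) :
    Joined N c (entry (N - 1) 0) (halfTurn N (entry 0 0)) := by
  rcases Int.emod_two_eq_zero_or_one N with hp | hp
  · have hlower := joined_entry_exit (N := N) (X := N - 1) (Y := 0) hc (by omega) le_rfl (by omega)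
    have hupper := joined_halfTurn_column (N := N) (Y := N - 1) hc le_rfl (by omega) (by omega)
    have hmeet : exit (N - 1) 0 = halfTurn N (exit 0 (N - 1)) := by
      simpa using exit_eq_halfTurn_exit hp (N - 1)
    rw [hmeet] at hlower
    exact hlower.trans hupper.symm
  · have hupper := joined_halfTurn_antidiagonal hc hp le_rfl (by omega)
    refine .trans (joined_of_lowerHorizontal ?_ ?_ ?_) hupper.symm <;>
      simp only [entry, halfTurn, LowerHorizontal, Prod.mk.injEq] <;> omega

/-- Below the antidiagonal the tops of the two columns are far apart, so the connection passes
through the upper part. -/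
lemma joined_entry_one_succ_of_even (hc : c ∈ ({0, 1} : Finset ℤ)) (hX : 0 ≤ X)
    (heven : X % 2 = 0) (hXN : X + 1 ≤ N - 2) : Joined N c (entry X 1) (entry (X + 1) 1) := by
  rcases Int.emod_two_eq_zero_or_one N with hp | hp
  · have hupper := joined_halfTurn_entry_zero_succ_of_even (N := N) (c := c) (X := N - 1 - (X + 1))
      (by omega) (by omega) (by omega)
    rw [show N - 1 - (X + 1) + 1 = N - 1 - X by ring] at hupper
    exact (joined_across_of_even hc hp hX (by omega)).trans
      (hupper.symm.trans (joined_across_of_even hc hp (by omega) hXN).symm)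
  · have hright := joined_across_of_odd hc hp (by omega) hXN
    rcases hX.eq_or_lt with rfl | hX
    · exact (joined_across_first_of_odd hc hp (by omega)).trans hright.symm
    · have hupper := joined_halfTurn_entry_zero_succ_of_even (N := N) (c := c) (X := N - (X + 1))
        (by omega) (by omega) (by omega)
      rw [show N - (X + 1) + 1 = N - X by ring] at hupper
      exact (joined_across_of_odd hc hp hX (by omega)).trans (hupper.symm.trans hright.symm)

lemma joined_entry_one (hc : c ∈ ({0, 1} : Finset ℤ)) (hX : 0 ≤ X) (hXN : X ≤ N - 2) :
    Joined N c (entry 0 0) (entry X 1) := by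
  induction X, hX using Int.leInduction with
  | base => exact joined_entry_zero_entry_one hc (by omega)
  | succ X hX ih =>
    refine (ih (by omega)).trans ?_
    rcases Int.emod_two_eq_zero_or_one X with hp | hp
    · exact joined_entry_one_succ_of_even hc hX hp hXN
    · exact joined_entry_one_succ_of_odd hX hp (by omega)

lemma joined_halfTurn_entry_zero (hc : c ∈ ({0, 1} : Finset ℤ)) (hX : 0 ≤ X) (hXN : X ≤ N - 1) :
    Joined N c (entry 0 0) (halfTurn N (entry X 0)) := by
  have hfirst : Joined N c (entry 0 0) (halfTurn N (entry 0 0)) :=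
    (joined_bottom_row hc (by omega) le_rfl).trans (joined_bottom_right hc (by omega))
  rcases hX.eq_or_lt with rfl | hX
  · exact hfirst
  rcases Int.emod_two_eq_zero_or_one N with hp | hp
  · have hacross := joined_across_of_even (X := N - 1 - X) hc hp (by omega) (by omega)
    rw [sub_sub_cancel] at hacross
    exact (joined_entry_one hc (by omega) (by omega)).trans hacross
  · by_cases hX₁ : X = 1
    · subst hX₁
      exact hfirst.trans (joined_halfTurn_entry_zero_succ_of_even le_rfl rfl (by omega))
    · have hacross := joined_across_of_odd (X := N - X) hc hp (by omega) (by omega)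
      rw [sub_sub_cancel] at hacross
      exact (joined_entry_one hc (by omega) (by omega)).trans hacross

lemma eq_entry_or_exit (hodd : (x + y + x / 2 + y / 2) % 2 = 1) :
    (x, y) = entry (x / 2) (y / 2) ∨ (x, y) = exit (x / 2) (y / 2) := by
  simp only [entry, exit, Prod.mk.injEq]
  omega

lemma joined_of_lower (hc : c ∈ ({0, 1} : Finset ℤ)) (hx : 0 ≤ x) (hy : 0 ≤ y)
    (hxy : x / 2 + y / 2 ≤ N - 1) (hodd : (x + y + x / 2 + y / 2) % 2 = 1) :
    Joined N c (entry 0 0) (x, y) := by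
  have hsquare := joined_entry_exit hc (by omega) (by omega) hxy
  have hexit : Joined N c (entry 0 0) (exit (x / 2) (y / 2)) := by
    by_cases hY : y / 2 = 0
    · rw [hY] at hsquare ⊢
      exact (joined_bottom_row hc (by omega) (by omega)).trans hsquare
    · exact (joined_entry_one hc (by omega) (by omega)).trans
        (joined_column hc (by omega) (by omega) hxy)
  rcases eq_entry_or_exit hodd with h | h <;> rw [h]
  · exact hexit.trans hsquare.symm
  · exact hexit

lemma joined_of_upper (hc : c ∈ ({0, 1} : Finset ℤ)) (hx : 0 ≤ x) (hy : 0 ≤ y)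
    (hxy : x / 2 + y / 2 ≤ N - 1) (hodd : (x + y + x / 2 + y / 2) % 2 = 1) :
    Joined N c (entry 0 0) (halfTurn N (x, y)) := by
  have hexit : Joined N c (entry 0 0) (halfTurn N (exit (x / 2) (y / 2))) :=
    (joined_halfTurn_entry_zero hc (by omega) (by omega)).trans
      (joined_halfTurn_column hc (by omega) (by omega) hxy)
  rcases eq_entry_or_exit hodd with h | h <;> rw [h]
  · exact hexit.trans (joined_halfTurn_entry_exit hc (by omega) (by omega) hxy).symm
  · exact hexit

lemma joined_of_oddHorizontal (hc : c ∈ ({0, 1} : Finset ℤ)) (h : OddHorizontal N c x y) :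
    Joined N c (entry 0 0) (x, y) ∨ Joined N c (entry 0 0) (x + 1, y) := by
  rcases h with ⟨hxy, hx, hy, h⟩ | ⟨hxy, hx, hy, h⟩
  · by_cases hodd : (x + y + x / 2 + y / 2) % 2 = 1
    · exact .inl (joined_of_lower hc hx hy (by omega) hodd)
    · exact .inr (joined_of_lower hc (by omega) hy (by omega) (by omega))
  · by_cases hodd : (2 * N - 1 - x + (2 * N - y) + (2 * N - 1 - x) / 2 + (2 * N - y) / 2) % 2 = 1
    · right
      convert joined_of_upper (N := N) hc hx hy (by omega) hodd using 1
      simp only [halfTurn, Prod.mk.injEq]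
      omega
    · left
      convert joined_of_upper (N := N) (x := 2 * N - x) (y := 2 * N - y) hc (by omega) hy
        (by omega) (by omega) using 1
      simp only [halfTurn, Prod.mk.injEq]
      omega

lemma joined_of_oddVertical (hc : c ∈ ({0, 1} : Finset ℤ)) (h : OddVertical N c x y) :
    Joined N c (entry 0 0) (x, y) ∨ Joined N c (entry 0 0) (x, y + 1) := by
  rcases h with ⟨hxy, hx, hy, h⟩ | ⟨hxy, hx, hy, h⟩
  · by_cases hodd : (x + y + x / 2 + y / 2) % 2 = 1
    · exact .inl (joined_of_lower hc hx hy (by omega) hodd)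
    · exact .inr (joined_of_lower hc hx (by omega) (by omega) (by omega))
  · by_cases hodd : (2 * N - x + (2 * N - 1 - y) + (2 * N - x) / 2 + (2 * N - 1 - y) / 2) % 2 = 1
    · right
      convert joined_of_upper (N := N) hc hx hy (by omega) hodd using 1
      simp only [halfTurn, Prod.mk.injEq]
      omega
    · left
      convert joined_of_upper (N := N) (x := 2 * N - x) (y := 2 * N - y) hc hx (by omega)
        (by omega) (by omega) using 1
      simp only [halfTurn, Prod.mk.injEq]
      omega

/-- Of two adjacent vertices, one is an end of the path inside its square. -/
lemma joined_of_adj (hc : c ∈ ({0, 1} : Finset ℤ)) {u w : ℤ × ℤ}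
    (h : (edgeGraph (oddLoop N c)).Adj u w) : Joined N c (entry 0 0) u := by
  suffices Joined N c (entry 0 0) u ∨ Joined N c (entry 0 0) w from
    this.elim id fun hw => hw.trans h.symm.reachable
  obtain ⟨x, y⟩ := u
  rcases h.1.cases with rfl | rfl | rfl | rfl
  · exact joined_of_oddHorizontal hc (oddLoop_horizontal.1 (edgeGraph_adj_right.1 h))
  · rw [edgeGraph_adj_left, show 2 * x = 2 * (x - 1) + 2 by ring, oddLoop_horizontal] at h
    simpa using (joined_of_oddHorizontal hc h).symm
  · exact joined_of_oddVertical hc (oddLoop_vertical.1 (edgeGraph_adj_up.1 h))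
  · rw [edgeGraph_adj_down, show 2 * y = 2 * (y - 1) + 2 by ring, oddLoop_vertical] at h
    simpa using (joined_of_oddVertical hc h).symm

lemma oddLoop_bottom (hN : 1 ≤ N) : oddLoop N c 4 1 := by
  rw [show (4 : ℤ) = 2 * 1 + 2 by norm_num, show (1 : ℤ) = 2 * 0 + 1 by norm_num,
    oddLoop_horizontal, oddHorizontal_iff_lower (by omega)]
  simp [LowerHorizontal]

lemma oddLoop_left (hN : 1 ≤ N) : oddLoop N c 1 4 := by
  rw [show (4 : ℤ) = 2 * 1 + 2 by norm_num, show (1 : ℤ) = 2 * 0 + 1 by norm_num,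
    oddLoop_vertical, oddVertical_iff_lower (by omega)]
  simp [LowerVertical]

lemma oddLoop_top (hN : 1 ≤ N) : oddLoop N c (4 * N - 2) (2 * (2 * N + 1) - 1) := by
  rw [show 4 * N - 2 = 2 * (2 * N - 2) + 2 by ring,
    show 2 * (2 * N + 1) - 1 = 2 * (2 * N) + 1 by ring, oddLoop_horizontal,
    oddHorizontal_iff_upper (X := 1) (Y := 0) (by omega) (by ring) (by ring)]
  simp [UpperHorizontal]

lemma oddLoop_right (hN : 1 ≤ N) : oddLoop N c (2 * (2 * N + 1) - 1) (4 * N - 2) := by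
  rw [show 4 * N - 2 = 2 * (2 * N - 2) + 2 by ring,
    show 2 * (2 * N + 1) - 1 = 2 * (2 * N) + 1 by ring, oddLoop_vertical,
    oddVertical_iff_upper (X := 0) (Y := 1) (by omega) (by ring) (by ring)]
  simp [UpperVertical]

lemma isLoop_oddLoop (hN : 1 ≤ N) (hc : c ∈ ({0, 1} : Finset ℤ)) :
    IsLoop (2 * N + 1) (2 * N + 1) (oddLoop N c) where
  supp := withinGrid_oddLoop
  degree x y := by simpa using edgeCount_oddLoop_vertex_mem hc x y
  connected := fun _ _ ⟨_, hu⟩ ⟨_, hv⟩ => (joined_of_adj hc hu).symm.trans (joined_of_adj hc hv)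
  nonempty := ⟨_, _, edgeGraph_adj_right (x := 1) (y := 0).2 (oddLoop_bottom hN)⟩

lemma hasLoopPair_odd (hN : 1 ≤ N) :
    HasLoopPair (2 * N + 1) (2 * N + 1) (edgeDiff (oddLoop N 0) (oddLoop N 1))
      (fun a b => oddLoop N 0 a b ∧ oddLoop N 1 a b) := by
  refine ⟨_, _, isLoop_oddLoop hN (by decide), isLoop_oddLoop hN (by decide), rfl,
    fun x y hx hxN hy hyN => ?_, fun _ _ h => h⟩
  rw [neighborSum_edgeDiff, sub_eq_zero]
  have hcell := edgeCount_oddLoop_cell_eq (N := N) (x := x - 1) (y := y - 1)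
    (by omega) (by omega) (by omega) (by omega)
  rwa [show 2 * (x - 1) + 2 = 2 * x by ring, show 2 * (y - 1) + 2 = 2 * y by ring] at hcell

lemma edgeDiff_oddLoop_diag {i : ℤ} (hi : 0 ≤ i) (hiN : i ≤ 2 * N) :
    edgeDiff (oddLoop N 0) (oddLoop N 1) (i + 1) i ≠ 0 ↔ i % 4 = 1 ∨ i % 4 = 2 := by
  rw [edgeDiff_ne_zero]
  rcases Int.even_or_odd' i with ⟨y, rfl | rfl⟩
  · rw [show 2 * y = 2 * (y - 1) + 2 by ring, show 2 * (y - 1) + 2 + 1 = 2 * y + 1 by ring,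
      oddLoop_vertical, oddLoop_vertical, oddVertical_iff_lower (by omega),
      oddVertical_iff_lower (by omega)]
    simp only [LowerVertical]
    omega
  · rw [show 2 * y + 1 + 1 = 2 * y + 2 by ring, oddLoop_horizontal, oddLoop_horizontal,
      oddHorizontal_iff_lower (by omega), oddHorizontal_iff_lower (by omega)]
    simp only [LowerHorizontal]
    omega

end OddLoop

lemma sum_range_ite_mod_four (N : ℕ) :
    ∑ i ∈ Finset.range (2 * N + 1), (if (i : ℤ) % 4 = 1 ∨ (i : ℤ) % 4 = 2 then (1 : ℤ) else 0) =
      N + N % 2 := by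
  induction N with
  | zero => simp
  | succ N ih =>
    rw [show 2 * (N + 1) + 1 = 2 * N + 1 + 1 + 1 by ring, Finset.sum_range_succ,
      Finset.sum_range_succ, ih]
    push_cast
    split_ifs <;> omega

lemma isAttained_of_odd_mul {N m' n' : ℕ} (hN : 1 ≤ N) (hm : 0 < m') (hn : 0 < n') :
    IsAttained ((2 * N + 1) * m') ((2 * N + 1) * n')
      (((2 * N + 1) * m' : ℕ) * ((2 * N + 1) * n' : ℕ) - m' * n') := by
  obtain ⟨k, rfl⟩ := Nat.exists_eq_add_of_le' hm
  obtain ⟨l, rfl⟩ := Nat.exists_eq_add_of_le' hn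
  have hN' : (1 : ℤ) ≤ N := by exact_mod_cast hN
  have hodd := hasLoopPair_odd hN'
  obtain ⟨f, K, hpair, hcopy, hzero⟩ := hodd.exists_array (by omega) (by omega) k l
    ⟨oddLoop_left hN', oddLoop_left hN'⟩ ⟨oddLoop_right hN', oddLoop_right hN'⟩
    ⟨oddLoop_bottom hN', oddLoop_bottom hN'⟩ ⟨oddLoop_top hN', oddLoop_top hN'⟩
  have hpair' : HasLoopPair ((2 * N + 1) * (k + 1) : ℕ) ((2 * N + 1) * (l + 1) : ℕ) f K := by
    rw [mul_comm (2 * N + 1), mul_comm (2 * N + 1)]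
    exact_mod_cast hpair
  have hones : ∑ i ∈ Finset.range (2 * N + 1), (if f (i + 1) i ≠ 0 then (1 : ℤ) else 0) =
      N + N % 2 := by
    rw [← sum_range_ite_mod_four]
    refine Finset.sum_congr rfl fun i hi => ?_
    rw [Finset.mem_range] at hi
    rw [hcopy _ _ (by omega) (by omega)]
    exact if_congr (edgeDiff_oddLoop_diag (by omega) (by omega)) rfl rfl
  refine ⟨f, K, hpair', ?_⟩
  rw [hpair'.supportCard_eq rfl rfl (by positivity) (by positivity)
    (by exact_mod_cast hzero _ le_rfl fun b => hodd.eq_zero (by omega)), hones]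
  push_cast
  rcases Int.emod_two_eq_zero_or_one N with h | h <;> rw [h] <;> ring

lemma isAttained_zero {m n : ℕ} (hm : 2 ≤ m) (hn : 2 ≤ n) : IsAttained m n 0 := by
  have hsquare : IsLoop m n (polygon square) := isLoop_square.mono (by omega) (by omega)
  have hzero : edgeDiff (polygon square) (polygon square) = fun _ _ => 0 := by
    funext a b
    exact sub_self _
  refine ⟨_, fun _ _ => False,
    ⟨_, _, hsquare, hsquare, hzero, fun _ _ _ _ _ _ => rfl, fun _ _ h => h.elim⟩, ?_⟩
  simp [supportCard]

lemma isAttained_of_odd {q m' n' : ℕ} (hq : Odd q) (hm : 2 ≤ q * m') (hn : 2 ≤ q * n') :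
    IsAttained (q * m') (q * n') ((q * m' : ℕ) * (q * n' : ℕ) - m' * n') := by
  obtain ⟨N, rfl⟩ := hq
  rcases N.eq_zero_or_pos with rfl | hN
  · simpa using isAttained_zero hm hn
  · exact isAttained_of_odd_mul hN (Nat.pos_of_mul_pos_left (zero_lt_two.trans_le hm))
      (Nat.pos_of_mul_pos_left (zero_lt_two.trans_le hn))

lemma isAttained_of_gcd_mod_four_eq_two {m n : ℕ} (hgcd : m.gcd n % 4 = 2) (hm : 4 ≤ m)
    (hn : 4 ≤ n) (h4 : 4 ∣ m ∨ 4 ∣ n) : IsAttained m n (m * n) := by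
  have h2 : 2 ∣ m.gcd n := by omega
  have hm2 : 2 ∣ m := h2.trans (Nat.gcd_dvd_left m n)
  have hn2 : 2 ∣ n := h2.trans (Nat.gcd_dvd_right m n)
  have hboth : ¬(4 ∣ m ∧ 4 ∣ n) := fun h => by
    have := Nat.dvd_gcd h.1 h.2
    omega
  rcases h4 with h4 | h4
  · rw [mul_comm]
    exact (isAttained_of_mod_four_eq_two (by omega) h4 hn (by omega)).transpose
  · exact isAttained_of_mod_four_eq_two (by omega) h4 hm (by omega)

lemma four_dvd_mul_or_four_dvd_mul {d m' n' : ℕ} (hd : 0 < d) (h2 : 2 ∣ d)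
    (heven : Even (d * m' * (d * n') / d ^ 2)) : 4 ∣ d * m' ∨ 4 ∣ d * n' := by
  rw [show d * m' * (d * n') = m' * n' * d ^ 2 by ring, Nat.mul_div_cancel _ (by positivity),
    Nat.even_mul] at heven
  exact heven.imp (fun h => mul_dvd_mul h2 h.two_dvd) fun h => mul_dvd_mul h2 h.two_dvd

lemma isAttained_delta {m n d m' n' : ℕ} (hm : 2 ≤ m) (hn : 2 ≤ n) (hd : d = Nat.gcd m n)
    (hm' : m = d * m') (hn' : n = d * n') :
    IsAttained m n (m * n - delta m n * m' * n') := by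
  unfold delta
  rw [← hd]
  split_ifs with hodd h0 h2
  · subst hm' hn'
    simpa using isAttained_of_odd hodd hm hn
  · have h4 : 4 ∣ m.gcd n := hd ▸ Nat.dvd_of_mod_eq_zero h0
    simpa using isAttained_of_four_dvd (h4.trans (Nat.gcd_dvd_left m n))
      (h4.trans (Nat.gcd_dvd_right m n)) (by omega) (by omega)
  · obtain ⟨hmod, hm4, hn4, heven⟩ := h2
    have h4 : 4 ∣ m ∨ 4 ∣ n := by
      rw [hm', hn'] at heven ⊢
      exact four_dvd_mul_or_four_dvd_mul (by omega) (by omega) heven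
    simpa using isAttained_of_gcd_mod_four_eq_two (hd ▸ hmod) hm4 hn4 h4
  · obtain ⟨q, rfl⟩ := Nat.not_odd_iff_even.1 hodd
    have hq : Odd q := Nat.odd_iff.2 (by omega)
    rw [← mul_two, mul_assoc] at hm' hn'
    subst hm' hn'
    convert isAttained_of_odd hq hm hn using 1
    push_cast
    ring

end Slitherlink

theorem mainTheorem2 (m n d m' n' : ℕ) (hm : 2 ≤ m) (hn : 2 ≤ n) (hd : d = Nat.gcd m n)
    (hm' : m = d * m') (hn' : n = d * n') :
    IsGreatest
      {s : ℤ | ∃ C₁ C₂ : Finset (Sym2 (Fin m × Fin n)),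
        Slitherlink.IsCycle C₁ ∧ Slitherlink.IsCycle C₂ ∧
        Slitherlink.signature C₁ = Slitherlink.signature C₂ ∧
        s = ((symmDiff C₁ C₂).card : ℤ)}
      ((m : ℤ) * (n : ℤ) - (Slitherlink.delta m n : ℤ) * (m' : ℤ) * (n' : ℤ)) := by
  constructor
  · obtain ⟨f, K, ⟨e₁, e₂, h₁, h₂, rfl, hc, -⟩, hcard⟩ :=
      Slitherlink.isAttained_delta hm hn hd hm' hn'
    obtain ⟨C₁, C₂, hC₁, hC₂, hs, hC⟩ := Slitherlink.exists_isCycle_pair h₁ h₂ hc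
    exact ⟨C₁, C₂, hC₁, hC₂, hs, by rw [hC, hcard]⟩
  · rintro s ⟨C₁, C₂, h₁, h₂, hs, rfl⟩
    exact h₁.card_symmDiff_le hm hn hd hm' hn' h₂ hs
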